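/- **Conventions.** Inner products are linear in the second variable, $\mathcal L(H,K)$ denotes the bounded operators between Hilbert spaces, and $[Y]$ the closed linear span of $Y$. A *$C^*$-base* $\mathfrak b=(\mathfrak K,\mathfrak B,\mathfrak B^\dagger)$ is a Hilbert space $\mathfrak K$ with two commuting nondegenerate $C^*$-algebras $\mathfrak B,\mathfrak B^\dagger\subseteq\mathcal L(\mathfrak K)$; put $\mathfrak b^\dagger=(\mathfrak K,\mathfrak B^\dagger,\mathfrak B)$. A *$C^*$-$\mathfrak b$-module* $H_\alpha$ is a Hilbert space $H$ with a closed subspace $\alpha\subseteq\mathcal L(\mathfrak K,H)$ such that $[\alpha\mathfrak K]=H$, $[\alpha\mathfrak B]=\alpha$, $[\alpha^*\alpha]=\mathfrak B$; it carries the representation $\rho_\alpha:\mathfrak B^\dagger\to\mathcal L(H)$, $\rho_\alpha(y)\xi\zeta=\xi y\zeta$ ($\xi\in\alpha$, $\zeta\in\mathfrak K$). A *$C^*$-$(\mathfrak b^\dagger,\mathfrak b)$-module* $(H,\beta,\alpha)$ is a $C^*$-$\mathfrak b^\dagger$-module $H_\beta$ that is also a $C^*$-$\mathfrak b$-module $H_\alpha$,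 with $[\rho_\beta(\mathfrak B)\alpha]=\alpha$ and $[\rho_\alpha(\mathfrak B^\dagger)\beta]=\beta$. A *$C^*$-$(\mathfrak b^\dagger,\mathfrak b)$-algebra* $A_H^{\beta,\alpha}$ is such a module with a $C^*$-algebra $A\subseteq\mathcal L(H)$ satisfying $\rho_\beta(\mathfrak B)A\subseteq A$ and $\rho_\alpha(\mathfrak B^\dagger)A\subseteq A$. For a $C^*$-$\mathfrak b$-module $H_\alpha$ and a $C^*$-$\mathfrak b^\dagger$-module $K_\gamma$, the *relative tensor product* $H\,{}_\alpha\!\otimes_\gamma K$ is the Hilbert space generated by elements $\xi\otimes\zeta\otimes\eta$ ($\xi\in\alpha,\zeta\in\mathfrak K,\eta\in\gamma$) with $\langle\xi\otimes\zeta\otimes\eta|\xi'\otimes\zeta'\otimes\eta'\rangle=\langle\zeta|\xi^*\xi'\eta^*\eta'\zeta'\rangle$. The operators $|\xi\rangle_1:K\to H\,{}_\alpha\!\otimes_\gamma K$ and $|\eta\rangle_2:H\to H\,{}_\alpha\!\otimes_\gamma K$ are given by $|\xi\rangle_1(\eta\zeta)=\xi\otimes\zeta\otimes\eta=|\eta\rangle_2(\xi\zeta)$;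 $\langle\xi|_1,\langle\eta|_2$ are their adjoints, $|\alpha\rangle_1=\{|\xi\rangle_1:\xi\in\alpha\}$ and $|\gamma\rangle_2=\{|\eta\rangle_2:\eta\in\gamma\}$. For $A\subseteq\mathcal L(H)$ and $C\subseteq\mathcal L(K)$, the *fiber product* $A\,{}_\alpha\!*_\gamma C$ consists of all $x\in\mathcal L(H\,{}_\alpha\!\otimes_\gamma K)$ with $x|\alpha\rangle_1,x^*|\alpha\rangle_1\subseteq[|\alpha\rangle_1C]$ and $x|\gamma\rangle_2,x^*|\gamma\rangle_2\subseteq[|\gamma\rangle_2A]$. A *normal Hopf $C^*$-bimodule* over $\mathfrak b$ is a $C^*$-$(\mathfrak b^\dagger,\mathfrak b)$-algebra $A_H^{\beta,\alpha}$ with a $*$-homomorphism $\Delta:A\to A\,{}_\alpha\!*_\beta A$ such that the following two conditions hold. * *Joint normality.* Put $\beta\triangleleft\beta=[|\beta\rangle_2\beta]$ and $\alpha\triangleright\alpha=[|\alpha\rangle_1\alpha]$. Let $I$ be the set of all $S\in\mathcal L(H,H\,{}_\alpha\!\otimes_\beta H)$ with $Sa=\Delta(a)S$ for all $a\in A$,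 $S\beta\subseteq\beta\triangleleft\beta$, $S^*(\beta\triangleleft\beta)\subseteq\beta$, $S\alpha\subseteq\alpha\triangleright\alpha$ and $S^*(\alpha\triangleright\alpha)\subseteq\alpha$. Then $[I\beta]=\beta\triangleleft\beta$ and $[I\alpha]=\alpha\triangleright\alpha$. * *Coassociativity.* $(\Delta*\mathrm{Id})(\Delta(a))=(\mathrm{Id}*\Delta)(\Delta(a))$ for all $a\in A$ as operators on $H\,{}_\alpha\!\otimes_\beta H\,{}_\alpha\!\otimes_\beta H$. Here $(\Delta*\mathrm{Id})(x)$ and $(\mathrm{Id}*\Delta)(x)$ are the operators with $(\Delta*\mathrm{Id})(x)(S\otimes\mathrm{Id})=(S\otimes\mathrm{Id})x$ and $(\mathrm{Id}*\Delta)(x)(\mathrm{Id}\otimes S)=(\mathrm{Id}\otimes S)x$ for all $S$ with $Sa=\Delta(a)S$ $(a\in A)$ for which $S\otimes \mathrm{Id}$ respectively $\mathrm{Id}\otimes S$ is defined, and $(H\otimes H)\otimes H$, formed with $\alpha\triangleright\alpha$ and $\beta$, is identified with $H\otimes(H\otimes H)$, formed with $\alpha$ and $\beta\triangleleft\beta$,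 via $|\eta\rangle_2|\xi\rangle_1h\mapsto|\xi\rangle_1|\eta\rangle_2h$ ($\xi\in\alpha$, $\eta\in\beta$, $h\in H$). For $\gamma,\delta\in\{\alpha,\beta\}$ let $\gamma^\infty$ be the set of all sequences $\xi=(\xi_n)_n$ in $\gamma$ for which $\sum_n\xi_n^*\xi_n$ converges in norm, and $\|\xi\|=\|\sum_n\xi_n^*\xi_n\|^{1/2}$. For $\xi\in\gamma^\infty$, $\xi'\in\delta^\infty$ put $\omega_{\xi,\xi'}:A\to\mathcal L(\mathfrak K)$, $\omega_{\xi,\xi'}(a)=\sum_n\xi_n^*a\xi'_n$. Let $\Omega_{\gamma,\delta}(A)=\{\omega_{\xi,\xi'}:\xi\in\gamma^\infty,\xi'\in\delta^\infty\}$, with pointwise linear operations and $\|\omega\|=\inf\{\|\xi\|\|\xi'\|:\omega=\omega_{\xi,\xi'}\}$, and $\Omega_\gamma(A)=\Omega_{\gamma,\gamma}(A)$. For $x\in A\,{}_\alpha\!*_\beta A$ define $(\omega\boxtimes\omega')(x)\in\mathcal L(\mathfrak K)$ as follows. * On $\Omega_\beta(A)$: $\omega\boxtimes\omega'=\omega\circ(\mathrm{Id}*\omega')$,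 where $(\mathrm{Id}*\omega_{\eta,\eta'})(x)=\sum_n\langle\eta_n|_2x|\eta'_n\rangle_2\in A$. * On $\Omega_\alpha(A)$: $\omega\boxtimes\omega'=\omega'\circ(\omega*\mathrm{Id})$, where $(\omega_{\xi,\xi'}*\mathrm{Id})(x)=\sum_n\langle\xi_n|_1x|\xi'_n\rangle_1\in A$. * On $\Omega_{\beta,\alpha}(A)$: $(\omega_{\xi,\xi'}\boxtimes\omega_{\eta,\eta'})(x)=\sum_{m,n}(|\eta_n\rangle_2\xi_m)^*\,x\,(|\xi'_m\rangle_1\eta'_n)$ for $\xi,\eta\in\beta^\infty$ and $\xi',\eta'\in\alpha^\infty$. * On $\Omega_{\alpha,\beta}(A)$: $(\omega_{\xi',\xi}\boxtimes\omega_{\eta',\eta})(x)=\sum_{m,n}(|\xi'_m\rangle_1\eta'_n)^*\,x\,(|\eta_n\rangle_2\xi_m)$ for $\xi,\eta\in\beta^\infty$ and $\xi',\eta'\in\alpha^\infty$. **Theorem.** Let $(A_H^{\beta,\alpha},\Delta)$ be a normal Hopf $C^*$-bimodule over a $C^*$-base $\mathfrak b$. Then each of the four sets $\Omega_\alpha(A)$,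 $\Omega_\beta(A)$, $\Omega_{\alpha,\beta}(A)$, $\Omega_{\beta,\alpha}(A)$ is a linear space on which $\|\cdot\|$ is a complete norm, the product $\omega*\omega'=(\omega\boxtimes\omega')\circ\Delta$ is well defined on it (all sums converge in norm, the result does not depend on the representing sequences and lies again in the same set), and with this product it is an associative, not necessarily unital, complex Banach algebra: the product is bilinear, $(\omega*\omega')*\omega''=\omega*(\omega'*\omega'')$ and $\|\omega*\omega'\|\le\|\omega\|\,\|\omega'\|$. -/

import Mathlib

set_option linter.unusedSectionVars false
open scoped InnerProduct InnerProductSpace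
namespace CStarRel

/-- The closed linear span `[S]` of a subset of a normed space. -/
def clspan {E : Type*} [NormedAddCommGroup E] [NormedSpace ℂ E] (S : Set E) : Submodule ℂ E :=
  (Submodule.span ℂ S).topologicalClosure

section Span
variable {E F : Type*} [NormedAddCommGroup E] [NormedSpace ℂ E]
  [NormedAddCommGroup F] [NormedSpace ℂ F]

theorem subset_clspan (S : Set E) : S ⊆ clspan S :=
  fun _ hx => Submodule.le_topologicalClosure _ (Submodule.subset_span hx)

theorem isClosed_clspan (S : Set E) : IsClosed (clspan S : Set E) :=
  Submodule.isClosed_topologicalClosure _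

theorem clspan_le {S : Set E} {W : Submodule ℂ E} (hW : IsClosed (W : Set E)) (h : S ⊆ W) :
    clspan S ≤ W :=
  Submodule.topologicalClosure_minimal _ (Submodule.span_le.2 h) hW

theorem map_mem_of_clspan {σ : ℂ →+* ℂ} {S : Set E} {W : Submodule ℂ F}
    (hW : IsClosed (W : Set F)) (g : E →SL[σ] F) (h : ∀ x ∈ S, g x ∈ W) {x : E}
    (hx : x ∈ clspan S) : g x ∈ W := by
  have : clspan S ≤ W.comap g.toLinearMap :=
    clspan_le (hW.preimage g.continuous) h
  exact this hx

/-- The continuous linear map determined by `f i ↦ g i` on a total family `f`. -/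
noncomputable def extendFamily {X : Type*} [CompleteSpace F] (f : X → E) (g : X → F) : E →L[ℂ] F :=
  (Finsupp.linearCombination ℂ g).extendOfNorm (Finsupp.linearCombination ℂ f)

theorem extendFamily_apply {X : Type*} [CompleteSpace F] {f : X → E} {g : X → F}
    (hf : clspan (Set.range f) = ⊤) (C : ℝ)
    (hC : ∀ (s : Finset X) (c : s → ℂ), ‖∑ i : s, c i • g i‖ ≤ C * ‖∑ i : s, c i • f i‖)
    (x : X) : extendFamily f g (f x) = g x := by
  have hd : DenseRange (Finsupp.linearCombination ℂ f) := by
    have : (LinearMap.range (Finsupp.linearCombination ℂ f)).topologicalClosure = ⊤ := by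
      rw [Finsupp.range_linearCombination]; exact hf
    exact (Submodule.dense_iff_topologicalClosure_eq_top.2 this)
  have h := LinearMap.extendOfNorm_eq (f := Finsupp.linearCombination ℂ g)
    (e := Finsupp.linearCombination ℂ f) hd ⟨C, fun c => by
      have := hC c.support (fun i => c i)
      rw [Finset.sum_coe_sort c.support (fun i => c i • g i),
        Finset.sum_coe_sort c.support (fun i => c i • f i)] at this
      simpa [Finsupp.linearCombination_apply, Finsupp.sum] using this⟩ (Finsupp.single x 1)
  simpa [extendFamily] using h

theorem norm_extendFamily_le {X : Type*} [CompleteSpace F] {f : X → E} {g : X → F}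
    (hf : clspan (Set.range f) = ⊤) (C : ℝ) (h0 : 0 ≤ C)
    (hC : ∀ (s : Finset X) (c : s → ℂ), ‖∑ i : s, c i • g i‖ ≤ C * ‖∑ i : s, c i • f i‖) :
    ‖extendFamily f g‖ ≤ C := by
  have hd : DenseRange (Finsupp.linearCombination ℂ f) := by
    have : (LinearMap.range (Finsupp.linearCombination ℂ f)).topologicalClosure = ⊤ := by
      rw [Finsupp.range_linearCombination]; exact hf
    exact (Submodule.dense_iff_topologicalClosure_eq_top.2 this)
  refine LinearMap.opNorm_extendOfNorm_le hd h0 fun c => ?_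
  have := hC c.support (fun i => c i)
  rw [Finset.sum_coe_sort c.support (fun i => c i • g i),
    Finset.sum_coe_sort c.support (fun i => c i • f i)] at this
  simpa [Finsupp.linearCombination_apply, Finsupp.sum] using this

theorem eq_of_eqOn_total {S : Set E} (hS : clspan S = ⊤) {T T' : E →L[ℂ] F}
    (h : ∀ x ∈ S, T x = T' x) : T = T' := by
  ext x
  have hx : x ∈ clspan S := hS ▸ Submodule.mem_top
  have : (T - T') x ∈ (⊥ : Submodule ℂ F) :=
    map_mem_of_clspan (by simp) (T - T') (fun y hy => by simp [h y hy]) hx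
  simpa [sub_eq_zero] using this

end Span

section Gram

theorem exists_sqrt {E K : Type*} [NormedAddCommGroup E] [InnerProductSpace ℂ E] [CompleteSpace E]
    [NormedAddCommGroup K] [InnerProductSpace ℂ K] [CompleteSpace K] (T : E →L[ℂ] K) :
    ∃ S : E →L[ℂ] E, (∀ u v, ⟪S u, S v⟫_ℂ = ⟪T u, T v⟫_ℂ) ∧
      ∀ D : E →L[ℂ] E, Commute ((T†) ∘L T) D → Commute S D := by
  have h0 : 0 ≤ (T†) ∘L T := by
    rw [ContinuousLinearMap.nonneg_iff_isPositive]
    exact ContinuousLinearMap.isPositive_adjoint_comp_self _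
  refine ⟨CFC.sqrt ((T†) ∘L T), fun u v => ?_, fun D hD => hD.cfcₙ_nnreal _⟩
  have h1 : (CFC.sqrt ((T†) ∘L T))† = CFC.sqrt ((T†) ∘L T) :=
    (IsSelfAdjoint.of_nonneg (CFC.sqrt_nonneg ((T†) ∘L T))).star_eq
  have h2 : CFC.sqrt ((T†) ∘L T) (CFC.sqrt ((T†) ∘L T) v) = ((T†) ∘L T) v :=
    DFunLike.congr_fun (CFC.sqrt_mul_sqrt_self ((T†) ∘L T) h0) v
  rw [← ContinuousLinearMap.adjoint_inner_right, h1, h2]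
  simp [ContinuousLinearMap.adjoint_inner_right]

theorem norm_sq_eq {H : Type*} [NormedAddCommGroup H] [InnerProductSpace ℂ H] (x : H) :
    ((‖x‖ : ℝ) : ℂ) ^ 2 = ⟪x, x⟫_ℂ := by
  rw [inner_self_eq_norm_sq_to_K]; rfl

theorem adjoint_id' (H : Type*) [NormedAddCommGroup H] [InnerProductSpace ℂ H] [CompleteSpace H] :
    ((ContinuousLinearMap.id ℂ H)†) = ContinuousLinearMap.id ℂ H :=
  star_one (H →L[ℂ] H)

variable {ι 𝔎 H K : Type*} [Fintype ι] [DecidableEq ι]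
  [NormedAddCommGroup 𝔎] [InnerProductSpace ℂ 𝔎] [CompleteSpace 𝔎]
  [NormedAddCommGroup H] [InnerProductSpace ℂ H] [CompleteSpace H]
  [NormedAddCommGroup K] [InnerProductSpace ℂ K] [CompleteSpace K]

/-- The `j`-th coordinate embedding of `𝔎` into the Hilbert space `𝔎^ι`. -/
noncomputable def inj (j : ι) : 𝔎 →L[ℂ] PiLp 2 (fun _ : ι => 𝔎) :=
  LinearMap.mkContinuous
    { toFun := fun u => PiLp.single 2 j u
      map_add' := fun u v => by simp [PiLp.single_add]
      map_smul' := fun c u => by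
        ext k; by_cases h : k = j
        · subst h; simp
        · simp [h] } 1 (fun u => by simp)

theorem inj_apply (j k : ι) (u : 𝔎) : inj j u k = if k = j then u else 0 := by
  by_cases h : k = j
  · subst h; simp [inj]
  · simp [inj, h]

theorem inner_inj (j : ι) (u : 𝔎) (v : PiLp 2 (fun _ : ι => 𝔎)) :
    ⟪inj j u, v⟫_ℂ = ⟪u, v j⟫_ℂ := by
  rw [PiLp.inner_apply, Finset.sum_eq_single j]
  · simp [inj_apply]
  · intro k _ hk; simp [inj_apply, hk]
  · simp

/-- The row operator `𝔎^ι → K` of a family of operators. -/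
noncomputable def row (η : ι → 𝔎 →L[ℂ] K) : PiLp 2 (fun _ : ι => 𝔎) →L[ℂ] K :=
  ∑ i, η i ∘L PiLp.proj 2 (fun _ : ι => 𝔎) i

theorem row_apply (η : ι → 𝔎 →L[ℂ] K) (v : PiLp 2 (fun _ : ι => 𝔎)) :
    row η v = ∑ i, η i (v i) := by
  simp [row]

theorem row_inj (η : ι → 𝔎 →L[ℂ] K) (j : ι) (u : 𝔎) : row η (inj j u) = η j u := by
  rw [row_apply, Finset.sum_eq_single j]
  · simp [inj_apply]
  · intro k _ hk; simp [inj_apply, hk]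
  · simp

theorem row_adjoint_apply (η : ι → 𝔎 →L[ℂ] K) (w : K) (j : ι) :
    (((row η)†) w) j = ((η j)†) w := by
  refine ext_inner_left ℂ fun u => ?_
  rw [← inner_inj, ContinuousLinearMap.adjoint_inner_right, ContinuousLinearMap.adjoint_inner_right,
    row_inj]

/-- A square root of the Gram operator of a family of operators. -/
noncomputable def gramSqrt (η : ι → 𝔎 →L[ℂ] K) :
    PiLp 2 (fun _ : ι => 𝔎) →L[ℂ] PiLp 2 (fun _ : ι => 𝔎) :=
  (exists_sqrt (row η)).choose

/-- The matrix entries of a square root of the Gram matrix `((η i)†) (η j)`. -/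
noncomputable def entry (η : ι → 𝔎 →L[ℂ] K) (k j : ι) : 𝔎 →L[ℂ] 𝔎 :=
  PiLp.proj 2 (fun _ : ι => 𝔎) k ∘L gramSqrt η ∘L inj j

theorem entry_apply (η : ι → 𝔎 →L[ℂ] K) (k j : ι) (u : 𝔎) :
    entry η k j u = gramSqrt η (inj j u) k := rfl

theorem sum_inner_entry (η : ι → 𝔎 →L[ℂ] K) (i j : ι) (u v : 𝔎) :
    ∑ k, ⟪entry η k i u, entry η k j v⟫_ℂ = ⟪η i u, η j v⟫_ℂ := by
  have := (exists_sqrt (row η)).choose_spec.1 (inj i u) (inj j v)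
  rw [row_inj, row_inj, PiLp.inner_apply] at this
  exact this

theorem entry_comm (η : ι → 𝔎 →L[ℂ] K) {T : 𝔎 →L[ℂ] 𝔎}
    (hT : ∀ i j u, ((η i)†) (η j (T u)) = T (((η i)†) (η j u))) (k j : ι) (u : 𝔎) :
    entry η k j (T u) = T (entry η k j u) := by
  set D : PiLp 2 (fun _ : ι => 𝔎) →L[ℂ] PiLp 2 (fun _ : ι => 𝔎) :=
    ∑ i, inj i ∘L T ∘L PiLp.proj 2 (fun _ : ι => 𝔎) i with hD
  have hDa : ∀ v i, D v i = T (v i) := fun v i => by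
    rw [hD]
    simp only [sum_apply, ContinuousLinearMap.comp_apply, PiLp.proj_apply,
      WithLp.ofLp_sum, Finset.sum_apply, inj_apply]
    simp
  have hc : Commute (((row η)†) ∘L row η) D := by
    ext v i
    change (((row η)†) (row η (D v))) i = D (((row η)†) (row η v)) i
    rw [hDa, row_adjoint_apply, row_adjoint_apply, row_apply, row_apply]
    simp only [map_sum, hDa, hT]
  have h := DFunLike.congr_fun ((exists_sqrt (row η)).choose_spec.2 D hc) (inj j u)
  have h' : gramSqrt η (D (inj j u)) = D (gramSqrt η (inj j u)) := h
  have h3 : D (inj j u) = inj j (T u) := by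
    ext i
    rw [hDa, inj_apply, inj_apply]
    split_ifs <;> simp
  rw [entry_apply, entry_apply, ← hDa, ← h', h3]

/-- The key identity: both Gram matrices commuting, the Schur product form is a sum of squares. -/
theorem gram_identity (η : ι → 𝔎 →L[ℂ] K) (ξ : ι → 𝔎 →L[ℂ] H)
    (hc : ∀ i j k l u, ((ξ i)†) (ξ j (((η k)†) (η l u))) = ((η k)†) (η l (((ξ i)†) (ξ j u))))
    (ζ : ι → 𝔎) :
    ∑ i, ∑ j, ⟪ζ i, ((ξ i)†) (ξ j (((η i)†) (η j (ζ j))))⟫_ℂ =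
      ((∑ k, ‖∑ j, ξ j (entry η k j (ζ j))‖ ^ 2 : ℝ) : ℂ) := by
  push_cast
  have h1 : ∀ k, ((‖∑ j, ξ j (entry η k j (ζ j))‖ : ℝ) : ℂ) ^ 2 =
      ∑ i, ∑ j, ⟪entry η k i (ζ i), entry η k j (((ξ i)†) (ξ j (ζ j)))⟫_ℂ := fun k => by
    rw [norm_sq_eq, sum_inner]
    refine Finset.sum_congr rfl fun i _ => ?_
    rw [inner_sum]
    refine Finset.sum_congr rfl fun j _ => ?_
    have := entry_comm η (T := ((ξ i)†) ∘L ξ j) (fun a b u => (hc i j a b u).symm) k j (ζ j)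
    simp only [ContinuousLinearMap.comp_apply] at this
    rw [this, ContinuousLinearMap.adjoint_inner_right]
  simp only [h1]
  symm
  rw [Finset.sum_comm]
  refine Finset.sum_congr rfl fun i _ => ?_
  rw [Finset.sum_comm]
  refine Finset.sum_congr rfl fun j _ => ?_
  rw [sum_inner_entry, hc, ContinuousLinearMap.adjoint_inner_right]

theorem gram_identity_one (η : ι → 𝔎 →L[ℂ] K) (ζ : ι → 𝔎) :
    ‖∑ j, η j (ζ j)‖ ^ 2 = ∑ k, ‖∑ j, entry η k j (ζ j)‖ ^ 2 := by
  have h := gram_identity η (fun _ => ContinuousLinearMap.id ℂ 𝔎)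
    (by simp [adjoint_id']) ζ
  rw [← Complex.ofReal_inj]
  simp only [ContinuousLinearMap.id_apply, adjoint_id'] at h
  rw [← h]
  push_cast
  rw [norm_sq_eq, sum_inner]
  refine Finset.sum_congr rfl fun i _ => ?_
  rw [inner_sum]
  simp [ContinuousLinearMap.adjoint_inner_right]

/-- Bound for a fixed left operator `ξ`. -/
theorem gram_bound (η : ι → 𝔎 →L[ℂ] K) (ξ : 𝔎 →L[ℂ] H) (ζ : ι → 𝔎) :
    ∑ k, ‖∑ j, ξ (entry η k j (ζ j))‖ ^ 2 ≤ (‖ξ‖ * ‖∑ j, η j (ζ j)‖) ^ 2 := by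
  rw [mul_pow, gram_identity_one, Finset.mul_sum]
  refine Finset.sum_le_sum fun k _ => ?_
  rw [← map_sum, ← mul_pow]
  gcongr
  exact ξ.le_opNorm _

end Gram
section Modules

variable {𝔎 𝔏 H K L : Type*}
  [NormedAddCommGroup 𝔎] [InnerProductSpace ℂ 𝔎] [CompleteSpace 𝔎]
  [NormedAddCommGroup 𝔏] [InnerProductSpace ℂ 𝔏] [CompleteSpace 𝔏]
  [NormedAddCommGroup H] [InnerProductSpace ℂ H] [CompleteSpace H]
  [NormedAddCommGroup K] [InnerProductSpace ℂ K] [CompleteSpace K]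
  [NormedAddCommGroup L] [InnerProductSpace ℂ L] [CompleteSpace L]

/-- A `C*`-base: two commuting nondegenerate `C*`-algebras of operators on a Hilbert space. -/
structure CStarBase (𝔎 : Type*) [NormedAddCommGroup 𝔎] [InnerProductSpace ℂ 𝔎]
    [CompleteSpace 𝔎] where
  B : NonUnitalStarSubalgebra ℂ (𝔎 →L[ℂ] 𝔎)
  Bd : NonUnitalStarSubalgebra ℂ (𝔎 →L[ℂ] 𝔎)
  isClosed_B : IsClosed (B : Set (𝔎 →L[ℂ] 𝔎))
  isClosed_Bd : IsClosed (Bd : Set (𝔎 →L[ℂ] 𝔎))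
  nondegenerate_B : clspan {v : 𝔎 | ∃ x ∈ B, ∃ ζ : 𝔎, v = x ζ} = ⊤
  nondegenerate_Bd : clspan {v : 𝔎 | ∃ y ∈ Bd, ∃ ζ : 𝔎, v = y ζ} = ⊤
  commute : ∀ x ∈ B, ∀ y ∈ Bd, Commute x y

/-- The opposite `C*`-base `(𝔎, 𝔅†, 𝔅)`. -/
def CStarBase.dagger (b : CStarBase 𝔎) : CStarBase 𝔎 where
  B := b.Bd
  Bd := b.B
  isClosed_B := b.isClosed_Bd
  isClosed_Bd := b.isClosed_B
  nondegenerate_B := b.nondegenerate_Bd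
  nondegenerate_Bd := b.nondegenerate_B
  commute := fun x hx y hy => (b.commute y hy x hx).symm

/-- A `C*`-module over the `C*`-base `b`: a closed space `α` of operators `𝔎 → H` with
`[α 𝔎] = H`, `[α 𝔅] = α` and `[α* α] = 𝔅`. -/
structure CModule (b : CStarBase 𝔎) (H : Type*) [NormedAddCommGroup H] [InnerProductSpace ℂ H]
    [CompleteSpace H] where
  space : Submodule ℂ (𝔎 →L[ℂ] H)
  isClosed_space : IsClosed (space : Set (𝔎 →L[ℂ] H))
  total : clspan {v : H | ∃ ξ ∈ space, ∃ ζ : 𝔎, v = ξ ζ} = ⊤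
  mul_base : clspan {T : 𝔎 →L[ℂ] H | ∃ ξ ∈ space, ∃ x ∈ b.B, T = ξ ∘L x} = space
  inner_base : clspan {x : 𝔎 →L[ℂ] 𝔎 | ∃ ξ ∈ space, ∃ ξ' ∈ space, x = (ξ†) ∘L ξ'} =
    b.B.toSubmodule

variable {b : CStarBase 𝔎}

theorem CModule.inner_mem (α : CModule b H) (ξ ξ' : α.space) : ((ξ.1)†) ∘L ξ'.1 ∈ b.B := by
  have : ((ξ.1)†) ∘L ξ'.1 ∈ b.B.toSubmodule := by
    rw [← α.inner_base]
    exact subset_clspan _ ⟨ξ, ξ.2, ξ', ξ'.2, rfl⟩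
  exact this

theorem CModule.inner_comm (α : CModule b H) (ξ ξ' : α.space) {y : 𝔎 →L[ℂ] 𝔎} (hy : y ∈ b.Bd)
    (u : 𝔎) : ((ξ.1)†) (ξ'.1 (y u)) = y (((ξ.1)†) (ξ'.1 u)) :=
  DFunLike.congr_fun (b.commute _ (α.inner_mem ξ ξ') y hy) u

theorem CModule.inner_comm' (α : CModule b H) (γ : CModule b.dagger K) (ξ ξ' : α.space)
    (η η' : γ.space) (u : 𝔎) :
    ((ξ.1)†) (ξ'.1 (((η.1)†) (η'.1 u))) = ((η.1)†) (η'.1 (((ξ.1)†) (ξ'.1 u))) :=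
  α.inner_comm ξ ξ' (y := ((η.1)†) ∘L η'.1) (γ.inner_mem η η') u

theorem CModule.total' (α : CModule b H) :
    clspan (Set.range fun p : α.space × 𝔎 => p.1.1 p.2) = ⊤ := by
  rw [← α.total]
  congr 1
  ext v
  constructor
  · rintro ⟨p, rfl⟩; exact ⟨p.1, p.1.2, p.2, rfl⟩
  · rintro ⟨ξ, hξ, ζ, rfl⟩; exact ⟨(⟨ξ, hξ⟩, ζ), rfl⟩

/-- The representation `ρ_α` of `𝔅†` on `H`, determined by `ρ_α(y)(ξ ζ) = ξ (y ζ)`. -/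
noncomputable def CModule.rho (α : CModule b H) (y : 𝔎 →L[ℂ] 𝔎) : H →L[ℂ] H :=
  extendFamily (fun p : α.space × 𝔎 => p.1.1 p.2) (fun p => p.1.1 (y p.2))

theorem CModule.rho_bound (α : CModule b H) {y : 𝔎 →L[ℂ] 𝔎} (hy : y ∈ b.Bd)
    (s : Finset (α.space × 𝔎)) (c : s → ℂ) :
    ‖∑ i : s, c i • i.1.1.1 (y i.1.2)‖ ≤ ‖y‖ * ‖∑ i : s, c i • i.1.1.1 i.1.2‖ := by
  classical
  refine abs_le_of_sq_le_sq' ?_ (by positivity) |>.2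
  have h1 : ∀ i : s, c i • i.1.1.1 (y i.1.2) = i.1.1.1 (y (c i • i.1.2)) := by simp
  have h2 : ∀ i : s, c i • i.1.1.1 i.1.2 = i.1.1.1 (c i • i.1.2) := by simp
  simp only [h1, h2]
  have hc := entry_comm (fun i : s => i.1.1.1) (T := y) (fun i j u => α.inner_comm i.1.1 j.1.1 hy u)
  have e1 := gram_identity_one (fun i : s => i.1.1.1) (fun i => y (c i • i.1.2))
  have e2 := gram_bound (fun i : s => i.1.1.1) y (fun i => c i • i.1.2)
  simp only [hc] at e1
  rw [e1]
  exact e2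

theorem CModule.rho_apply (α : CModule b H) {y : 𝔎 →L[ℂ] 𝔎} (hy : y ∈ b.Bd) (ξ : α.space) (ζ : 𝔎) :
    α.rho y (ξ.1 ζ) = ξ.1 (y ζ) :=
  extendFamily_apply α.total' ‖y‖ (α.rho_bound hy) (ξ, ζ)

theorem CModule.norm_rho_le (α : CModule b H) {y : 𝔎 →L[ℂ] 𝔎} (hy : y ∈ b.Bd) : ‖α.rho y‖ ≤ ‖y‖ :=
  norm_extendFamily_le α.total' ‖y‖ (norm_nonneg _) (α.rho_bound hy)

/-- The kernel `((ξ, η), (ξ', η')) ↦ ξ* ξ' η* η'`. -/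
noncomputable def tensorKernel (α : CModule b H) (γ : CModule b.dagger K) :
    Matrix (α.space × γ.space) (α.space × γ.space) (𝔎 →L[ℂ] 𝔎) :=
  fun p q => ((p.1.1)†) ∘L q.1.1 ∘L ((p.2.1)†) ∘L q.2.1

theorem tensorKernel_apply (α : CModule b H) (γ : CModule b.dagger K) (p q : α.space × γ.space)
    (u : 𝔎) : tensorKernel α γ p q u = ((p.1.1)†) (q.1.1 (((p.2.1)†) (q.2.1 u))) := rfl

theorem tensorKernel_isHermitian (α : CModule b H) (γ : CModule b.dagger K) :
    (tensorKernel α γ).IsHermitian := by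
  ext p q
  refine ext_inner_right ℂ fun w => ?_
  rw [Matrix.conjTranspose_apply, ContinuousLinearMap.star_eq_adjoint,
    ContinuousLinearMap.adjoint_inner_left, tensorKernel_apply, tensorKernel_apply,
    α.inner_comm' γ, ContinuousLinearMap.adjoint_inner_right,
    ← ContinuousLinearMap.adjoint_inner_left, ContinuousLinearMap.adjoint_inner_right,
    ← ContinuousLinearMap.adjoint_inner_left]

instance tensorKernel_posSemidef (α : CModule b H) (γ : CModule b.dagger K) :
    Fact (tensorKernel α γ).PosSemidef := by
  classical
  refine ⟨(((RKHS.posSemidef_tfae (K := tensorKernel α γ)).out 0 2 :)).2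
    ⟨tensorKernel_isHermitian α γ, fun vv => ?_⟩⟩
  have h := gram_identity (fun i : vv.support => i.1.2.1) (fun i : vv.support => i.1.1.1)
    (fun i j k l u => α.inner_comm' γ i.1.1 j.1.1 k.1.2 l.1.2 u) (fun i => vv i.1)
  have h2 : (vv.sum fun x w => vv.sum fun x' w' => ⟪tensorKernel α γ x' x w, w'⟫_ℂ) =
      starRingEnd ℂ (∑ i : vv.support, ∑ j : vv.support,
        ⟪vv i.1, ((i.1.1.1)†) (j.1.1.1 (((i.1.2.1)†) (j.1.2.1 (vv j.1))))⟫_ℂ) := by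
    rw [map_sum]
    simp only [map_sum, inner_conj_symm]
    rw [Finset.sum_comm]
    simp only [Finsupp.sum]
    rw [← Finset.sum_coe_sort]
    refine Finset.sum_congr rfl fun i _ => ?_
    rw [← Finset.sum_coe_sort]
    rfl
  rw [h2, h]
  have h3 : ∀ r : ℝ, 0 ≤ r → 0 ≤ RCLike.re (starRingEnd ℂ (r : ℂ)) := fun r hr => by simpa using hr
  exact h3 _ (Finset.sum_nonneg fun k _ => by positivity)

/-- The relative tensor product `H_α ⊗_b γK`: the Hilbert space generated by elements
`ξ ⊗ ζ ⊗ η` with inner products `⟨ζ, ξ* ξ' η* η' ζ'⟩`. -/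
def RelTensor (α : CModule b H) (γ : CModule b.dagger K) : Type _ := RKHS.OfKernel (tensorKernel α γ)

variable (α : CModule b H) (γ : CModule b.dagger K)

noncomputable instance : NormedAddCommGroup (RelTensor α γ) :=
  inferInstanceAs (NormedAddCommGroup (RKHS.OfKernel (tensorKernel α γ)))
noncomputable instance : InnerProductSpace ℂ (RelTensor α γ) :=
  inferInstanceAs (InnerProductSpace ℂ (RKHS.OfKernel (tensorKernel α γ)))
instance : CompleteSpace (RelTensor α γ) :=
  inferInstanceAs (CompleteSpace (RKHS.OfKernel (tensorKernel α γ)))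

variable {α γ}

/-- The elementary tensor `ξ ⊗ ζ ⊗ η`. -/
noncomputable def tens (ξ : α.space) (ζ : 𝔎) (η : γ.space) : RelTensor α γ :=
  RKHS.kerFun (RKHS.OfKernel (tensorKernel α γ)) (ξ, η) ζ

theorem inner_tens (ξ ξ' : α.space) (ζ ζ' : 𝔎) (η η' : γ.space) :
    ⟪tens ξ ζ η, tens ξ' ζ' η'⟫_ℂ = ⟪ζ, ((ξ.1)†) (ξ'.1 (((η.1)†) (η'.1 ζ')))⟫_ℂ := by
  have h := RKHS.kernel_inner (RKHS.OfKernel (tensorKernel α γ)) (ξ', η') (ξ, η) ζ ζ'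
  rw [RKHS.OfKernel.kernel_ofKernel, tensorKernel_apply,
    ContinuousLinearMap.adjoint_inner_left, ← ContinuousLinearMap.adjoint_inner_right,
    ContinuousLinearMap.adjoint_inner_left, ← ContinuousLinearMap.adjoint_inner_right] at h
  rw [α.inner_comm' γ]
  exact h.symm

theorem total_tens :
    clspan (Set.range fun p : α.space × 𝔎 × γ.space => tens p.1 p.2.1 p.2.2) = ⊤ := by
  have h := RKHS.kerFun_dense (RKHS.OfKernel (tensorKernel α γ))
  rw [eq_top_iff]
  intro v _
  have hv : (show RKHS.OfKernel (tensorKernel α γ) from v) ∈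
      (Submodule.span ℂ {RKHS.kerFun (RKHS.OfKernel (tensorKernel α γ)) x v |
        (x) (v)}).topologicalClosure := by rw [h]; exact Submodule.mem_top
  refine Submodule.topologicalClosure_mono (Submodule.span_mono ?_) hv
  rintro _ ⟨x, v, rfl⟩
  exact ⟨(x.1, v, x.2), rfl⟩

theorem eq_of_inner_total {S : Set H} (hS : clspan S = ⊤) {w w' : H}
    (h : ∀ x ∈ S, ⟪x, w⟫_ℂ = ⟪x, w'⟫_ℂ) : w = w' := by
  have : innerSL ℂ w = innerSL ℂ w' := eq_of_eqOn_total hS fun x hx => by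
    rw [innerSL_apply_apply, innerSL_apply_apply, ← inner_conj_symm, h x hx, inner_conj_symm]
  refine ext_inner_right ℂ fun v => ?_
  simpa using DFunLike.congr_fun this v

theorem inner_sum_smul {ι : Type*} [Fintype ι] (c : ι → ℂ) (f : ι → H) :
    ((‖∑ i, c i • f i‖ : ℝ) : ℂ) ^ 2 =
      ∑ i, ∑ j, starRingEnd ℂ (c i) * (c j * ⟪f i, f j⟫_ℂ) := by
  rw [norm_sq_eq, sum_inner]
  simp only [inner_sum, inner_smul_left, inner_smul_right]
  refine Finset.sum_congr rfl fun i _ => Finset.sum_congr rfl fun j _ => by ring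

/-- `|ξ⟩₁ : K → H_α ⊗ γK`, determined by `|ξ⟩₁ (η ζ) = ξ ⊗ ζ ⊗ η`. -/
noncomputable def ket1 (ξ : α.space) : K →L[ℂ] RelTensor α γ :=
  extendFamily (fun p : γ.space × 𝔎 => p.1.1 p.2) (fun p => tens ξ p.2 p.1)

/-- `|η⟩₂ : H → H_α ⊗ γK`, determined by `|η⟩₂ (ξ ζ) = ξ ⊗ ζ ⊗ η`. -/
noncomputable def ket2 (η : γ.space) : H →L[ℂ] RelTensor α γ :=
  extendFamily (fun p : α.space × 𝔎 => p.1.1 p.2) (fun p => tens p.1 p.2 η)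

theorem ket1_apply (ξ : α.space) (ζ : 𝔎) (η : γ.space) :
    ket1 (γ := γ) ξ (η.1 ζ) = tens ξ ζ η := by
  classical
  refine extendFamily_apply (f := fun p : γ.space × 𝔎 => p.1.1 p.2) γ.total' ‖ξ.1‖
    (fun s c => ?_) (η, ζ)
  refine abs_le_of_sq_le_sq' ?_ (by positivity) |>.2
  have e := gram_bound (fun i : s => i.1.1.1) ξ.1 (fun i => c i • i.1.2)
  simp only [map_smul] at e
  refine le_trans (le_of_eq ?_) e
  have h := gram_identity (fun i : s => i.1.1.1) (fun _ => ξ.1)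
    (fun i j k l u => α.inner_comm' γ ξ ξ k.1.1 l.1.1 u) (fun i => c i • i.1.2)
  rw [← Complex.ofReal_inj]
  simp only [map_smul] at h
  rw [← h]
  push_cast
  rw [inner_sum_smul]
  refine Finset.sum_congr rfl fun i _ => Finset.sum_congr rfl fun j _ => ?_
  rw [inner_smul_left, inner_smul_right, inner_tens]

theorem ket2_apply (ξ : α.space) (ζ : 𝔎) (η : γ.space) :
    ket2 (α := α) η (ξ.1 ζ) = tens ξ ζ η := by
  classical
  refine extendFamily_apply (f := fun p : α.space × 𝔎 => p.1.1 p.2) α.total' ‖η.1‖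
    (fun s c => ?_) (ξ, ζ)
  refine abs_le_of_sq_le_sq' ?_ (by positivity) |>.2
  have e := gram_bound (fun i : s => i.1.1.1) η.1 (fun i => c i • i.1.2)
  simp only [map_smul] at e
  refine le_trans (le_of_eq ?_) e
  have h := gram_identity (fun i : s => i.1.1.1) (fun _ => η.1)
    (fun i j k l u => (α.inner_comm' γ k.1.1 l.1.1 η η u).symm) (fun i => c i • i.1.2)
  rw [← Complex.ofReal_inj]
  simp only [map_smul] at h
  rw [← h]
  push_cast
  rw [inner_sum_smul]
  refine Finset.sum_congr rfl fun i _ => Finset.sum_congr rfl fun j _ => ?_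
  rw [inner_smul_left, inner_smul_right, inner_tens, α.inner_comm' γ]

theorem adjoint_ket1_comp (ξ ξ' : α.space) :
    ((ket1 (γ := γ) ξ)†) ∘L ket1 ξ' = γ.rho (((ξ.1)†) ∘L ξ'.1) := by
  refine eq_of_eqOn_total γ.total' ?_
  rintro _ ⟨⟨η', ζ'⟩, rfl⟩
  refine eq_of_inner_total γ.total' ?_
  rintro _ ⟨⟨η, ζ⟩, rfl⟩
  simp only
  rw [γ.rho_apply (α.inner_mem ξ ξ'), ContinuousLinearMap.comp_apply,
    ContinuousLinearMap.adjoint_inner_right, ket1_apply, ket1_apply, inner_tens, α.inner_comm' γ,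
    ContinuousLinearMap.adjoint_inner_right]
  rfl

theorem adjoint_ket2_comp (η η' : γ.space) :
    ((ket2 (α := α) η)†) ∘L ket2 η' = α.rho (((η.1)†) ∘L η'.1) := by
  refine eq_of_eqOn_total α.total' ?_
  rintro _ ⟨⟨ξ', ζ'⟩, rfl⟩
  refine eq_of_inner_total α.total' ?_
  rintro _ ⟨⟨ξ, ζ⟩, rfl⟩
  simp only
  rw [α.rho_apply (γ.inner_mem η η'), ContinuousLinearMap.comp_apply,
    ContinuousLinearMap.adjoint_inner_right, ket2_apply, ket2_apply, inner_tens,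
    ContinuousLinearMap.adjoint_inner_right]
  rfl

theorem total_ket1 : clspan {v : RelTensor α γ | ∃ (ξ : α.space) (ω : K), v = ket1 ξ ω} = ⊤ := by
  rw [eq_top_iff, ← total_tens]
  refine clspan_le (isClosed_clspan _) ?_
  rintro _ ⟨p, rfl⟩
  exact subset_clspan _ ⟨p.1, _, (ket1_apply p.1 p.2.1 p.2.2).symm⟩

theorem total_ket2 : clspan {v : RelTensor α γ | ∃ (η : γ.space) (ω : H), v = ket2 η ω} = ⊤ := by
  rw [eq_top_iff, ← total_tens]
  refine clspan_le (isClosed_clspan _) ?_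
  rintro _ ⟨p, rfl⟩
  exact subset_clspan _ ⟨p.2.2, _, (ket2_apply p.1 p.2.1 p.2.2).symm⟩

theorem comp_left_mem {W : Submodule ℂ (H →L[ℂ] L)} (hW : IsClosed (W : Set (H →L[ℂ] L)))
    {S : Set (H →L[ℂ] K)} (s : K →L[ℂ] L) (h : ∀ t ∈ S, s ∘L t ∈ W) {t : H →L[ℂ] K}
    (ht : t ∈ clspan S) : s ∘L t ∈ W :=
  map_mem_of_clspan hW (ContinuousLinearMap.compL ℂ H K L s) h ht

theorem comp_right_mem {W : Submodule ℂ (H →L[ℂ] L)} (hW : IsClosed (W : Set (H →L[ℂ] L)))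
    {S : Set (K →L[ℂ] L)} (t : H →L[ℂ] K) (h : ∀ s ∈ S, s ∘L t ∈ W) {s : K →L[ℂ] L}
    (hs : s ∈ clspan S) : s ∘L t ∈ W :=
  map_mem_of_clspan hW ((ContinuousLinearMap.compL ℂ H K L).flip t) h hs

theorem adjoint_comp_mem {W : Submodule ℂ (H →L[ℂ] L)} (hW : IsClosed (W : Set (H →L[ℂ] L)))
    {S : Set (L →L[ℂ] K)} (t : H →L[ℂ] K) (h : ∀ s ∈ S, (s†) ∘L t ∈ W) {s : L →L[ℂ] K}
    (hs : s ∈ clspan S) : (s†) ∘L t ∈ W :=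
  map_mem_of_clspan hW (((ContinuousLinearMap.compL ℂ H K L).flip t).comp
    (ContinuousLinearMap.adjoint (𝕜 := ℂ) (E := L) (F := K)).toContinuousLinearEquiv.toContinuousLinearMap) h hs

/-- The `C*`-module `[k δ]` on `L`, for a family `k` of operators `H → L` with `[k H] = L` and
`[k* k δ] = δ`. -/
noncomputable def CModule.push {a : CStarBase 𝔏} (δ : CModule a H) {ι : Type*} (k : ι → H →L[ℂ] L)
    (htot : clspan {v : L | ∃ (i : ι) (h : H), v = k i h} = ⊤)
    (hmul : clspan {T : 𝔏 →L[ℂ] H | ∃ i j, ∃ ξ ∈ δ.space, T = (((k i)†) ∘L k j) ∘L ξ} = δ.space) :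
    CModule a L where
  space := clspan {T | ∃ i, ∃ ξ ∈ δ.space, T = k i ∘L ξ}
  isClosed_space := isClosed_clspan _
  total := by
    rw [eq_top_iff, ← htot]
    refine clspan_le (isClosed_clspan _) ?_
    rintro _ ⟨i, h, rfl⟩
    refine map_mem_of_clspan (isClosed_clspan _) (k i) ?_
      (show h ∈ _ from δ.total ▸ Submodule.mem_top)
    rintro _ ⟨ξ, hξ, ζ, rfl⟩
    exact subset_clspan _ ⟨k i ∘L ξ, subset_clspan _ ⟨i, ξ, hξ, rfl⟩, ζ, rfl⟩
  mul_base := by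
    apply le_antisymm
    · refine clspan_le (isClosed_clspan _) ?_
      rintro _ ⟨T, hT, x, hx, rfl⟩
      refine comp_right_mem (isClosed_clspan _) x ?_ hT
      rintro _ ⟨i, ξ, hξ, rfl⟩
      refine subset_clspan _ ⟨i, ξ ∘L x, ?_, rfl⟩
      rw [← δ.mul_base]
      exact subset_clspan _ ⟨ξ, hξ, x, hx, rfl⟩
    · refine clspan_le (isClosed_clspan _) ?_
      rintro _ ⟨i, ξ, hξ, rfl⟩
      rw [← δ.mul_base] at hξ
      refine comp_left_mem (isClosed_clspan _) (k i) ?_ hξ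
      rintro _ ⟨ξ', hξ', x, hx, rfl⟩
      exact subset_clspan _ ⟨k i ∘L ξ', subset_clspan _ ⟨i, ξ', hξ', rfl⟩, x, hx, rfl⟩
  inner_base := by
    apply le_antisymm
    · refine clspan_le a.isClosed_B ?_
      rintro _ ⟨T, hT, T', hT', rfl⟩
      refine adjoint_comp_mem a.isClosed_B T' ?_ hT
      rintro _ ⟨i, ξ, hξ, rfl⟩
      refine comp_left_mem a.isClosed_B _ ?_ hT'
      rintro _ ⟨j, ξ', hξ', rfl⟩
      have h1 : (((k i)†) ∘L k j) ∘L ξ' ∈ δ.space := by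
        rw [← hmul]
        exact subset_clspan _ ⟨i, j, ξ', hξ', rfl⟩
      have h2 : ((k i ∘L ξ)†) ∘L (k j ∘L ξ') = (ξ†) ∘L ((((k i)†) ∘L k j) ∘L ξ') := by
        rw [ContinuousLinearMap.adjoint_comp]; rfl
      rw [h2]
      exact δ.inner_mem ⟨ξ, hξ⟩ ⟨_, h1⟩
    · rw [← δ.inner_base]
      refine clspan_le (isClosed_clspan _) ?_
      rintro _ ⟨ξ, hξ, ξ', hξ', rfl⟩
      rw [← hmul] at hξ'
      refine comp_left_mem (isClosed_clspan _) _ ?_ hξ'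
      rintro _ ⟨i, j, ξ'', hξ'', rfl⟩
      refine subset_clspan _ ⟨k i ∘L ξ, subset_clspan _ ⟨i, ξ, hξ, rfl⟩,
        k j ∘L ξ'', subset_clspan _ ⟨j, ξ'', hξ'', rfl⟩, ?_⟩
      rw [ContinuousLinearMap.adjoint_comp]; rfl

theorem CModule.rho_add (α : CModule b H) {y y' : 𝔎 →L[ℂ] 𝔎} (hy : y ∈ b.Bd) (hy' : y' ∈ b.Bd) :
    α.rho (y + y') = α.rho y + α.rho y' := by
  refine eq_of_eqOn_total α.total' ?_
  rintro _ ⟨⟨ξ, ζ⟩, rfl⟩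
  simp [α.rho_apply hy, α.rho_apply hy', α.rho_apply (add_mem hy hy')]

theorem CModule.rho_smul (α : CModule b H) {y : 𝔎 →L[ℂ] 𝔎} (hy : y ∈ b.Bd) (c : ℂ) :
    α.rho (c • y) = c • α.rho y := by
  refine eq_of_eqOn_total α.total' ?_
  rintro _ ⟨⟨ξ, ζ⟩, rfl⟩
  simp [α.rho_apply hy, α.rho_apply (SMulMemClass.smul_mem c hy)]

theorem CModule.rho_comp_mem (α : CModule b H) {W : Submodule ℂ (𝔏 →L[ℂ] H)}
    (hW : IsClosed (W : Set (𝔏 →L[ℂ] H))) {S : Set (𝔎 →L[ℂ] 𝔎)}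
    (hS : clspan S = b.Bd.toSubmodule) (ξ : 𝔏 →L[ℂ] H) (h : ∀ y ∈ S, α.rho y ∘L ξ ∈ W)
    {y : 𝔎 →L[ℂ] 𝔎} (hy : y ∈ b.Bd) : α.rho y ∘L ξ ∈ W := by
  let ρ : b.Bd.toSubmodule →L[ℂ] (H →L[ℂ] H) :=
    LinearMap.mkContinuous
      { toFun := fun y => α.rho y.1
        map_add' := fun y y' => α.rho_add y.2 y'.2
        map_smul' := fun c y => α.rho_smul y.2 c } 1 (fun y => by
          rw [one_mul]; exact α.norm_rho_le y.2)
  have hρ : ∀ y : b.Bd.toSubmodule, ρ y = α.rho y.1 := fun _ => rfl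
  have hspan : ∀ z ∈ Submodule.span ℂ S, ∃ hz : z ∈ b.Bd.toSubmodule, α.rho z ∘L ξ ∈ W := by
    intro z hz
    have hle : Submodule.span ℂ S ≤ b.Bd.toSubmodule := hS ▸ Submodule.le_topologicalClosure _
    refine ⟨hle hz, ?_⟩
    induction hz using Submodule.span_induction with
    | mem x hx => exact h x hx
    | zero =>
      have : α.rho 0 = 0 := by simpa using α.rho_smul (y := 0) (zero_mem _) 0
      rw [this, ContinuousLinearMap.zero_comp]; exact zero_mem _
    | add x y hx hy h1 h2 =>
      rw [α.rho_add (hle hx) (hle hy), ContinuousLinearMap.add_comp]; exact add_mem h1 h2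
    | smul c x hx h1 =>
      rw [α.rho_smul (hle hx), ContinuousLinearMap.smul_comp]; exact W.smul_mem c h1
  have hy' : y ∈ closure (Submodule.span ℂ S : Set (𝔎 →L[ℂ] 𝔎)) := by
    have : y ∈ clspan S := hS ▸ hy
    exact this
  obtain ⟨u, hu, hlim⟩ := mem_closure_iff_seq_limit.1 hy'
  let u' : ℕ → b.Bd.toSubmodule := fun n => ⟨u n, (hspan _ (hu n)).1⟩
  have h1 : Filter.Tendsto u' Filter.atTop (nhds (⟨y, hy⟩ : b.Bd.toSubmodule)) :=
    tendsto_subtype_rng.2 hlim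
  have h2 := ((ContinuousLinearMap.compL ℂ 𝔏 H H).flip ξ ∘L ρ).continuous.tendsto
    (⟨y, hy⟩ : b.Bd.toSubmodule) |>.comp h1
  exact hW.mem_of_tendsto h2 (Filter.Eventually.of_forall fun n => (hspan _ (hu n)).2)

/-- Compatibility `[ρ_α(𝔅†) δ] = δ` of two module structures on the same Hilbert space. -/
def CModule.Compatible {a : CStarBase 𝔏} (α : CModule b H) (δ : CModule a H) : Prop :=
  clspan {T : 𝔏 →L[ℂ] H | ∃ y ∈ b.Bd, ∃ ξ ∈ δ.space, T = α.rho y ∘L ξ} = δ.space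

theorem CModule.Compatible.rho_comp_mem {a : CStarBase 𝔏} {α : CModule b H} {δ : CModule a H}
    (h : α.Compatible δ) {y : 𝔎 →L[ℂ] 𝔎} (hy : y ∈ b.Bd) {ξ : 𝔏 →L[ℂ] H} (hξ : ξ ∈ δ.space) :
    α.rho y ∘L ξ ∈ δ.space := by
  have h' := subset_clspan {T : 𝔏 →L[ℂ] H | ∃ y ∈ b.Bd, ∃ ξ ∈ δ.space, T = α.rho y ∘L ξ}
    ⟨y, hy, ξ, hξ, rfl⟩
  rw [h] at h'
  exact h'

/-- The module `δ ◁ γ = [|γ⟩₂ δ]` on `H_α ⊗ γK`. -/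
noncomputable def leftLeg {a : CStarBase 𝔏} (δ : CModule a H) (α : CModule b H)
    (γ : CModule b.dagger K) (h : α.Compatible δ) : CModule a (RelTensor α γ) :=
  δ.push (fun η : γ.space => ket2 (α := α) η) total_ket2 (by
    apply le_antisymm
    · refine clspan_le δ.isClosed_space ?_
      rintro _ ⟨η, η', ξ, hξ, rfl⟩
      rw [adjoint_ket2_comp]
      exact h.rho_comp_mem (γ.inner_mem η η') hξ
    · intro ξ hξ
      rw [← show _ = δ.space from h] at hξ
      refine clspan_le (isClosed_clspan _) ?_ hξ
      rintro _ ⟨y, hy, ξ', hξ', rfl⟩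
      refine α.rho_comp_mem (isClosed_clspan _) γ.inner_base ξ' ?_ hy
      rintro _ ⟨η, hη, η', hη', rfl⟩
      refine subset_clspan _ ⟨⟨η, hη⟩, ⟨η', hη'⟩, ξ', hξ', ?_⟩
      rw [adjoint_ket2_comp])

/-- The module `α ▷ δ = [|α⟩₁ δ]` on `H_α ⊗ γK`. -/
noncomputable def rightLeg {a : CStarBase 𝔏} (α : CModule b H) (γ : CModule b.dagger K)
    (δ : CModule a K) (h : γ.Compatible δ) : CModule a (RelTensor α γ) :=
  δ.push (fun ξ : α.space => ket1 (γ := γ) ξ) total_ket1 (by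
    apply le_antisymm
    · refine clspan_le δ.isClosed_space ?_
      rintro _ ⟨η, η', ξ, hξ, rfl⟩
      rw [adjoint_ket1_comp]
      exact h.rho_comp_mem (α.inner_mem η η') hξ
    · intro ξ hξ
      rw [← show _ = δ.space from h] at hξ
      refine clspan_le (isClosed_clspan _) ?_ hξ
      rintro _ ⟨y, hy, ξ', hξ', rfl⟩
      refine γ.rho_comp_mem (isClosed_clspan _) α.inner_base ξ' ?_ hy
      rintro _ ⟨η, hη, η', hη', rfl⟩
      refine subset_clspan _ ⟨⟨η, hη⟩, ⟨η', hη'⟩, ξ', hξ', ?_⟩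
      rw [adjoint_ket1_comp])

/-- A `C*`-`(a, b)`-module: a Hilbert space with a `C*`-`a`-module structure and a
`C*`-`b`-module structure that are compatible with each other. -/
structure Bimodule (a : CStarBase 𝔏) (b : CStarBase 𝔎) (H : Type*) [NormedAddCommGroup H]
    [InnerProductSpace ℂ H] [CompleteSpace H] where
  left : CModule a H
  right : CModule b H
  left_right : left.Compatible right
  right_left : right.Compatible left

theorem CModule.push_rho {a : CStarBase 𝔏} (δ : CModule a H) {ι : Type*} (k : ι → H →L[ℂ] L)
    (htot) (hmul) {y : 𝔏 →L[ℂ] 𝔏} (hy : y ∈ a.Bd) (i : ι) (h : H) :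
    (δ.push k htot hmul).rho y (k i h) = k i (δ.rho y h) := by
  have : (δ.push k htot hmul).rho y ∘L k i = k i ∘L δ.rho y := by
    refine eq_of_eqOn_total δ.total' ?_
    rintro _ ⟨⟨ξ, ζ⟩, rfl⟩
    have hm : k i ∘L ξ.1 ∈ (δ.push k htot hmul).space := subset_clspan _ ⟨i, ξ.1, ξ.2, rfl⟩
    have h1 := (δ.push k htot hmul).rho_apply hy ⟨_, hm⟩ ζ
    simp only [ContinuousLinearMap.comp_apply] at h1 ⊢
    rw [h1, δ.rho_apply hy]
  exact DFunLike.congr_fun this h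

theorem Bimodule.rho_comm {a : CStarBase 𝔏} (M : Bimodule a b H) {x : 𝔏 →L[ℂ] 𝔏}
    {y : 𝔎 →L[ℂ] 𝔎} (hx : x ∈ a.Bd) (hy : y ∈ b.Bd) (h : H) :
    M.left.rho x (M.right.rho y h) = M.right.rho y (M.left.rho x h) := by
  have : M.left.rho x ∘L M.right.rho y = M.right.rho y ∘L M.left.rho x := by
    refine eq_of_eqOn_total M.right.total' ?_
    rintro _ ⟨⟨ξ, ζ⟩, rfl⟩
    have h1 := M.right.rho_apply hy ⟨_, M.left_right.rho_comp_mem hx ξ.2⟩ ζ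
    simp only [ContinuousLinearMap.comp_apply] at h1 ⊢
    rw [M.right.rho_apply hy, h1]
  exact DFunLike.congr_fun this h

section Associator

variable {d : CStarBase 𝔏} (α : CModule b H) (M : Bimodule b.dagger d K) (φ : CModule d.dagger L)

theorem inner_ket2_ket1 (η η' : φ.space) (ξ ξ' : α.space) (h h' : K) :
    ⟪ket2 (α := rightLeg α M.left M.right M.left_right) η (ket1 ξ h),
      ket2 (α := rightLeg α M.left M.right M.left_right) η' (ket1 ξ' h')⟫_ℂ =
    ⟪h, M.left.rho (((ξ.1)†) ∘L ξ'.1) (M.right.rho (((η.1)†) ∘L η'.1) h')⟫_ℂ := by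
  rw [← ContinuousLinearMap.adjoint_inner_right, ← ContinuousLinearMap.comp_apply,
    adjoint_ket2_comp]
  have : (rightLeg α M.left M.right M.left_right).rho (((η.1)†) ∘L η'.1) (ket1 ξ' h') =
      ket1 ξ' (M.right.rho (((η.1)†) ∘L η'.1) h') :=
    CModule.push_rho _ _ _ _ (φ.inner_mem η η') ξ' h'
  rw [this, ← ContinuousLinearMap.adjoint_inner_right, ← ContinuousLinearMap.comp_apply,
    adjoint_ket1_comp]

theorem inner_ket1_ket2 (η η' : φ.space) (ξ ξ' : α.space) (h h' : K) :
    ⟪ket1 (γ := leftLeg M.left M.right φ M.right_left) ξ (ket2 η h),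
      ket1 (γ := leftLeg M.left M.right φ M.right_left) ξ' (ket2 η' h')⟫_ℂ =
    ⟪h, M.left.rho (((ξ.1)†) ∘L ξ'.1) (M.right.rho (((η.1)†) ∘L η'.1) h')⟫_ℂ := by
  rw [← ContinuousLinearMap.adjoint_inner_right, ← ContinuousLinearMap.comp_apply,
    adjoint_ket1_comp]
  have : (leftLeg M.left M.right φ M.right_left).rho (((ξ.1)†) ∘L ξ'.1) (ket2 η' h') =
      ket2 η' (M.left.rho (((ξ.1)†) ∘L ξ'.1) h') :=
    CModule.push_rho _ _ _ _ (α.inner_mem ξ ξ') η' h'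
  rw [this, ← ContinuousLinearMap.adjoint_inner_right, ← ContinuousLinearMap.comp_apply,
    adjoint_ket2_comp, M.rho_comm (α.inner_mem ξ ξ') (φ.inner_mem η η')]

theorem total_ket2_ket1 : clspan (Set.range fun p : φ.space × α.space × K =>
    ket2 (α := rightLeg α M.left M.right M.left_right) p.1 (ket1 p.2.1 p.2.2)) = ⊤ := by
  rw [eq_top_iff, ← total_ket2]
  refine clspan_le (isClosed_clspan _) ?_
  rintro _ ⟨η, u, rfl⟩
  have hu : u ∈ clspan {v : RelTensor α M.left | ∃ (ξ : α.space) (ω : K), v = ket1 ξ ω} := by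
    rw [total_ket1]; exact Submodule.mem_top
  refine map_mem_of_clspan (isClosed_clspan _)
    (ket2 (α := rightLeg α M.left M.right M.left_right) η) ?_ hu
  rintro _ ⟨ξ, h, rfl⟩
  exact subset_clspan _ ⟨(η, ξ, h), rfl⟩

/-- The canonical isomorphism `(H ⊗ K) ⊗ L → H ⊗ (K ⊗ L)`, through which the two spaces are
identified. It sends `(ξ ⊗ h) ⊗ η` to `ξ ⊗ (h ⊗ η)` for `ξ ∈ α`, `h ∈ K`, `η ∈ φ`. -/
noncomputable def assoc :
    RelTensor (rightLeg α M.left M.right M.left_right) φ →L[ℂ]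
      RelTensor α (leftLeg M.left M.right φ M.right_left) :=
  extendFamily (fun p : φ.space × α.space × K => ket2 p.1 (ket1 p.2.1 p.2.2))
    (fun p => ket1 p.2.1 (ket2 p.1 p.2.2))

theorem assoc_apply (ξ : α.space) (h : K) (η : φ.space) :
    assoc α M φ (ket2 η (ket1 ξ h)) = ket1 ξ (ket2 η h) := by
  refine extendFamily_apply (f := fun p : φ.space × α.space × K =>
    ket2 (α := rightLeg α M.left M.right M.left_right) p.1 (ket1 p.2.1 p.2.2))
    (total_ket2_ket1 α M φ) 1 (fun s c => ?_) (η, ξ, h)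
  rw [one_mul]
  refine abs_le_of_sq_le_sq' (le_of_eq ?_) (norm_nonneg _) |>.2
  rw [← Complex.ofReal_inj]
  push_cast
  rw [inner_sum_smul, inner_sum_smul]
  simp only [inner_ket2_ket1, inner_ket1_ket2]

end Associator

section FiberProduct

/-- The closed space `[k C]` for a family `k` of operators and an algebra `C`. -/
noncomputable def ketSpan {ι : Type*} (k : ι → K →L[ℂ] L) (C : NonUnitalStarSubalgebra ℂ (K →L[ℂ] K)) :
    Submodule ℂ (K →L[ℂ] L) :=
  clspan {T | ∃ i, ∃ c ∈ C, T = k i ∘L c}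

theorem comp_mem_ketSpan {ι : Type*} {k : ι → K →L[ℂ] L}
    {C : NonUnitalStarSubalgebra ℂ (K →L[ℂ] K)} {x : L →L[ℂ] L}
    (hx : ∀ i, x ∘L k i ∈ ketSpan k C) {T : K →L[ℂ] L} (hT : T ∈ ketSpan k C) :
    x ∘L T ∈ ketSpan k C := by
  refine comp_left_mem (isClosed_clspan _) x ?_ hT
  rintro _ ⟨i, c, hc, rfl⟩
  refine comp_right_mem (s := x ∘L k i) (isClosed_clspan _) c ?_ (hx i)
  rintro _ ⟨j, c', hc', rfl⟩
  exact subset_clspan _ ⟨j, c' ∘L c, mul_mem hc' hc, rfl⟩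

/-- The `C*`-algebra of all `x ∈ L(L)` with `x k ⊆ [k C]` and `x* k ⊆ [k C]`. -/
noncomputable def ketStable {ι : Type*} (k : ι → K →L[ℂ] L)
    (C : NonUnitalStarSubalgebra ℂ (K →L[ℂ] K)) : NonUnitalStarSubalgebra ℂ (L →L[ℂ] L) where
  carrier := {x | ∀ i, x ∘L k i ∈ ketSpan k C ∧ (x†) ∘L k i ∈ ketSpan k C}
  zero_mem' := fun i => by
    rw [map_zero, ContinuousLinearMap.zero_comp]
    exact ⟨zero_mem _, zero_mem _⟩
  add_mem' := fun {x y} hx hy i => by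
    rw [map_add, ContinuousLinearMap.add_comp, ContinuousLinearMap.add_comp]
    exact ⟨add_mem (hx i).1 (hy i).1, add_mem (hx i).2 (hy i).2⟩
  smul_mem' := fun c x hx i => by
    rw [map_smulₛₗ, ContinuousLinearMap.smul_comp, ContinuousLinearMap.smul_comp]
    exact ⟨Submodule.smul_mem _ _ (hx i).1, Submodule.smul_mem _ _ (hx i).2⟩
  mul_mem' := fun {x y} hx hy i => by
    have hs : ((x * y)†) = (y†) ∘L (x†) := ContinuousLinearMap.adjoint_comp x y
    have e : (x * y) ∘L k i = x ∘L (y ∘L k i) := rfl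
    rw [hs, e, ContinuousLinearMap.comp_assoc]
    exact ⟨comp_mem_ketSpan (k := k) (C := C) (x := x) (fun i => (hx i).1) (hy i).1,
      comp_mem_ketSpan (k := k) (C := C) (x := y†) (fun i => (hy i).2) (hx i).2⟩
  star_mem' := fun {x} hx i => by
    rw [ContinuousLinearMap.star_eq_adjoint, ContinuousLinearMap.adjoint_adjoint]
    exact ⟨(hx i).2, (hx i).1⟩

/-- The fiber product of a `C*`-`b`-algebra `A` on `H_α` and a `C*`-`b†`-algebra `C` on `γK`:
all `x ∈ L(H_α ⊗ γK)` with `x |α⟩₁, x* |α⟩₁ ⊆ [|α⟩₁ C]` and `x |γ⟩₂, x* |γ⟩₂ ⊆ [|γ⟩₂ A]`. -/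
noncomputable def fiberProduct (α : CModule b H) (γ : CModule b.dagger K)
    (A : NonUnitalStarSubalgebra ℂ (H →L[ℂ] H)) (C : NonUnitalStarSubalgebra ℂ (K →L[ℂ] K)) :
    NonUnitalStarSubalgebra ℂ (RelTensor α γ →L[ℂ] RelTensor α γ) :=
  ketStable (fun ξ : α.space => ket1 (γ := γ) ξ) C ⊓
    ketStable (fun η : γ.space => ket2 (α := α) η) A

end FiberProduct

section Morphisms

/-- The intertwiner space `L^π(H, K)` of a map `π` from `A ⊆ L(H)` to `L(K)`. -/
def intertwiners (A : NonUnitalStarSubalgebra ℂ (H →L[ℂ] H)) (π : A → K →L[ℂ] K) :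
    Set (H →L[ℂ] K) :=
  {S | ∀ a : A, S ∘L a.1 = π a ∘L S}

/-- Morphisms of `C*`-`b`-modules: `S α ⊆ α'` and `S* α' ⊆ α`. -/
def morphisms (α : CModule b H) (α' : CModule b K) : Set (H →L[ℂ] K) :=
  {S | (∀ ξ ∈ α.space, S ∘L ξ ∈ α'.space) ∧ ∀ ξ ∈ α'.space, (S†) ∘L ξ ∈ α.space}

/-- Joint normality of a map `π` from `A ⊆ L(H)` to `L(K)`, for two module structures `α, δ`
on `H` and `α', δ'` on `K`: the intertwiners `I` of `π` that are morphisms for both structures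
satisfy `[I α] = α'` and `[I δ] = δ'`. -/
def IsJointlyNormal {a : CStarBase 𝔏} (α : CModule a H) (δ : CModule b H)
    (A : NonUnitalStarSubalgebra ℂ (H →L[ℂ] H)) (α' : CModule a K) (δ' : CModule b K)
    (π : A → K →L[ℂ] K) : Prop :=
  clspan {T : 𝔏 →L[ℂ] K | ∃ S ∈ intertwiners A π ∩ (morphisms α α' ∩ morphisms δ δ'),
    ∃ ξ ∈ α.space, T = S ∘L ξ} = α'.space ∧
  clspan {T : 𝔎 →L[ℂ] K | ∃ S ∈ intertwiners A π ∩ (morphisms α α' ∩ morphisms δ δ'),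
    ∃ ξ ∈ δ.space, T = S ∘L ξ} = δ'.space

/-- `R = S ⊗ Id`, i.e. `R (h ⊗ η) = S h ⊗ η` for `h ∈ H`, `η ∈ γ`. -/
def IsTensorId {α : CModule b H} {α' : CModule b L} {γ : CModule b.dagger K} (S : H →L[ℂ] L)
    (R : RelTensor α γ →L[ℂ] RelTensor α' γ) : Prop :=
  ∀ η : γ.space, R ∘L ket2 η = ket2 η ∘L S

/-- `R = Id ⊗ S`, i.e. `R (ξ ⊗ h) = ξ ⊗ S h` for `ξ ∈ α`, `h ∈ K`. -/
def IsIdTensor {α : CModule b H} {γ : CModule b.dagger K} {γ' : CModule b.dagger L} (S : K →L[ℂ] L)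
    (R : RelTensor α γ →L[ℂ] RelTensor α γ') : Prop :=
  ∀ ξ : α.space, R ∘L ket1 ξ = ket1 ξ ∘L S

theorem norm_sum_tens {ι : Type*} [Fintype ι] [DecidableEq ι] {α : CModule b H}
    {γ : CModule b.dagger K} (c : ι → ℂ) (ξ : ι → α.space) (ζ : ι → 𝔎) (η : ι → γ.space) :
    ‖∑ i, c i • tens (ξ i) (ζ i) (η i)‖ ^ 2 =
      ∑ k, ‖∑ j, (ξ j).1 (entry (fun i => (η i).1) k j (c j • ζ j))‖ ^ 2 := by
  have h := gram_identity (fun i => (η i).1) (fun i => (ξ i).1)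
    (fun i j k l u => α.inner_comm' γ (ξ i) (ξ j) (η k) (η l) u) (fun i => c i • ζ i)
  rw [← Complex.ofReal_inj, ← h]
  push_cast
  rw [inner_sum_smul]
  refine Finset.sum_congr rfl fun i _ => Finset.sum_congr rfl fun j _ => ?_
  simp only [map_smul]
  rw [inner_smul_left, inner_smul_right, inner_tens]

/-- `S ⊗ Id` exists for every semi-morphism `S`. -/
theorem exists_isTensorId {α : CModule b H} {α' : CModule b L} (γ : CModule b.dagger K)
    {S : H →L[ℂ] L} (hS : ∀ ξ ∈ α.space, S ∘L ξ ∈ α'.space) :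
    ∃ R : RelTensor α γ →L[ℂ] RelTensor α' γ, IsTensorId S R := by
  classical
  obtain ⟨R, hR⟩ : ∃ R : RelTensor α γ →L[ℂ] RelTensor α' γ, ∀ p : α.space × 𝔎 × γ.space,
      R (tens p.1 p.2.1 p.2.2) = tens ⟨S ∘L p.1.1, hS _ p.1.2⟩ p.2.1 p.2.2 := by
    refine ⟨extendFamily (fun p : α.space × 𝔎 × γ.space => tens p.1 p.2.1 p.2.2)
      (fun p => tens ⟨S ∘L p.1.1, hS _ p.1.2⟩ p.2.1 p.2.2), ?_⟩
    refine extendFamily_apply total_tens ‖S‖ fun s c => ?_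
    refine abs_le_of_sq_le_sq' ?_ (by positivity) |>.2
    rw [mul_pow,
      norm_sum_tens c (fun i : s => i.1.1) (fun i : s => i.1.2.1) (fun i : s => i.1.2.2),
      norm_sum_tens c (fun i : s => (⟨S ∘L i.1.1.1, hS _ i.1.1.2⟩ : α'.space))
        (fun i : s => i.1.2.1) (fun i : s => i.1.2.2), Finset.mul_sum]
    refine Finset.sum_le_sum fun k _ => ?_
    rw [← mul_pow]
    gcongr
    simp only [ContinuousLinearMap.comp_apply]
    rw [← map_sum]
    exact S.le_opNorm _
  refine ⟨R, fun η => eq_of_eqOn_total α.total' ?_⟩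
  rintro _ ⟨⟨ξ, ζ⟩, rfl⟩
  have h1 := ket2_apply (γ := γ) (⟨S ∘L ξ.1, hS _ ξ.2⟩ : α'.space) ζ η
  simp only [ContinuousLinearMap.comp_apply] at h1 ⊢
  rw [ket2_apply, h1]
  exact hR (ξ, ζ, η)

theorem norm_sum_tens' {ι : Type*} [Fintype ι] [DecidableEq ι] {α : CModule b H}
    {γ : CModule b.dagger K} (c : ι → ℂ) (ξ : ι → α.space) (ζ : ι → 𝔎) (η : ι → γ.space) :
    ‖∑ i, c i • tens (ξ i) (ζ i) (η i)‖ ^ 2 =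
      ∑ k, ‖∑ j, (η j).1 (entry (fun i => (ξ i).1) k j (c j • ζ j))‖ ^ 2 := by
  have h := gram_identity (fun i => (ξ i).1) (fun i => (η i).1)
    (fun i j k l u => (α.inner_comm' γ (ξ k) (ξ l) (η i) (η j) u).symm) (fun i => c i • ζ i)
  rw [← Complex.ofReal_inj, ← h]
  push_cast
  rw [inner_sum_smul]
  refine Finset.sum_congr rfl fun i _ => Finset.sum_congr rfl fun j _ => ?_
  simp only [map_smul]
  rw [inner_smul_left, inner_smul_right, inner_tens, α.inner_comm' γ]

/-- `Id ⊗ S` exists for every semi-morphism `S`. -/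
theorem exists_isIdTensor (α : CModule b H) {γ : CModule b.dagger K} {γ' : CModule b.dagger L}
    {S : K →L[ℂ] L} (hS : ∀ η ∈ γ.space, S ∘L η ∈ γ'.space) :
    ∃ R : RelTensor α γ →L[ℂ] RelTensor α γ', IsIdTensor S R := by
  classical
  obtain ⟨R, hR⟩ : ∃ R : RelTensor α γ →L[ℂ] RelTensor α γ', ∀ p : α.space × 𝔎 × γ.space,
      R (tens p.1 p.2.1 p.2.2) = tens p.1 p.2.1 ⟨S ∘L p.2.2.1, hS _ p.2.2.2⟩ := by
    refine ⟨extendFamily (fun p : α.space × 𝔎 × γ.space => tens p.1 p.2.1 p.2.2)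
      (fun p => tens p.1 p.2.1 ⟨S ∘L p.2.2.1, hS _ p.2.2.2⟩), ?_⟩
    refine extendFamily_apply total_tens ‖S‖ fun s c => ?_
    refine abs_le_of_sq_le_sq' ?_ (by positivity) |>.2
    rw [mul_pow,
      norm_sum_tens' c (fun i : s => i.1.1) (fun i : s => i.1.2.1) (fun i : s => i.1.2.2),
      norm_sum_tens' c (fun i : s => i.1.1) (fun i : s => i.1.2.1)
        (fun i : s => (⟨S ∘L i.1.2.2.1, hS _ i.1.2.2.2⟩ : γ'.space)), Finset.mul_sum]
    refine Finset.sum_le_sum fun k _ => ?_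
    rw [← mul_pow]
    gcongr
    simp only [ContinuousLinearMap.comp_apply]
    rw [← map_sum]
    exact S.le_opNorm _
  refine ⟨R, fun ξ => eq_of_eqOn_total γ.total' ?_⟩
  rintro _ ⟨⟨η, ζ⟩, rfl⟩
  have h1 := ket1_apply (α := α) ξ ζ (⟨S ∘L η.1, hS _ η.2⟩ : γ'.space)
  simp only [ContinuousLinearMap.comp_apply] at h1 ⊢
  rw [ket1_apply, h1]
  exact hR (ξ, ζ, η)

/-- `X = (π ∗ Id)(x)`: the operator determined by `X (S ⊗ Id) = (S ⊗ Id) x` for all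
intertwiners `S` of `π`. -/
def IsFiberMapLeft {α : CModule b H} {α' : CModule b L} {γ : CModule b.dagger K}
    (A : NonUnitalStarSubalgebra ℂ (H →L[ℂ] H)) (π : A → L →L[ℂ] L)
    (x : RelTensor α γ →L[ℂ] RelTensor α γ) (X : RelTensor α' γ →L[ℂ] RelTensor α' γ) : Prop :=
  ∀ S ∈ intertwiners A π, ∀ R : RelTensor α γ →L[ℂ] RelTensor α' γ, IsTensorId S R →
    X ∘L R = R ∘L x

/-- `X = (Id ∗ π)(x)`: the operator determined by `X (Id ⊗ S) = (Id ⊗ S) x` for all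
intertwiners `S` of `π`. -/
def IsFiberMapRight {α : CModule b H} {γ : CModule b.dagger K} {γ' : CModule b.dagger L}
    (C : NonUnitalStarSubalgebra ℂ (K →L[ℂ] K)) (π : C → L →L[ℂ] L)
    (x : RelTensor α γ →L[ℂ] RelTensor α γ) (X : RelTensor α γ' →L[ℂ] RelTensor α γ') : Prop :=
  ∀ S ∈ intertwiners C π, ∀ R : RelTensor α γ →L[ℂ] RelTensor α γ', IsIdTensor S R →
    X ∘L R = R ∘L x

end Morphisms

/-- A `C*`-`(a, b)`-algebra: a `C*`-`(a, b)`-module `H` with a `C*`-algebra `A ⊆ L(H)` that is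
stable under left multiplication by both representations of the base algebras. -/
structure BaseAlgebra (a : CStarBase 𝔏) (b : CStarBase 𝔎) (H : Type*) [NormedAddCommGroup H]
    [InnerProductSpace ℂ H] [CompleteSpace H] extends Bimodule a b H where
  A : NonUnitalStarSubalgebra ℂ (H →L[ℂ] H)
  isClosed_A : IsClosed (A : Set (H →L[ℂ] H))
  left_mul_mem : ∀ y ∈ a.Bd, ∀ x ∈ A, left.rho y ∘L x ∈ A
  right_mul_mem : ∀ y ∈ b.Bd, ∀ x ∈ A, right.rho y ∘L x ∈ A

/-- A normal Hopf `C*`-bimodule over `b`: a `C*`-`(b†, b)`-algebra `(H, β, α, A)`, where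
`β = left` and `α = right`, with a jointly normal coassociative comultiplication
`Δ : A → A ∗ A` into the fiber product over `H_α ⊗ βH`. -/
structure NormalHopfBimodule (b : CStarBase 𝔎) (H : Type*) [NormedAddCommGroup H]
    [InnerProductSpace ℂ H] [CompleteSpace H] extends BaseAlgebra b.dagger b H where
  Δ : A →⋆ₙₐ[ℂ] fiberProduct right left A A
  normal : IsJointlyNormal left right A (leftLeg left right left right_left)
    (rightLeg right left right left_right) (fun a => (Δ a).1)
  coassociative : ∀ a : A,
    ∃ (X : RelTensor (rightLeg right left right left_right) left →L[ℂ]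
        RelTensor (rightLeg right left right left_right) left)
      (Y : RelTensor right (leftLeg left right left right_left) →L[ℂ]
        RelTensor right (leftLeg left right left right_left)),
      IsFiberMapLeft A (fun a' => (Δ a').1) (Δ a).1 X ∧
      IsFiberMapRight A (fun a' => (Δ a').1) (Δ a).1 Y ∧
      assoc right toBimodule left ∘L X = Y ∘L assoc right toBimodule left

section Omega

/-- `ξ ∈ α^∞`: the sum `∑ ξₙ* ξₙ` converges in norm. -/
def SqSummable {α : CModule b H} (ξ : ℕ → α.space) : Prop :=
  Summable fun n => (((ξ n).1)†) ∘L (ξ n).1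

/-- `‖ξ‖ = ‖∑ ξₙ* ξₙ‖^(1/2)`. -/
noncomputable def seqNorm {α : CModule b H} (ξ : ℕ → α.space) : ℝ :=
  Real.sqrt ‖∑' n, (((ξ n).1)†) ∘L (ξ n).1‖

/-- `ω = ω_{ξ,ξ'}` with `ξ ∈ α^∞` and `ξ' ∈ δ^∞`, where `ω_{ξ,ξ'}(x) = ∑ ξₙ* x ξ'ₙ`. -/
def Represents {a : CStarBase 𝔏} {α : CModule a H} {δ : CModule b H}
    {A : NonUnitalStarSubalgebra ℂ (H →L[ℂ] H)} (ξ : ℕ → α.space) (ξ' : ℕ → δ.space)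
    (ω : A →L[ℂ] (𝔎 →L[ℂ] 𝔏)) : Prop :=
  SqSummable ξ ∧ SqSummable ξ' ∧
    ∀ x : A, HasSum (fun n => (((ξ n).1)†) ∘L x.1 ∘L (ξ' n).1) (ω x)

/-- The space `Ω_{α,δ}(A)` of all maps `ω_{ξ,ξ'}` with `ξ ∈ α^∞` and `ξ' ∈ δ^∞`. -/
structure Omega {a : CStarBase 𝔏} (α : CModule a H) (δ : CModule b H)
    (A : NonUnitalStarSubalgebra ℂ (H →L[ℂ] H)) where
  toMap : A →L[ℂ] (𝔎 →L[ℂ] 𝔏)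
  exists_represents : ∃ (ξ : ℕ → α.space) (ξ' : ℕ → δ.space), Represents ξ ξ' toMap

/-- The norm on `Ω_{α,δ}(A)`: the infimum of `‖ξ‖ ‖ξ'‖` over all `ξ, ξ'` with `ω = ω_{ξ,ξ'}`. -/
noncomputable def Omega.norm {a : CStarBase 𝔏} {α : CModule a H} {δ : CModule b H}
    {A : NonUnitalStarSubalgebra ℂ (H →L[ℂ] H)} (ω : Omega α δ A) : ℝ :=
  sInf {r : ℝ | ∃ (ξ : ℕ → α.space) (ξ' : ℕ → δ.space),
    Represents ξ ξ' ω.toMap ∧ r = seqNorm ξ * seqNorm ξ'}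

end Omega

section Convolution

variable {α : CModule b H} {β : CModule b.dagger H} {A : NonUnitalStarSubalgebra ℂ (H →L[ℂ] H)}

/-- `c = (Id ∗ ω)(x)` for `ω ∈ Ω_β(A)`, where `(Id ∗ ω_{η,η'})(x) = ∑ ⟨ηₙ|₂ x |η'ₙ⟩₂`. -/
def IsSliceRight (ω : Omega β β A) (x : RelTensor α β →L[ℂ] RelTensor α β) (c : H →L[ℂ] H) :
    Prop :=
  ∀ η η' : ℕ → β.space, Represents η η' ω.toMap →
    HasSum (fun n => ((ket2 (η n))†) ∘L x ∘L ket2 (η' n)) c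

/-- `c = (ω ∗ Id)(x)` for `ω ∈ Ω_α(A)`, where `(ω_{ξ,ξ'} ∗ Id)(x) = ∑ ⟨ξₙ|₁ x |ξ'ₙ⟩₁`. -/
def IsSliceLeft (ω : Omega α α A) (x : RelTensor α β →L[ℂ] RelTensor α β) (c : H →L[ℂ] H) :
    Prop :=
  ∀ ξ ξ' : ℕ → α.space, Represents ξ ξ' ω.toMap →
    HasSum (fun n => ((ket1 (ξ n))†) ∘L x ∘L ket1 (ξ' n)) c

/-- `v = (ω ⊠ ω')(x)` for `ω, ω' ∈ Ω_β(A)`, where `ω ⊠ ω' = ω ∘ (Id ∗ ω')`. -/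
def IsBoxLeft (ω ω' : Omega β β A) (x : RelTensor α β →L[ℂ] RelTensor α β) (v : 𝔎 →L[ℂ] 𝔎) :
    Prop :=
  ∃ c : A, IsSliceRight ω' x c.1 ∧ v = ω.toMap c

/-- `v = (ω ⊠ ω')(x)` for `ω, ω' ∈ Ω_α(A)`, where `ω ⊠ ω' = ω' ∘ (ω ∗ Id)`. -/
def IsBoxRight (ω ω' : Omega α α A) (x : RelTensor α β →L[ℂ] RelTensor α β) (v : 𝔎 →L[ℂ] 𝔎) :
    Prop :=
  ∃ c : A, IsSliceLeft ω x c.1 ∧ v = ω'.toMap c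

/-- `v = (ω ⊠ ω')(x)` for `ω, ω' ∈ Ω_{β,α}(A)`: if `ω = ω_{ξ,ξ'}` and `ω' = ω_{η,η'}`, then
`ω ⊠ ω' = ω_{θ,θ'}` with `θ_{m,n} = |ηₙ⟩₂ ξₘ` and `θ'_{m,n} = |ξ'ₘ⟩₁ η'ₙ`. -/
def IsBoxLeftRight (ω ω' : Omega β α A) (x : RelTensor α β →L[ℂ] RelTensor α β) (v : 𝔎 →L[ℂ] 𝔎) :
    Prop :=
  ∀ (ξ : ℕ → β.space) (ξ' : ℕ → α.space) (η : ℕ → β.space) (η' : ℕ → α.space),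
    Represents ξ ξ' ω.toMap → Represents η η' ω'.toMap →
    HasSum (fun p : ℕ × ℕ => ((ket2 (η p.2) ∘L (ξ p.1).1)†) ∘L x ∘L (ket1 (ξ' p.1) ∘L (η' p.2).1)) v

/-- `v = (ω ⊠ ω')(x)` for `ω, ω' ∈ Ω_{α,β}(A)`: if `ω = ω_{ξ',ξ}` and `ω' = ω_{η',η}`, then
`ω ⊠ ω' = ω_{θ',θ}` with `θ'_{m,n} = |ξ'ₘ⟩₁ η'ₙ` and `θ_{m,n} = |ηₙ⟩₂ ξₘ`. -/
def IsBoxRightLeft (ω ω' : Omega α β A) (x : RelTensor α β →L[ℂ] RelTensor α β) (v : 𝔎 →L[ℂ] 𝔎) :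
    Prop :=
  ∀ (ξ' : ℕ → α.space) (ξ : ℕ → β.space) (η' : ℕ → α.space) (η : ℕ → β.space),
    Represents ξ' ξ ω.toMap → Represents η' η ω'.toMap →
    HasSum (fun p : ℕ × ℕ => ((ket1 (ξ' p.1) ∘L (η' p.2).1)†) ∘L x ∘L (ket2 (η p.2) ∘L (ξ p.1).1)) v

end Convolution

end Modules

/-- The set `Ω`, identified through `val` with a subset of a complex vector space `V`, is a
Banach algebra: with the vector space operations of `V`, the norm `N` and the product described
by `prod` (`prod x y z` says that `z` is the product of `x` and `y`), it is an associative,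
not necessarily unital, complete normed algebra over `ℂ` with `‖x y‖ ≤ ‖x‖ ‖y‖`. -/
def IsBanachAlgebra {Ω V : Type*} [AddCommGroup V] [Module ℂ V] (val : Ω → V) (N : Ω → ℝ)
    (prod : Ω → Ω → Ω → Prop) : Prop :=
  ∃ (_ : NonUnitalNormedRing Ω) (_ : NormedSpace ℂ Ω),
    IsScalarTower ℂ Ω Ω ∧ SMulCommClass ℂ Ω Ω ∧ CompleteSpace Ω ∧
    (∀ x y : Ω, val (x + y) = val x + val y) ∧
    (∀ (c : ℂ) (x : Ω), val (c • x) = c • val x) ∧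
    (∀ x : Ω, ‖x‖ = N x) ∧
    ∀ x y : Ω, prod x y (x * y)

end CStarRel

namespace CStarRel

/-! A functional in Ω is a sandwich ω(a) = ∑ ξₙ* a ξ'ₙ between two columns of operators, where ‖ξ‖²
is the least c with ∑ ‖ξₙ u‖² ≤ c ‖u‖² for all u. The normed space structure comes from operations
on columns. Concatenation of columns adds functionals. Rescaling gives both columns squared norm at
most r for any r > ‖ω‖ (`Omega.exists_isRep_lt`). Concatenating two such balanced columns gives the
triangle inequality, and concatenating infinitely many gives completeness.

The product is ω_{θ,θ'} ∘ Δ, where θ and θ' are the columns of all products |ξ⟩₁η in α ▷ α or |η⟩₂ξ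
in β ◁ β; a Schur bound gives ‖θ‖ ≤ ‖ξ‖ ‖η‖. The main point is that such a pullback lies in Ω(A)
with norm at most ‖θ‖ ‖θ'‖ (`exists_pullback`), and this is where joint normality enters. For
finitely many Tᵢ in I put Y = ∑ Tᵢ Tᵢ*, G = (Y + ε²)^(-1/2) and Sᵢ = G Tᵢ. Then Sᵢ lies in I, and e
= ∑ Sᵢ Sᵢ* is a contraction that almost fixes every Tᵢ. Since I spans the target module, e can be
chosen to almost fix the whole column θ'. Intertwining turns θ* Δ(a) e θ' into ∑ (Sᵢ*θ)* a (Sᵢ*θ'),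
an element of Ω(A), and the compressed columns Sᵢ*θ, Sᵢ*θ' are not longer than θ, θ'. The remainder
(1 - e)θ' is treated in the same way, and the resulting series converges in Ω(A).

Independence of the representing columns comes from the fiber product. If both columns carry the
same kind of ket, the operators ⟨η|₂ Δ(a) |η'⟩₂ and ⟨ξ|₁ Δ(a) |ξ'⟩₁ lie in A, so only values of ω on
A occur. In the mixed cases Δ(a)|η⟩₂ lies in [|β⟩₂ A], and ⟨ξ|₁ |η⟩₂ = η ξ* again reduces to values
on A; the other factor follows by taking adjoints.

For associativity, (ω * ω') * ω'' is computed as a sandwich of (Δ ∗ Id)(Δ(a)) between triple product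
columns, and ω * (ω' * ω'') as one of (Id ∗ Δ)(Δ(a)). For compressed columns this is the defining
relation of Δ ∗ Id with S ⊗ Id, respectively Id ∗ Δ with Id ⊗ S; the general case follows by
approximation (`amplified_pullback`). Coassociativity and the isometric associator identify the two
sandwiches. -/

theorem hasSum_of_eq {ι M : Type*} [AddCommMonoid M] [TopologicalSpace M] {f g : ι → M} {a : M}
    (h : HasSum f a) (e : ∀ i, f i = g i) : HasSum g a :=
  funext e ▸ h

/-! ### Columns of operators: norm bounds and norm convergence. -/

section Columns

variable {ι κ E E' F F' G : Type*}
  [NormedAddCommGroup E] [InnerProductSpace ℂ E] [CompleteSpace E]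
  [NormedAddCommGroup E'] [InnerProductSpace ℂ E'] [CompleteSpace E']
  [NormedAddCommGroup F] [InnerProductSpace ℂ F] [CompleteSpace F]
  [NormedAddCommGroup F'] [InnerProductSpace ℂ F'] [CompleteSpace F']
  [NormedAddCommGroup G] [InnerProductSpace ℂ G] [CompleteSpace G]

/-- The finite column of the operators `f i`, `i ∈ s`, has norm at most `√c`. -/
def FinColLE (f : ι → E →L[ℂ] F) (s : Finset ι) (c : ℝ) : Prop :=
  ∀ u : E, ∑ i ∈ s, ‖f i u‖ ^ 2 ≤ c * ‖u‖ ^ 2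

/-- The column of the operators `f i` is bounded with norm at most `√c`. -/
def ColLE (f : ι → E →L[ℂ] F) (c : ℝ) : Prop :=
  ∀ s : Finset ι, FinColLE f s c

/-- The column of the operators `f i` is the norm limit of its finite parts. -/
def ColSummable (f : ι → E →L[ℂ] F) : Prop :=
  ∀ ε > 0, ∃ s : Finset ι, ∀ t : Finset ι, Disjoint t s → FinColLE f t ε

theorem FinColLE.mono {f : ι → E →L[ℂ] F} {s : Finset ι} {c d : ℝ} (h : FinColLE f s c)
    (hcd : c ≤ d) : FinColLE f s d := fun u => (h u).trans (by gcongr)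

theorem FinColLE.subset {f : ι → E →L[ℂ] F} {s t : Finset ι} {c : ℝ} (h : FinColLE f s c)
    (hts : t ⊆ s) : FinColLE f t c := fun u =>
  (Finset.sum_le_sum_of_subset_of_nonneg hts fun _ _ _ => by positivity).trans (h u)

/-- Cauchy–Schwarz for columns: with y the value at v, ‖y‖² is the real part of ∑ ⟪f i y, T (g i
v)⟫, which is at most √c ‖y‖ · ‖T‖ · √d ‖v‖; then ‖y‖ is cancelled. -/
theorem norm_sum_adjoint_comp_le {f : ι → E →L[ℂ] F} {g : ι → E' →L[ℂ] F'} {s : Finset ι} {c d : ℝ}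
    (hc : 0 ≤ c) (hd : 0 ≤ d) (hf : FinColLE f s c) (hg : FinColLE g s d) (T : F' →L[ℂ] F) :
    ‖∑ i ∈ s, ((f i)†) ∘L T ∘L g i‖ ≤ √c * √d * ‖T‖ := by
  refine ContinuousLinearMap.opNorm_le_bound _ (by positivity) fun v => ?_
  set y := (∑ i ∈ s, ((f i)†) ∘L T ∘L g i) v with hy
  have h1 : ‖y‖ ^ 2 ≤ ∑ i ∈ s, ‖f i y‖ * (‖T‖ * ‖g i v‖) := by
    have : ‖y‖ ^ 2 = RCLike.re (∑ i ∈ s, ⟪f i y, T (g i v)⟫_ℂ) := by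
      rw [← inner_self_eq_norm_sq (𝕜 := ℂ)]
      nth_rw 2 [hy]
      simp only [sum_apply, inner_sum, ContinuousLinearMap.comp_apply,
        ContinuousLinearMap.adjoint_inner_right]
    rw [this, map_sum]
    refine Finset.sum_le_sum fun i _ => ?_
    refine (re_inner_le_norm _ _).trans ?_
    gcongr
    exact T.le_opNorm _
  have h2 : ∑ i ∈ s, ‖f i y‖ * (‖T‖ * ‖g i v‖) ≤ (√c * ‖y‖) * (‖T‖ * (√d * ‖v‖)) := by
    have e : ∑ i ∈ s, ‖f i y‖ * (‖T‖ * ‖g i v‖) = ‖T‖ * ∑ i ∈ s, ‖f i y‖ * ‖g i v‖ := by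
      rw [Finset.mul_sum]; exact Finset.sum_congr rfl fun i _ => by ring
    have cs := Real.sum_mul_le_sqrt_mul_sqrt s (fun i => ‖f i y‖) (fun i => ‖g i v‖)
    have e1 : √(∑ i ∈ s, ‖f i y‖ ^ 2) ≤ √c * ‖y‖ := by
      refine (Real.sqrt_le_sqrt (hf y)).trans ?_
      rw [Real.sqrt_mul hc, Real.sqrt_sq (norm_nonneg _)]
    have e2 : √(∑ i ∈ s, ‖g i v‖ ^ 2) ≤ √d * ‖v‖ := by
      refine (Real.sqrt_le_sqrt (hg v)).trans ?_
      rw [Real.sqrt_mul hd, Real.sqrt_sq (norm_nonneg _)]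
    rw [e]
    calc ‖T‖ * ∑ i ∈ s, ‖f i y‖ * ‖g i v‖ ≤ ‖T‖ * ((√c * ‖y‖) * (√d * ‖v‖)) := by
          gcongr
          exact cs.trans (by gcongr)
      _ = _ := by ring
  by_cases h0 : ‖y‖ = 0
  · rw [h0]; positivity
  · have hpos : 0 < ‖y‖ := lt_of_le_of_ne (norm_nonneg _) (Ne.symm h0)
    refine le_of_mul_le_mul_left ?_ hpos
    calc ‖y‖ * ‖y‖ = ‖y‖ ^ 2 := by ring
      _ ≤ _ := h1.trans h2
      _ = _ := by ring

theorem sum_norm_sq_eq (f : ι → E →L[ℂ] F) (s : Finset ι) (u : E) :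
    ∑ i ∈ s, ‖f i u‖ ^ 2 = RCLike.re ⟪u, (∑ i ∈ s, ((f i)†) ∘L f i) u⟫_ℂ := by
  simp only [sum_apply, inner_sum, ContinuousLinearMap.comp_apply,
    ContinuousLinearMap.adjoint_inner_right, map_sum, inner_self_eq_norm_sq]

theorem finColLE_norm (f : ι → E →L[ℂ] F) (s : Finset ι) :
    FinColLE f s ‖∑ i ∈ s, ((f i)†) ∘L f i‖ := fun u => by
  rw [sum_norm_sq_eq]
  refine (re_inner_le_norm _ _).trans ?_
  calc ‖u‖ * ‖(∑ i ∈ s, ((f i)†) ∘L f i) u‖ ≤ ‖u‖ * (‖∑ i ∈ s, ((f i)†) ∘L f i‖ * ‖u‖) := by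
        gcongr; exact ContinuousLinearMap.le_opNorm _ _
    _ = _ := by ring

theorem norm_sum_adjoint_comp_self_le {f : ι → E →L[ℂ] F} {s : Finset ι} {c : ℝ} (hc : 0 ≤ c)
    (hf : FinColLE f s c) : ‖∑ i ∈ s, ((f i)†) ∘L f i‖ ≤ c := by
  have h := norm_sum_adjoint_comp_le hc hc hf hf (ContinuousLinearMap.id ℂ F)
  simp only [ContinuousLinearMap.id_comp, Real.mul_self_sqrt hc] at h
  refine h.trans (mul_le_of_le_one_right hc ContinuousLinearMap.norm_id_le)

/-- The norm of a finite sum of `(f i)† ∘L f i` is the least admissible constant in `FinColLE`, so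
both sides are the same Cauchy condition. -/
theorem colSummable_iff {f : ι → E →L[ℂ] F} :
    ColSummable f ↔ Summable fun i => ((f i)†) ∘L f i := by
  rw [summable_iff_vanishing_norm]
  constructor
  · intro h ε hε
    obtain ⟨s, hs⟩ := h (ε / 2) (by positivity)
    refine ⟨s, fun t ht => ?_⟩
    refine (norm_sum_adjoint_comp_self_le (by positivity) (hs t ht)).trans_lt (by linarith)
  · intro h ε hε
    obtain ⟨s, hs⟩ := h ε hε
    exact ⟨s, fun t ht => (finColLE_norm f t).mono (hs t ht).le⟩

/-- The finite sums of ‖f i u‖² are partial sums of a nonnegative series with value ⟪u, (∑ f i* f i)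
u⟫. -/
theorem ColSummable.colLE_norm {f : ι → E →L[ℂ] F} (hf : ColSummable f) :
    ColLE f ‖∑' i, ((f i)†) ∘L f i‖ := fun s u => by
  have h : HasSum (fun i => ‖f i u‖ ^ 2)
      (RCLike.re ⟪u, (∑' i, ((f i)†) ∘L f i) u⟫_ℂ) := by
    have h1 := (colSummable_iff.1 hf).hasSum
    have h2 := (h1.mapL (ContinuousLinearMap.apply ℂ E u)).mapL (innerSL ℂ u)
    have h3 := h2.mapL (RCLike.reCLM (K := ℂ))
    refine hasSum_of_eq h3 fun i => ?_
    simp [ContinuousLinearMap.adjoint_inner_right, ← inner_self_eq_norm_sq (𝕜 := ℂ)]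
  refine (sum_le_hasSum s (fun _ _ => by positivity) h).trans ?_
  refine (re_inner_le_norm _ _).trans ?_
  calc ‖u‖ * ‖(∑' i, ((f i)†) ∘L f i) u‖ ≤ ‖u‖ * (‖∑' i, ((f i)†) ∘L f i‖ * ‖u‖) := by
        gcongr; exact ContinuousLinearMap.le_opNorm _ _
    _ = _ := by ring

/-- Together with `ColSummable.colLE_norm` this identifies the squared column norm with the least c
for which `ColLE` holds, so that `seqNorm` can be handled through `ColLE` alone. -/
theorem ColSummable.norm_tsum_le {f : ι → E →L[ℂ] F} (hf : ColSummable f) {c : ℝ} (hc : 0 ≤ c)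
    (h : ColLE f c) : ‖∑' i, ((f i)†) ∘L f i‖ ≤ c :=
  le_of_tendsto (colSummable_iff.1 hf).hasSum.norm
    (Filter.Eventually.of_forall fun s => norm_sum_adjoint_comp_self_le hc (h s))

theorem ColLE.zero (f : ι → E →L[ℂ] F) (hf : ∀ i, f i = 0) : ColLE f 0 := fun s u => by
  simp [hf]

theorem ColSummable.of_finite [Finite ι] (f : ι → E →L[ℂ] F) : ColSummable f := by
  have := Fintype.ofFinite ι
  refine fun ε hε => ⟨Finset.univ, fun t ht => ?_⟩
  have : t = ∅ := by
    rw [Finset.disjoint_left] at ht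
    exact Finset.eq_empty_of_forall_notMem fun i hi => ht hi (Finset.mem_univ i)
  subst this
  intro u
  simp only [Finset.sum_empty]; positivity

theorem ColSummable.zero : ColSummable fun _ : ι => (0 : E →L[ℂ] F) := fun ε hε =>
  ⟨∅, fun t _ u => by simp; positivity⟩

theorem FinColLE.comp_left {f : ι → E →L[ℂ] F} {s : Finset ι} {c : ℝ} (h : FinColLE f s c)
    (S : F →L[ℂ] G) : FinColLE (fun i => S ∘L f i) s (‖S‖ ^ 2 * c) := fun u => by
  calc ∑ i ∈ s, ‖S (f i u)‖ ^ 2 ≤ ∑ i ∈ s, ‖S‖ ^ 2 * ‖f i u‖ ^ 2 :=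
        Finset.sum_le_sum fun i _ => by
          rw [← mul_pow]; gcongr; exact S.le_opNorm _
    _ = ‖S‖ ^ 2 * ∑ i ∈ s, ‖f i u‖ ^ 2 := by rw [Finset.mul_sum]
    _ ≤ ‖S‖ ^ 2 * (c * ‖u‖ ^ 2) := by gcongr; exact h u
    _ = _ := by ring

/-- Summability of columns passes to families that are dominated on finite sets. -/
theorem ColSummable.of_dominated {f : ι → E →L[ℂ] F} {g : ι → E →L[ℂ] G} (C : ℝ)
    (h : ∀ (s : Finset ι) c, FinColLE f s c → FinColLE g s (C * c)) (hf : ColSummable f) :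
    ColSummable g := fun ε hε => by
  obtain ⟨s, hs⟩ := hf (ε / (|C| + 1)) (by positivity)
  refine ⟨s, fun t ht => (h t _ (hs t ht)).mono ?_⟩
  calc C * (ε / (|C| + 1)) ≤ (|C| + 1) * (ε / (|C| + 1)) := by
        gcongr
        linarith [le_abs_self C]
    _ = ε := by field_simp

theorem ColSummable.comp_left {f : ι → E →L[ℂ] F} (h : ColSummable f)
    (S : F →L[ℂ] G) : ColSummable fun i => S ∘L f i :=
  h.of_dominated (‖S‖ ^ 2) fun _ _ hc => hc.comp_left S

theorem FinColLE.comp_right {f : ι → E →L[ℂ] F} {s : Finset ι} {c : ℝ} (hc : 0 ≤ c)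
    (h : FinColLE f s c) (S : G →L[ℂ] E) : FinColLE (fun i => f i ∘L S) s (‖S‖ ^ 2 * c) :=
  fun u => by
    calc ∑ i ∈ s, ‖f i (S u)‖ ^ 2 ≤ c * ‖S u‖ ^ 2 := h _
      _ ≤ c * (‖S‖ * ‖u‖) ^ 2 := by gcongr; exact S.le_opNorm _
      _ = _ := by ring

theorem ColSummable.comp_right {f : ι → E →L[ℂ] F} (h : ColSummable f)
    (S : G →L[ℂ] E) : ColSummable fun i => f i ∘L S := fun ε hε => by
  obtain ⟨s, hs⟩ := h (ε / (‖S‖ ^ 2 + 1)) (by positivity)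
  refine ⟨s, fun t ht => ((hs t ht).comp_right (by positivity) S).mono ?_⟩
  rw [mul_div_assoc', div_le_iff₀ (by positivity)]
  nlinarith

theorem FinColLE.smul {f : ι → E →L[ℂ] F} {s : Finset ι} {c : ℝ} (h : FinColLE f s c) (z : ℂ) :
    FinColLE (fun i => z • f i) s (‖z‖ ^ 2 * c) := fun u => by
  have : ∀ i, ‖(z • f i) u‖ ^ 2 = ‖z‖ ^ 2 * ‖f i u‖ ^ 2 := fun i => by
    rw [smul_apply, norm_smul, mul_pow]
  simp only [this]
  rw [← Finset.mul_sum, mul_assoc]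
  gcongr
  exact h u

theorem ColSummable.smul {f : ι → E →L[ℂ] F} (h : ColSummable f) (z : ℂ) :
    ColSummable fun i => z • f i :=
  h.of_dominated (‖z‖ ^ 2) fun _ _ hc => hc.smul z

theorem FinColLE.add {f g : ι → E →L[ℂ] F} {s : Finset ι} {c d : ℝ} (hf : FinColLE f s c)
    (hg : FinColLE g s d) : FinColLE (fun i => f i + g i) s (2 * (c + d)) := fun u => by
  have : ∀ i, ‖(f i + g i) u‖ ^ 2 ≤ 2 * (‖f i u‖ ^ 2 + ‖g i u‖ ^ 2) := fun i => by
    have h1 : ‖(f i + g i) u‖ ≤ ‖f i u‖ + ‖g i u‖ := norm_add_le _ _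
    nlinarith [norm_nonneg ((f i + g i) u), norm_nonneg (f i u), norm_nonneg (g i u),
      sq_nonneg (‖f i u‖ - ‖g i u‖)]
  calc ∑ i ∈ s, ‖(f i + g i) u‖ ^ 2 ≤ ∑ i ∈ s, 2 * (‖f i u‖ ^ 2 + ‖g i u‖ ^ 2) :=
        Finset.sum_le_sum fun i _ => this i
    _ = 2 * (∑ i ∈ s, ‖f i u‖ ^ 2 + ∑ i ∈ s, ‖g i u‖ ^ 2) := by
        rw [← Finset.mul_sum, Finset.sum_add_distrib]
    _ ≤ 2 * (c * ‖u‖ ^ 2 + d * ‖u‖ ^ 2) := by gcongr <;> [exact hf u; exact hg u]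
    _ = _ := by ring

theorem ColSummable.add {f g : ι → E →L[ℂ] F} (hf : ColSummable f) (hg : ColSummable g) :
    ColSummable fun i => f i + g i := fun ε hε => by
  classical
  obtain ⟨s, hs⟩ := hf (ε / 4) (by positivity)
  obtain ⟨t, ht⟩ := hg (ε / 4) (by positivity)
  refine ⟨s ∪ t, fun r hr => ?_⟩
  rw [Finset.disjoint_union_right] at hr
  exact ((hs r hr.1).add (ht r hr.2)).mono (by linarith)

theorem ColSummable.sub {f g : ι → E →L[ℂ] F} (hf : ColSummable f) (hg : ColSummable g) :
    ColSummable fun i => f i - g i := by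
  have := hf.add (hg.smul (-1))
  simpa [sub_eq_add_neg] using this

theorem ColLE.elim {f : ι → E →L[ℂ] F} {g : κ → E →L[ℂ] F} {c d : ℝ} (hf : ColLE f c)
    (hg : ColLE g d) : ColLE (Sum.elim f g) (c + d) := fun s u => by
  have h : ∑ i ∈ s, ‖Sum.elim f g i u‖ ^ 2 =
      ∑ i ∈ s.toLeft, ‖f i u‖ ^ 2 + ∑ i ∈ s.toRight, ‖g i u‖ ^ 2 := by
    rw [← Finset.toLeft_disjSum_toRight (u := s), Finset.sum_disjSum]
    simp
  rw [h, add_mul]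
  exact add_le_add (hf _ u) (hg _ u)

theorem ColSummable.elim {f : ι → E →L[ℂ] F} {g : κ → E →L[ℂ] F} (hf : ColSummable f)
    (hg : ColSummable g) : ColSummable (Sum.elim f g) := by
  rw [colSummable_iff] at hf hg ⊢
  have := HasSum.sum (f := fun i => ((Sum.elim f g i)†) ∘L Sum.elim f g i) hf.hasSum hg.hasSum
  exact this.summable

/-- Columns of columns. -/
theorem colSummable_prod {f : ι × κ → E →L[ℂ] F} {c : ι → ℝ} (hc : Summable c)
    (hc0 : ∀ i, 0 ≤ c i)
    (hf : ∀ i, ColSummable fun k => f (i, k)) (hfc : ∀ i, ColLE (fun k => f (i, k)) (c i)) :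
    ColSummable f ∧ ColLE f (∑' i, c i) := by
  classical
  -- Row-wise bounds add up. The bounds `d` are left free so that tail bounds can be used for some
  -- rows and full bounds for the others.
  have key : ∀ (s : Finset ι) (t : Finset (ι × κ)), t.image Prod.fst ⊆ s → ∀ d : ι → ℝ,
      (∀ i ∈ s, ∀ t' : Finset κ, (∀ k ∈ t', (i, k) ∈ t) →
        FinColLE (fun k => f (i, k)) t' (d i)) → FinColLE f t (∑ i ∈ s, d i) := by
    intro s t hts d hd u
    have hsub : t ⊆ (s.sigma (fun i => (t.filter fun p => p.1 = i).image Prod.snd)).image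
        (fun p => (p.1, p.2)) := by
      intro p hp
      simp only [Finset.mem_image, Finset.mem_sigma, Finset.mem_filter, Sigma.exists]
      exact ⟨p.1, p.2, ⟨hts (Finset.mem_image_of_mem _ hp), p, ⟨hp, rfl⟩, rfl⟩, rfl⟩
    refine (Finset.sum_le_sum_of_subset_of_nonneg hsub fun _ _ _ => by positivity).trans ?_
    rw [Finset.sum_image (by rintro ⟨a, b⟩ _ ⟨a', b'⟩ _ h; simp_all), Finset.sum_sigma,
      Finset.sum_mul]
    refine Finset.sum_le_sum fun i hi => hd i hi _ ?_ u
    intro k hk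
    simp only [Finset.mem_image, Finset.mem_filter] at hk
    obtain ⟨⟨a, b⟩, ⟨h1, h2⟩, h3⟩ := hk
    simp only at h2 h3
    subst h2 h3
    exact h1
  have hle : ColLE f (∑' i, c i) := fun t =>
    (key (t.image Prod.fst) t le_rfl c fun i _ t' _ => hfc i t').mono
      (hc.sum_le_tsum _ fun i _ => hc0 i)
  refine ⟨fun ε hε => ?_, hle⟩
  obtain ⟨s, hs⟩ := summable_iff_vanishing_norm.1 hc (ε / 2) (by positivity)
  have hε' : 0 < ε / 2 / (s.card + 1) := by positivity
  choose T hT using fun i => hf i (ε / 2 / (s.card + 1)) hε'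
  refine ⟨(s.sigma T).image fun p => (p.1, p.2), fun t ht => ?_⟩
  -- Outside the finite set, the finitely many rows in `s` contribute only their small tails, ε/2 in
  -- total, and the remaining rows contribute a tail of ∑ c i.
  have h1 := key (s ∪ t.image Prod.fst) t Finset.subset_union_right
    (fun i => if i ∈ s then ε / 2 / (s.card + 1) else c i) (fun i _ t' ht' => by
      split_ifs with his
      · refine hT i t' ?_
        rw [Finset.disjoint_left]
        intro k hk hk'
        refine Finset.disjoint_left.1 ht (ht' k hk) ?_
        simp only [Finset.mem_image, Finset.mem_sigma, Sigma.exists]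
        exact ⟨i, k, ⟨his, hk'⟩, rfl⟩
      · exact hfc i t')
  refine h1.mono ?_
  have h2 : s ∪ t.image Prod.fst = s ∪ (t.image Prod.fst \ s) := by simp
  rw [h2, Finset.sum_union Finset.disjoint_sdiff]
  have h3 : ∑ i ∈ s, (if i ∈ s then ε / 2 / (s.card + 1) else c i) ≤ ε / 2 := by
    rw [Finset.sum_congr rfl fun i hi => if_pos hi, Finset.sum_const, nsmul_eq_mul,
      mul_div_assoc', div_le_iff₀ (by positivity)]
    nlinarith
  have h4 : ∑ i ∈ t.image Prod.fst \ s, (if i ∈ s then ε / 2 / (s.card + 1) else c i) ≤ ε / 2 := by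
    rw [Finset.sum_congr rfl fun i hi => if_neg (Finset.mem_sdiff.1 hi).2]
    exact (le_abs_self _).trans (hs _ Finset.sdiff_disjoint).le
  linarith

end Columns

/-! ### Sandwiches ∑ f i* T g i between two columns. -/

section Sandwich

variable {ι κ E E' F F' : Type*}
  [NormedAddCommGroup E] [InnerProductSpace ℂ E] [CompleteSpace E]
  [NormedAddCommGroup E'] [InnerProductSpace ℂ E'] [CompleteSpace E']
  [NormedAddCommGroup F] [InnerProductSpace ℂ F] [CompleteSpace F]
  [NormedAddCommGroup F'] [InnerProductSpace ℂ F'] [CompleteSpace F']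

/-- The operator `∑ f_i* T g_i`. -/
noncomputable def sand (f : ι → E →L[ℂ] F) (g : ι → E' →L[ℂ] F') (T : F' →L[ℂ] F) : E' →L[ℂ] E :=
  ∑' i, ((f i)†) ∘L T ∘L g i

variable {f f' : ι → E →L[ℂ] F} {g g' : ι → E' →L[ℂ] F'}

/-- The column Cauchy–Schwarz inequality bounds the tails: two column tails of squared norm at most
δ give a sandwich tail of norm at most δ ‖T‖. -/
theorem hasSum_sand (hf : ColSummable f) (hg : ColSummable g) (T : F' →L[ℂ] F) :
    HasSum (fun i => ((f i)†) ∘L T ∘L g i) (sand f g T) := by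
  classical
  refine Summable.hasSum (summable_iff_vanishing_norm.2 fun ε hε => ?_)
  have hδ : 0 < ε / 2 / (‖T‖ + 1) := by positivity
  obtain ⟨s, hs⟩ := hf _ hδ
  obtain ⟨t, ht⟩ := hg _ hδ
  refine ⟨s ∪ t, fun r hr => ?_⟩
  rw [Finset.disjoint_union_right] at hr
  have h := norm_sum_adjoint_comp_le hδ.le hδ.le (hs r hr.1) (ht r hr.2) T
  rw [Real.mul_self_sqrt hδ.le, div_mul_eq_mul_div] at h
  refine h.trans_lt ?_
  rw [div_lt_iff₀ (by positivity)]
  nlinarith [norm_nonneg T]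

theorem norm_sand_le (hf : ColSummable f) (hg : ColSummable g) {c d : ℝ} (hc : 0 ≤ c) (hd : 0 ≤ d)
    (hfc : ColLE f c) (hgd : ColLE g d) (T : F' →L[ℂ] F) : ‖sand f g T‖ ≤ √c * √d * ‖T‖ :=
  le_of_tendsto (hasSum_sand hf hg T).norm
    (Filter.Eventually.of_forall fun s => norm_sum_adjoint_comp_le hc hd (hfc s) (hgd s) T)

theorem ColSummable.exists_colLE (hf : ColSummable f) : ∃ c, 0 ≤ c ∧ ColLE f c :=
  ⟨_, norm_nonneg _, hf.colLE_norm⟩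

/-- `sand f g T` as a continuous linear function of `T`. -/
noncomputable def sandL (hf : ColSummable f) (hg : ColSummable g) :
    (F' →L[ℂ] F) →L[ℂ] (E' →L[ℂ] E) :=
  LinearMap.mkContinuous
    { toFun := sand f g
      map_add' := fun T T' => by
        refine ((hasSum_sand hf hg T).add (hasSum_sand hf hg T')).unique ?_ |>.symm
        refine hasSum_of_eq (hasSum_sand hf hg (T + T')) fun i => ?_
        simp
      map_smul' := fun z T => by
        refine ((hasSum_sand hf hg T).const_smul z).unique ?_ |>.symm
        refine hasSum_of_eq (hasSum_sand hf hg (z • T)) fun i => ?_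
        simp }
    (√(‖∑' i, ((f i)†) ∘L f i‖) * √(‖∑' i, ((g i)†) ∘L g i‖))
    (norm_sand_le hf hg (norm_nonneg _) (norm_nonneg _) hf.colLE_norm hg.colLE_norm)

theorem sandL_apply (hf : ColSummable f) (hg : ColSummable g) (T : F' →L[ℂ] F) :
    sandL hf hg T = sand f g T := rfl

theorem sand_sub_right (hf : ColSummable f) (hg : ColSummable g) (hg' : ColSummable g')
    (T : F' →L[ℂ] F) : sand f (fun i => g i - g' i) T = sand f g T - sand f g' T := by
  refine (hasSum_sand hf (hg.sub hg') T).unique ?_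
  refine hasSum_of_eq ((hasSum_sand hf hg T).sub (hasSum_sand hf hg' T)) fun i => ?_
  simp

theorem sand_smul_right (z : ℂ) (hf : ColSummable f) (hg : ColSummable g)
    (T : F' →L[ℂ] F) : sand f (fun i => z • g i) T = z • sand f g T := by
  refine (hasSum_sand hf (hg.smul z) T).unique ?_
  refine hasSum_of_eq ((hasSum_sand hf hg T).const_smul z) fun i => ?_
  simp

theorem sand_elim {f₂ : κ → E →L[ℂ] F} {g₂ : κ → E' →L[ℂ] F'} (hf : ColSummable f)
    (hg : ColSummable g) (hf₂ : ColSummable f₂) (hg₂ : ColSummable g₂) (T : F' →L[ℂ] F) :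
    sand (Sum.elim f f₂) (Sum.elim g g₂) T = sand f g T + sand f₂ g₂ T :=
  (hasSum_sand (hf.elim hf₂) (hg.elim hg₂) T).unique
    (HasSum.sum (f := fun i => ((Sum.elim f f₂ i)†) ∘L T ∘L Sum.elim g g₂ i)
      (hasSum_sand hf hg T) (hasSum_sand hf₂ hg₂ T))

theorem adjoint_sand (hf : ColSummable f) (hg : ColSummable g) (T : F' →L[ℂ] F) :
    (sand f g T)† = sand g f (T†) := by
  refine HasSum.unique ?_ (hasSum_sand hg hf (T†))
  have h := (hasSum_sand hf hg T).mapL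
    (ContinuousLinearMap.adjoint (𝕜 := ℂ) (E := E') (F := E)).toContinuousLinearEquiv.toContinuousLinearMap
  refine hasSum_of_eq h fun i => ?_
  change ((((f i)†) ∘L T ∘L g i)†) = _
  rw [ContinuousLinearMap.adjoint_comp, ContinuousLinearMap.adjoint_comp,
    ContinuousLinearMap.adjoint_adjoint]
  rfl

end Sandwich

/-! ### Changing the index set: injections, zero extension, iterated sums. -/

section Reindex

variable {ι κ E E' F F' : Type*}
  [NormedAddCommGroup E] [InnerProductSpace ℂ E] [CompleteSpace E]
  [NormedAddCommGroup E'] [InnerProductSpace ℂ E'] [CompleteSpace E']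
  [NormedAddCommGroup F] [InnerProductSpace ℂ F] [CompleteSpace F]
  [NormedAddCommGroup F'] [InnerProductSpace ℂ F'] [CompleteSpace F']

theorem FinColLE.comp_injective {f : ι → E →L[ℂ] F} {e : κ → ι} (he : Function.Injective e)
    {t : Finset κ} {c : ℝ} (h : FinColLE f (t.map ⟨e, he⟩) c) : FinColLE (fun k => f (e k)) t c :=
  fun u => by simpa using h u

theorem ColLE.comp_injective {f : ι → E →L[ℂ] F} {e : κ → ι} (he : Function.Injective e)
    {c : ℝ} (h : ColLE f c) : ColLE (fun k => f (e k)) c :=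
  fun _ => FinColLE.comp_injective he (h _)

theorem ColSummable.comp_injective {f : ι → E →L[ℂ] F} {e : κ → ι} (he : Function.Injective e)
    (h : ColSummable f) : ColSummable fun k => f (e k) := fun ε hε => by
  obtain ⟨s, hs⟩ := h ε hε
  refine ⟨s.preimage e he.injOn, fun t ht => FinColLE.comp_injective he (hs _ ?_)⟩
  rw [Finset.disjoint_left] at ht ⊢
  intro i hi hi'
  obtain ⟨k, hk, rfl⟩ := Finset.mem_map.1 hi
  exact ht hk (Finset.mem_preimage.2 hi')

theorem FinColLE.extend {f : ι → E →L[ℂ] F} {e : ι → κ} (he : Function.Injective e)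
    {t : Finset κ} {c : ℝ} (h : FinColLE f (t.preimage e he.injOn) c) :
    FinColLE (Function.extend e f 0) t c := fun u => by
  refine (le_of_eq ?_).trans (h u)
  rw [← Finset.sum_preimage e t he.injOn (fun k => ‖Function.extend e f 0 k u‖ ^ 2)]
  · simp [he.extend_apply]
  · intro k _ hk
    rw [Function.extend_apply' _ _ _ (by simpa using hk)]
    simp

theorem ColLE.extend {f : ι → E →L[ℂ] F} {e : ι → κ} (he : Function.Injective e)
    {c : ℝ} (h : ColLE f c) : ColLE (Function.extend e f 0) c :=
  fun _ => FinColLE.extend he (h _)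

theorem ColSummable.extend {f : ι → E →L[ℂ] F} {e : ι → κ} (he : Function.Injective e)
    (h : ColSummable f) : ColSummable (Function.extend e f 0) := fun ε hε => by
  obtain ⟨s, hs⟩ := h ε hε
  refine ⟨s.map ⟨e, he⟩, fun t ht => FinColLE.extend he (hs _ ?_)⟩
  rw [Finset.disjoint_left] at ht ⊢
  intro i hi hi'
  exact ht (Finset.mem_preimage.1 hi) (Finset.mem_map_of_mem ⟨e, he⟩ hi')

theorem sand_extend {f : ι → E →L[ℂ] F} {g : ι → E' →L[ℂ] F'} {e : ι → κ}
    (he : Function.Injective e) (hf : ColSummable f) (hg : ColSummable g) (T : F' →L[ℂ] F) :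
    sand (Function.extend e f 0) (Function.extend e g 0) T = sand f g T := by
  refine (hasSum_sand (hf.extend he) (hg.extend he) T).unique ?_
  refine hasSum_of_eq ((hasSum_extend_zero he).2 (hasSum_sand hf hg T)) fun k => ?_
  by_cases hk : ∃ i, e i = k
  · obtain ⟨i, rfl⟩ := hk
    simp [he.extend_apply]
  · simp [Function.extend_apply' _ _ _ hk]

theorem sand_comp_equiv {f : ι → E →L[ℂ] F} {g : ι → E' →L[ℂ] F'} (e : κ ≃ ι) (T : F' →L[ℂ] F) :
    sand (fun k => f (e k)) (fun k => g (e k)) T = sand f g T :=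
  e.tsum_eq fun i => ((f i)†) ∘L T ∘L g i

/-- Summability over pairs is unconditional, so a double sandwich may be summed one index at a time;
the independence, distributivity and slice arguments all use this. -/
theorem hasSum_sand_prod {f : ι × κ → E →L[ℂ] F} {g : ι × κ → E' →L[ℂ] F'} (hf : ColSummable f)
    (hg : ColSummable g) (T : F' →L[ℂ] F) :
    HasSum (fun i => sand (fun k => f (i, k)) (fun k => g (i, k)) T) (sand f g T) :=
  (hasSum_sand hf hg T).prod_fiberwise fun i =>
    hasSum_sand (hf.comp_injective (Prod.mk_right_injective i))
      (hg.comp_injective (Prod.mk_right_injective i)) T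

end Reindex

/-! ### Ω as a complete normed space. -/

section OmegaSpace

variable {𝔎 𝔏 H : Type*}
  [NormedAddCommGroup 𝔎] [InnerProductSpace ℂ 𝔎] [CompleteSpace 𝔎]
  [NormedAddCommGroup 𝔏] [InnerProductSpace ℂ 𝔏] [CompleteSpace 𝔏]
  [NormedAddCommGroup H] [InnerProductSpace ℂ H] [CompleteSpace H]
  {a : CStarBase 𝔏} {b : CStarBase 𝔎} {α : CModule a H} {δ : CModule b H}
  {A : NonUnitalStarSubalgebra ℂ (H →L[ℂ] H)}

/-- `ω = ω_{ξ,ξ'}` for column summable families with arbitrary index set. -/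
structure IsRep {ι : Type*} (ξ : ι → α.space) (ξ' : ι → δ.space) (ω : A →L[ℂ] (𝔎 →L[ℂ] 𝔏)) :
    Prop where
  left : ColSummable fun i => (ξ i).1
  right : ColSummable fun i => (ξ' i).1
  sand_eq : ∀ x : A, sand (fun i => (ξ i).1) (fun i => (ξ' i).1) x.1 = ω x

theorem sqSummable_iff {ξ : ℕ → α.space} : SqSummable ξ ↔ ColSummable fun i => (ξ i).1 :=
  colSummable_iff.symm

theorem represents_iff {ξ : ℕ → α.space} {ξ' : ℕ → δ.space} {ω : A →L[ℂ] (𝔎 →L[ℂ] 𝔏)} :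
    Represents ξ ξ' ω ↔ IsRep ξ ξ' ω := by
  constructor
  · rintro ⟨h1, h2, h3⟩
    rw [sqSummable_iff] at h1 h2
    exact ⟨h1, h2, fun x => (hasSum_sand h1 h2 x.1).unique (h3 x)⟩
  · rintro ⟨h1, h2, h3⟩
    refine ⟨sqSummable_iff.2 h1, sqSummable_iff.2 h2, fun x => ?_⟩
    rw [← h3 x]
    exact hasSum_sand h1 h2 x.1

theorem seqNorm_le {ξ : ℕ → α.space} {c : ℝ} (hc : 0 ≤ c) (h : ColSummable fun i => (ξ i).1)
    (hξ : ColLE (fun i => (ξ i).1) c) : seqNorm ξ ≤ √c :=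
  Real.sqrt_le_sqrt (h.norm_tsum_le hc hξ)

theorem colLE_seqNorm {ξ : ℕ → α.space} (h : ColSummable fun i => (ξ i).1) :
    ColLE (fun i => (ξ i).1) (seqNorm ξ ^ 2) := by
  rw [seqNorm, Real.sq_sqrt (norm_nonneg _)]
  exact h.colLE_norm

/-- Zero extension along an injection into ℕ changes neither the functional nor any column bound.
Constructions may therefore use whatever countable index set is natural, such as sums or products.
-/
theorem IsRep.exists_nat {ι : Type*} [Countable ι] {ξ : ι → α.space} {ξ' : ι → δ.space}
    {ω : A →L[ℂ] (𝔎 →L[ℂ] 𝔏)} (h : IsRep ξ ξ' ω) :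
    ∃ (η : ℕ → α.space) (η' : ℕ → δ.space), IsRep η η' ω ∧
      (∀ c, ColLE (fun i => (ξ i).1) c → ColLE (fun i => (η i).1) c) ∧
      (∀ c, ColLE (fun i => (ξ' i).1) c → ColLE (fun i => (η' i).1) c) := by
  obtain ⟨e, he⟩ := exists_injective_nat ι
  have h1 : (fun n => ((Function.extend e ξ 0 n : α.space) : 𝔏 →L[ℂ] H)) =
      Function.extend e (fun i => (ξ i).1) 0 := by
    funext n
    by_cases hk : ∃ i, e i = n
    · obtain ⟨i, rfl⟩ := hk
      simp [he.extend_apply]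
    · simp [Function.extend_apply' _ _ _ hk]
  have h2 : (fun n => ((Function.extend e ξ' 0 n : δ.space) : 𝔎 →L[ℂ] H)) =
      Function.extend e (fun i => (ξ' i).1) 0 := by
    funext n
    by_cases hk : ∃ i, e i = n
    · obtain ⟨i, rfl⟩ := hk
      simp [he.extend_apply]
    · simp [Function.extend_apply' _ _ _ hk]
  refine ⟨Function.extend e ξ 0, Function.extend e ξ' 0, ⟨?_, ?_, fun x => ?_⟩, fun c hc => ?_,
    fun c hc => ?_⟩
  · rw [h1]; exact h.left.extend he
  · rw [h2]; exact h.right.extend he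
  · rw [h1, h2, sand_extend he h.left h.right, h.sand_eq]
  · rw [h1]; exact hc.extend he
  · rw [h2]; exact hc.extend he

namespace Omega

@[ext] theorem ext {ω ω' : Omega α δ A} (h : ∀ x, ω.toMap x = ω'.toMap x) : ω = ω' := by
  cases ω; cases ω'
  congr
  exact ContinuousLinearMap.ext h

theorem toMap_injective : Function.Injective (toMap : Omega α δ A → _) := fun _ _ h =>
  ext fun x => by rw [h]

theorem exists_isRep (ω : Omega α δ A) :
    ∃ (ξ : ℕ → α.space) (ξ' : ℕ → δ.space), IsRep ξ ξ' ω.toMap := by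
  obtain ⟨ξ, ξ', h⟩ := ω.exists_represents
  exact ⟨ξ, ξ', represents_iff.1 h⟩

/-- A functional with a representation over a countable index set. -/
def ofRep {ι : Type*} [Countable ι] {ξ : ι → α.space} {ξ' : ι → δ.space}
    {T : A →L[ℂ] (𝔎 →L[ℂ] 𝔏)} (h : IsRep ξ ξ' T) : Omega α δ A where
  toMap := T
  exists_represents := by
    obtain ⟨η, η', h', -⟩ := h.exists_nat
    exact ⟨η, η', represents_iff.2 h'⟩

/-- The functional `ω_{ξ,ξ'}`. -/
noncomputable def ofFamily {ι : Type*} [Countable ι] (ξ : ι → α.space) (ξ' : ι → δ.space)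
    (h : ColSummable fun i => (ξ i).1) (h' : ColSummable fun i => (ξ' i).1) : Omega α δ A :=
  ofRep (ξ := ξ) (ξ' := ξ')
    (T := ⟨(sandL h h').toLinearMap ∘ₗ A.toSubmodule.subtype,
      (sandL h h').continuous.comp continuous_subtype_val⟩) ⟨h, h', fun _ => rfl⟩

theorem isRep_ofFamily {ι : Type*} [Countable ι] (ξ : ι → α.space) (ξ' : ι → δ.space)
    (h : ColSummable fun i => (ξ i).1) (h' : ColSummable fun i => (ξ' i).1) :
    IsRep ξ ξ' (ofFamily (A := A) ξ ξ' h h').toMap := ⟨h, h', fun _ => rfl⟩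

theorem norm_nonneg (ω : Omega α δ A) : 0 ≤ ω.norm := by
  refine Real.sInf_nonneg ?_
  rintro _ ⟨ξ, ξ', -, rfl⟩
  exact mul_nonneg (Real.sqrt_nonneg _) (Real.sqrt_nonneg _)

theorem norm_le_of_isRep (ω : Omega α δ A) {ι : Type*} [Countable ι] {ξ : ι → α.space}
    {ξ' : ι → δ.space} (h : IsRep ξ ξ' ω.toMap) {c d : ℝ} (hc : 0 ≤ c) (hd : 0 ≤ d)
    (hξ : ColLE (fun i => (ξ i).1) c) (hξ' : ColLE (fun i => (ξ' i).1) d) :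
    ω.norm ≤ √c * √d := by
  obtain ⟨η, η', h', h1, h2⟩ := h.exists_nat
  have hle : ω.norm ≤ seqNorm η * seqNorm η' := by
    refine csInf_le ⟨0, ?_⟩ ⟨η, η', represents_iff.2 h', rfl⟩
    rintro _ ⟨ξ, ξ', -, rfl⟩
    exact mul_nonneg (Real.sqrt_nonneg _) (Real.sqrt_nonneg _)
  exact hle.trans <| mul_le_mul (seqNorm_le hc h'.left (h1 c hξ)) (seqNorm_le hd h'.right (h2 d hξ'))
      (Real.sqrt_nonneg _) (Real.sqrt_nonneg _)

/-- Balanced representations: multiplying one column by z > 0 and the other by its inverse leaves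
the functional unchanged and equalises the bounds. Note that `r` bounds the squares of the column
norms. -/
theorem exists_isRep_lt (ω : Omega α δ A) {r : ℝ} (hr : ω.norm < r) :
    ∃ (ξ : ℕ → α.space) (ξ' : ℕ → δ.space), IsRep ξ ξ' ω.toMap ∧
      ColLE (fun i => (ξ i).1) r ∧ ColLE (fun i => (ξ' i).1) r := by
  have hne : {r : ℝ | ∃ (ξ : ℕ → α.space) (ξ' : ℕ → δ.space),
      Represents ξ ξ' ω.toMap ∧ r = seqNorm ξ * seqNorm ξ'}.Nonempty := by
    obtain ⟨ξ, ξ', h⟩ := ω.exists_represents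
    exact ⟨_, ξ, ξ', h, rfl⟩
  obtain ⟨_, ⟨ξ, ξ', h, rfl⟩, hlt⟩ := exists_lt_of_csInf_lt hne hr
  rw [represents_iff] at h
  have hp : 0 ≤ seqNorm ξ := Real.sqrt_nonneg _
  have hq : 0 ≤ seqNorm ξ' := Real.sqrt_nonneg _
  -- One of the column norms may vanish, so both are first enlarged to positive numbers whose
  -- product still does not exceed `r`.
  obtain ⟨p, q, hp0, hq0, hpp, hqq, hpq⟩ : ∃ p q : ℝ, 0 < p ∧ 0 < q ∧ seqNorm ξ ≤ p ∧
      seqNorm ξ' ≤ q ∧ p * q ≤ r := by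
    have hcont : Filter.Tendsto (fun t : ℝ => (seqNorm ξ + t) * (seqNorm ξ' + t))
        (nhdsWithin 0 (Set.Ioi 0)) (nhds ((seqNorm ξ + 0) * (seqNorm ξ' + 0))) :=
      (Continuous.tendsto (by fun_prop) 0).mono_left nhdsWithin_le_nhds
    rw [add_zero, add_zero] at hcont
    obtain ⟨t, ht, ht0⟩ := ((hcont.eventually_lt_const hlt).and self_mem_nhdsWithin).exists
    have ht0 : 0 < t := ht0
    exact ⟨seqNorm ξ + t, seqNorm ξ' + t, by positivity, by positivity, by linarith, by linarith,
      ht.le⟩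
  -- With this factor the squared bounds become (q/p) p² and (p/q) q², both equal to p q.
  set z : ℝ := √(q / p) with hz
  have hz0 : 0 < z := Real.sqrt_pos.2 (by positivity)
  have hz2 : z ^ 2 = q / p := Real.sq_sqrt (by positivity)
  refine ⟨fun i => (z : ℂ) • ξ i, fun i => ((z⁻¹ : ℝ) : ℂ) • ξ' i,
    ⟨h.left.smul _, h.right.smul _, fun x => ?_⟩, fun s => ?_, fun s => ?_⟩
  · rw [← h.sand_eq x]
    refine tsum_congr fun i => ?_
    simp only [SetLike.val_smul, map_smulₛₗ, Complex.conj_ofReal, ContinuousLinearMap.smul_comp,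
      ContinuousLinearMap.comp_smul, smul_smul]
    rw [← Complex.ofReal_mul, inv_mul_cancel₀ hz0.ne', Complex.ofReal_one, one_smul]
  · refine ((colLE_seqNorm h.left s).smul (z : ℂ)).mono ?_
    rw [Complex.norm_real, Real.norm_of_nonneg hz0.le, hz2]
    calc q / p * seqNorm ξ ^ 2 ≤ q / p * p ^ 2 := by gcongr
      _ = p * q := by field_simp
      _ ≤ r := hpq
  · refine ((colLE_seqNorm h.right s).smul ((z⁻¹ : ℝ) : ℂ)).mono ?_
    rw [Complex.norm_real, Real.norm_of_nonneg (by positivity), inv_pow, hz2]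
    calc (q / p)⁻¹ * seqNorm ξ' ^ 2 ≤ (q / p)⁻¹ * q ^ 2 := by gcongr
      _ = p * q := by field_simp
      _ ≤ r := hpq

/-- Balanced columns with constants close to ‖ω‖ and the sandwich estimate give the bound. It yields
definiteness of the norm and continuity of evaluation at x. -/
theorem norm_toMap_le (ω : Omega α δ A) (x : A) : ‖ω.toMap x‖ ≤ ω.norm * ‖x.1‖ := by
  refine le_of_forall_gt_imp_ge_of_dense fun r hr => ?_
  by_cases hx : ‖x.1‖ = 0
  · have : x = 0 := Subtype.ext (norm_eq_zero.1 hx)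
    subst this
    simp only [map_zero, norm_zero]
    rw [hx, mul_zero] at hr
    exact hr.le
  · have hx' : 0 < ‖x.1‖ := lt_of_le_of_ne (_root_.norm_nonneg _) (Ne.symm hx)
    have h1 : ω.norm < r / ‖x.1‖ := (lt_div_iff₀ hx').2 hr
    have h2 : 0 ≤ r / ‖x.1‖ := ω.norm_nonneg.trans h1.le
    obtain ⟨ξ, ξ', h, hc, hd⟩ := ω.exists_isRep_lt h1
    rw [← h.sand_eq x]
    refine (norm_sand_le h.left h.right h2 h2 hc hd _).trans (le_of_eq ?_)
    rw [Real.mul_self_sqrt h2]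
    field_simp

noncomputable section

instance : Zero (Omega α δ A) where
  zero := ofRep (ι := ℕ) (ξ := 0) (ξ' := 0) (T := 0) ⟨ColSummable.zero, ColSummable.zero, fun x => by
    simp [sand]⟩

theorem isRep_add {ω ω' : A →L[ℂ] (𝔎 →L[ℂ] 𝔏)} {ι κ : Type*} {ξ : ι → α.space} {ξ' : ι → δ.space}
    {η : κ → α.space} {η' : κ → δ.space} (h : IsRep ξ ξ' ω) (h' : IsRep η η' ω') :
    IsRep (Sum.elim ξ η) (Sum.elim ξ' η') (ω + ω') := by
  have e : ∀ (c : CStarBase 𝔏) (γ : CModule c H) (ξ : ι → γ.space) (η : κ → γ.space),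
      (fun i => ((Sum.elim ξ η i : γ.space) : 𝔏 →L[ℂ] H)) =
      Sum.elim (fun i => (ξ i).1) fun i => (η i).1 := by
    intro c γ ξ η; funext i; cases i <;> rfl
  have e' : ∀ (c : CStarBase 𝔎) (γ : CModule c H) (ξ : ι → γ.space) (η : κ → γ.space),
      (fun i => ((Sum.elim ξ η i : γ.space) : 𝔎 →L[ℂ] H)) =
      Sum.elim (fun i => (ξ i).1) fun i => (η i).1 := by
    intro c γ ξ η; funext i; cases i <;> rfl
  refine ⟨?_, ?_, fun x => ?_⟩
  · rw [e]; exact h.left.elim h'.left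
  · rw [e']; exact h.right.elim h'.right
  · rw [e, e', sand_elim h.left h.right h'.left h'.right, h.sand_eq, h'.sand_eq]; rfl

theorem isRep_smul {ω : A →L[ℂ] (𝔎 →L[ℂ] 𝔏)} {ι : Type*} {ξ : ι → α.space} {ξ' : ι → δ.space}
    (h : IsRep ξ ξ' ω) (z : ℂ) : IsRep ξ (fun i => z • ξ' i) (z • ω) :=
  ⟨h.left, h.right.smul z, fun x => by
    have := sand_smul_right z h.left h.right x.1
    rw [h.sand_eq] at this
    exact this⟩

instance : Add (Omega α δ A) where
  add ω ω' := ⟨ω.toMap + ω'.toMap, by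
    obtain ⟨ξ, ξ', h⟩ := ω.exists_isRep
    obtain ⟨η, η', h'⟩ := ω'.exists_isRep
    exact (ofRep (isRep_add h h')).exists_represents⟩

instance : SMul ℂ (Omega α δ A) where
  smul z ω := ⟨z • ω.toMap, by
    obtain ⟨ξ, ξ', h⟩ := ω.exists_isRep
    exact (ofRep (isRep_smul h z)).exists_represents⟩

instance : Neg (Omega α δ A) := ⟨fun ω => (-1 : ℂ) • ω⟩
instance : Sub (Omega α δ A) := ⟨fun ω ω' => ω + -ω'⟩
instance : SMul ℕ (Omega α δ A) := ⟨fun n ω => (n : ℂ) • ω⟩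
instance : SMul ℤ (Omega α δ A) := ⟨fun n ω => (n : ℂ) • ω⟩
instance : Norm (Omega α δ A) := ⟨Omega.norm⟩

theorem norm_def (ω : Omega α δ A) : ‖ω‖ = ω.norm := rfl

theorem toMap_neg (ω : Omega α δ A) : (-ω).toMap = -ω.toMap := neg_one_smul ℂ ω.toMap

theorem toMap_sub (ω ω' : Omega α δ A) : (ω - ω').toMap = ω.toMap - ω'.toMap :=
  ContinuousLinearMap.ext fun x => by
    have h : (-ω').toMap x = -ω'.toMap x := by rw [toMap_neg]; rfl
    change ω.toMap x + (-ω').toMap x = ω.toMap x - ω'.toMap x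
    rw [h, sub_eq_add_neg]

instance : AddCommGroup (Omega α δ A) :=
  toMap_injective.addCommGroup _ rfl (fun _ _ => rfl) toMap_neg toMap_sub
    (fun ω n => Nat.cast_smul_eq_nsmul ℂ n ω.toMap) (fun ω n => Int.cast_smul_eq_zsmul ℂ n ω.toMap)

/-- The inclusion of `Ω` into the space of all bounded maps. -/
def toMapHom : Omega α δ A →+ (A →L[ℂ] (𝔎 →L[ℂ] 𝔏)) where
  toFun := toMap
  map_zero' := rfl
  map_add' _ _ := rfl

instance : Module ℂ (Omega α δ A) :=
  toMap_injective.module ℂ toMapHom fun _ _ => rfl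

theorem norm_smul_le' (z : ℂ) (ω : Omega α δ A) : ‖z • ω‖ ≤ ‖z‖ * ‖ω‖ := by
  by_cases hz : ‖z‖ = 0
  · rw [hz, zero_mul]
    have : z = 0 := norm_eq_zero.1 hz
    subst this
    obtain ⟨ξ, ξ', h⟩ := ω.exists_isRep
    have hc := h.left.colLE_norm
    refine (norm_le_of_isRep _ (isRep_smul h 0) (_root_.norm_nonneg _) le_rfl hc
      (ColLE.zero _ fun i => by simp)).trans ?_
    simp
  · have hz' : 0 < ‖z‖ := lt_of_le_of_ne (_root_.norm_nonneg _) (Ne.symm hz)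
    refine le_of_forall_gt_imp_ge_of_dense fun r hr => ?_
    have h1 : ω.norm < r / ‖z‖ := (lt_div_iff₀ hz').2 (by rwa [mul_comm])
    have h2 : 0 ≤ r / ‖z‖ := ω.norm_nonneg.trans h1.le
    obtain ⟨ξ, ξ', h, hc, hd⟩ := ω.exists_isRep_lt h1
    refine (norm_le_of_isRep (z • ω) (isRep_smul h z) h2 (by positivity) hc
      (fun s => (hd s).smul z)).trans (le_of_eq ?_)
    rw [Real.sqrt_mul (by positivity), Real.sqrt_sq hz'.le,
      mul_left_comm, Real.mul_self_sqrt h2]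
    field_simp

/-- Concatenation adds squared column norms. For balanced columns both factors are then bounded by
the square root of the same sum, so the product of the square roots is that sum itself. -/
theorem norm_add_le' (ω ω' : Omega α δ A) : ‖ω + ω'‖ ≤ ‖ω‖ + ‖ω'‖ := by
  refine le_of_forall_pos_le_add fun ε hε => ?_
  have h1 : ω.norm < ω.norm + ε / 2 := by linarith
  have h2 : ω'.norm < ω'.norm + ε / 2 := by linarith
  have p1 : 0 ≤ ω.norm + ε / 2 := ω.norm_nonneg.trans h1.le
  have p2 : 0 ≤ ω'.norm + ε / 2 := ω'.norm_nonneg.trans h2.le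
  obtain ⟨ξ, ξ', h, hc, hd⟩ := ω.exists_isRep_lt h1
  obtain ⟨η, η', h', hc', hd'⟩ := ω'.exists_isRep_lt h2
  have hl := hc.elim hc'
  have hr := hd.elim hd'
  have k1 : ColLE (fun i => ((Sum.elim ξ η i : α.space) : 𝔏 →L[ℂ] H))
      ((ω.norm + ε / 2) + (ω'.norm + ε / 2)) := by
    convert hl using 2 with i; cases i <;> rfl
  have k2 : ColLE (fun i => ((Sum.elim ξ' η' i : δ.space) : 𝔎 →L[ℂ] H))
      ((ω.norm + ε / 2) + (ω'.norm + ε / 2)) := by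
    convert hr using 2 with i; cases i <;> rfl
  refine (norm_le_of_isRep (ω + ω') (isRep_add h h') (by positivity) (by positivity) k1 k2).trans ?_
  rw [Real.mul_self_sqrt (by positivity), norm_def, norm_def]
  linarith

theorem core : NormedSpace.Core ℂ (Omega α δ A) where
  norm_nonneg := norm_nonneg
  norm_smul z ω := by
    refine le_antisymm (norm_smul_le' z ω) ?_
    by_cases hz : z = 0
    · subst hz; rw [_root_.norm_zero, zero_mul]; exact norm_nonneg _
    · have h := norm_smul_le' z⁻¹ (z • ω)
      rw [smul_smul, inv_mul_cancel₀ hz, one_smul, norm_inv] at h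
      rwa [inv_mul_eq_div, le_div_iff₀ (norm_pos_iff.2 hz), mul_comm] at h
  norm_triangle := norm_add_le'
  norm_eq_zero_iff ω := by
    constructor
    · intro h
      refine ext fun x => ?_
      have := ω.norm_toMap_le x
      rw [← norm_def, h, zero_mul, norm_le_zero_iff] at this
      rw [this]; rfl
    · rintro rfl
      have := norm_smul_le' 0 (0 : Omega α δ A)
      rw [zero_smul, norm_zero, zero_mul] at this
      exact le_antisymm this (norm_nonneg _)

instance : NormedAddCommGroup (Omega α δ A) := NormedAddCommGroup.ofCore core
instance : NormedSpace ℂ (Omega α δ A) := NormedSpace.ofCore core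

theorem toMap_sum (s : Finset ℕ) (u : ℕ → Omega α δ A) (x : A) :
    (∑ k ∈ s, u k).toMap x = ∑ k ∈ s, (u k).toMap x := by
  induction s using Finset.cons_induction with
  | empty => rfl
  | cons k s hk ih => rw [Finset.sum_cons, Finset.sum_cons, ← ih]; rfl

theorem summable_families {r : ℕ → ℝ} (hrs : Summable r) (hr0 : ∀ k, 0 ≤ r k)
    {X : Type*} [NormedAddCommGroup X] [InnerProductSpace ℂ X] [CompleteSpace X]
    {ξ : ℕ → ℕ → X →L[ℂ] H} (h : ∀ k, ColSummable (ξ k)) (hc : ∀ k, ColLE (ξ k) (r k)) (n : ℕ) :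
    (ColSummable fun p : ℕ × ℕ => ξ (p.1 + n) p.2) ∧
      ColLE (fun p : ℕ × ℕ => ξ (p.1 + n) p.2) (∑' k, r (k + n)) :=
  colSummable_prod (f := fun p : ℕ × ℕ => ξ (p.1 + n) p.2) (c := fun k => r (k + n))
    ((summable_nat_add_iff n).2 hrs) (fun k => hr0 (k + n)) (fun k => h (k + n))
    (fun k => hc (k + n))

/-- Balanced columns for all terms are concatenated into one column indexed by ℕ × ℕ, which is
summable because the squared norms are. The rows from n onwards represent the tail `w n`, so ‖w n‖
is at most a tail of ∑ r k, and the partial sums converge to `w 0`. -/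
theorem exists_tendsto_of_summable (u : ℕ → Omega α δ A) (hu : Summable (‖u ·‖)) :
    ∃ w, Filter.Tendsto (fun n => ∑ k ∈ Finset.range n, u k) Filter.atTop (nhds w) := by
  -- The infimum defining the norm need not be attained; a summable amount of room is left for the
  -- choice of representations.
  obtain ⟨r, hrs, hr0, hlt⟩ : ∃ r : ℕ → ℝ, Summable r ∧ (∀ k, 0 ≤ r k) ∧ ∀ k, (u k).norm < r k :=
    ⟨fun k => ‖u k‖ + (1 / 2) ^ k, hu.add summable_geometric_two,
      fun k => add_nonneg (_root_.norm_nonneg _) (by positivity),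
      fun k => lt_add_of_pos_right _ (by positivity)⟩
  choose ξ ξ' hrep hc hd using fun k => (u k).exists_isRep_lt (hlt k)
  have hf := summable_families hrs hr0 (fun k => (hrep k).left) hc
  have hg := summable_families hrs hr0 (fun k => (hrep k).right) hd
  obtain ⟨w, hwr⟩ : ∃ w : ℕ → Omega α δ A, ∀ n, IsRep (fun p : ℕ × ℕ => ξ (p.1 + n) p.2)
      (fun p : ℕ × ℕ => ξ' (p.1 + n) p.2) (w n).toMap :=
    ⟨fun n => ofFamily _ _ (hf n).1 (hg n).1, fun n => isRep_ofFamily _ _ (hf n).1 (hg n).1⟩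
  have hw : ∀ n x, HasSum (fun k => (u (k + n)).toMap x) ((w n).toMap x) := fun n x => by
    rw [← (hwr n).sand_eq x]
    exact hasSum_of_eq (hasSum_sand_prod (hf n).1 (hg n).1 x.1) fun k => (hrep (k + n)).sand_eq x
  have hdiff : ∀ n, ∑ k ∈ Finset.range n, u k - w 0 = -w n := fun n => by
    rw [sub_eq_iff_eq_add, ← sub_eq_neg_add, eq_comm, sub_eq_iff_eq_add]
    refine ext fun x => ?_
    have h1 : (∑ k ∈ Finset.range n, u k + w n).toMap x =
      (∑ k ∈ Finset.range n, u k).toMap x + (w n).toMap x := rfl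
    rw [h1, toMap_sum, ← (hw n x).tsum_eq, ← (hw 0 x).tsum_eq]
    exact ((hw 0 x).summable.sum_add_tsum_nat_add n).symm
  refine ⟨w 0, ?_⟩
  rw [tendsto_iff_norm_sub_tendsto_zero]
  refine squeeze_zero (fun _ => _root_.norm_nonneg _) (fun n => ?_) (tendsto_sum_nat_add r)
  have h0 : 0 ≤ ∑' k, r (k + n) := tsum_nonneg fun k => hr0 _
  have h1 := (w n).norm_le_of_isRep (hwr n) h0 h0 (hf n).2 (hg n).2
  rw [Real.mul_self_sqrt h0] at h1
  rw [hdiff, norm_neg]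
  exact h1

instance : CompleteSpace (Omega α δ A) :=
  NormedAddCommGroup.completeSpace_of_summable_imp_tendsto exists_tendsto_of_summable

end

end Omega

end OmegaSpace

/-! ### Contractive approximate units made of intertwiners. -/

section Approximation

variable {𝔎 𝔏 X H K : Type*}
  [NormedAddCommGroup 𝔎] [InnerProductSpace ℂ 𝔎] [CompleteSpace 𝔎]
  [NormedAddCommGroup 𝔏] [InnerProductSpace ℂ 𝔏] [CompleteSpace 𝔏]
  [NormedAddCommGroup X] [InnerProductSpace ℂ X] [CompleteSpace X]
  [NormedAddCommGroup H] [InnerProductSpace ℂ H] [CompleteSpace H]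
  [NormedAddCommGroup K] [InnerProductSpace ℂ K] [CompleteSpace K]

theorem norm_adjoint_apply_le {ι : Type*} {S : ι → H →L[ℂ] K}
    (hS : ColLE (fun i => (S i)†) 1) (j : ι) : ‖S j‖ ≤ 1 := by
  rw [← (ContinuousLinearMap.adjoint (𝕜 := ℂ) (E := H) (F := K)).norm_map (S j)]
  refine ContinuousLinearMap.opNorm_le_bound _ zero_le_one fun u => ?_
  have h1 := hS {j} u
  rw [Finset.sum_singleton, one_mul] at h1
  rw [one_mul]
  exact le_of_sq_le_sq h1 (norm_nonneg _)

/-- Approximate units of the form `∑ S_i S_i*` with `S_i = G T_i`. -/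
theorem exists_approx_unit {ι : Type*} [Fintype ι] (T : ι → H →L[ℂ] K) {ε : ℝ} (hε : 0 < ε) :
    ∃ G : K →L[ℂ] K, G† = G ∧ (∀ Y, Commute (∑ i, T i ∘L ((T i)†)) Y → Commute G Y) ∧
      (∀ D : StarSubalgebra ℂ (K →L[ℂ] K), IsClosed (D : Set (K →L[ℂ] K)) →
        (∑ i, T i ∘L ((T i)†)) ∈ D → G ∈ D) ∧
      ColLE (fun i => (G ∘L T i)†) 1 ∧
      ∀ j, ‖T j - (∑ i, (G ∘L T i) ∘L ((G ∘L T i)†)) ∘L T j‖ ≤ ε := by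
  set Y : K →L[ℂ] K := ∑ i, T i ∘L ((T i)†) with hY
  have hY0 : 0 ≤ Y := Finset.sum_nonneg fun i _ => by
    rw [ContinuousLinearMap.nonneg_iff_isPositive]
    exact ContinuousLinearMap.isPositive_self_comp_adjoint _
  have hYsa : IsSelfAdjoint Y := IsSelfAdjoint.of_nonneg hY0
  -- On the spectrum of the positive operator `Y` this is (t + ε²)^(-1/2); the absolute value makes
  -- `g` continuous on all of ℝ.
  set g : ℝ → ℝ := fun t => (√(|t| + ε ^ 2))⁻¹ with hg
  have hpos : ∀ t : ℝ, 0 < |t| + ε ^ 2 := fun t => by positivity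
  have hgc : Continuous g := by
    refine Continuous.inv₀ (by fun_prop) fun t => (Real.sqrt_pos.2 (hpos t)).ne'
  set G : K →L[ℂ] K := cfc g Y with hG
  have hGsa : G† = G := (IsSelfAdjoint.cfc (f := g) (a := Y)).star_eq
  -- Functional calculus of g(t)² (t + ε²) = 1. Since the first summand is ∑ Sᵢ Sᵢ* for Sᵢ = G Tᵢ,
  -- the defect of the approximate unit is exactly ε² G².
  have hid : G * Y * G + ((ε ^ 2 : ℝ)) • (G * G) = 1 := by
    have e1 : cfc (fun t => g t * t * g t) Y = G * Y * G := by
      rw [cfc_mul (fun t => g t * t) g Y (by fun_prop) (by fun_prop),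
        cfc_mul g (fun t => t) Y (by fun_prop) (by fun_prop), cfc_id' ℝ Y]
    have e2 : cfc (fun t => ε ^ 2 * (g t * g t)) Y = (ε ^ 2 : ℝ) • (G * G) := by
      rw [cfc_const_mul _ (fun t => g t * g t) Y (by fun_prop), cfc_mul g g Y (by fun_prop)
        (by fun_prop)]
    rw [← e1, ← e2, ← cfc_add (a := Y) _ _ (by fun_prop) (by fun_prop), ← cfc_const_one ℝ Y]
    refine cfc_congr fun t ht => ?_
    have ht0 : 0 ≤ t := spectrum_nonneg_of_nonneg hY0 ht
    have hs : √(|t| + ε ^ 2) * √(|t| + ε ^ 2) = t + ε ^ 2 := by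
      rw [Real.mul_self_sqrt (hpos t).le, abs_of_nonneg ht0]
    have hne : √(|t| + ε ^ 2) ≠ 0 := (Real.sqrt_pos.2 (hpos t)).ne'
    simp only [hg]
    field_simp
    rw [sq (√(|t| + ε ^ 2)), hs]
  have hadj : ∀ i, (G ∘L T i)† = ((T i)†) ∘L G := fun i => by
    rw [ContinuousLinearMap.adjoint_comp, hGsa]
  have he : ∑ i, (G ∘L T i) ∘L ((G ∘L T i)†) = G * Y * G := by
    rw [hY, Finset.mul_sum, Finset.sum_mul]
    exact Finset.sum_congr rfl fun i _ => by rw [hadj]; rfl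
  -- The quadratic form of `hid`: it gives both that the column of the Sᵢ* is contractive and that
  -- ‖ε G u‖ ≤ ‖u‖.
  have hquad : ∀ u : K, ∑ i, ‖((G ∘L T i)†) u‖ ^ 2 + ε ^ 2 * ‖G u‖ ^ 2 = ‖u‖ ^ 2 := fun u => by
    have h1 : ∑ i, ‖((G ∘L T i)†) u‖ ^ 2 = RCLike.re ⟪u, (G * Y * G) u⟫_ℂ := by
      rw [sum_norm_sq_eq, ← he]
      simp only [ContinuousLinearMap.adjoint_adjoint]
    have h2 : ‖G u‖ ^ 2 = RCLike.re ⟪u, (G * G) u⟫_ℂ := by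
      rw [← inner_self_eq_norm_sq (𝕜 := ℂ)]
      nth_rw 1 [← hGsa]
      rw [ContinuousLinearMap.adjoint_inner_left]; rfl
    have h3 := congrArg (fun Z : K →L[ℂ] K => RCLike.re ⟪u, Z u⟫_ℂ) hid
    simp only [add_apply, inner_add_right, map_add] at h3
    rw [h1, h2]
    have h4 : RCLike.re ⟪u, ((ε ^ 2 : ℝ) • (G * G)) u⟫_ℂ = ε ^ 2 * RCLike.re ⟪u, (G * G) u⟫_ℂ := by
      have : ((ε ^ 2 : ℝ) • (G * G)) u = ((ε ^ 2 : ℝ) : ℂ) • (G * G) u := rfl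
      rw [this, inner_smul_right]
      exact RCLike.re_ofReal_mul _ _
    rw [← h4, h3]
    exact inner_self_eq_norm_sq (𝕜 := ℂ) u
  have hcol : ColLE (fun i => (G ∘L T i)†) 1 := fun s u => by
    rw [one_mul, ← hquad u]
    refine le_add_of_le_of_nonneg ?_ (by positivity)
    exact Finset.sum_le_sum_of_subset_of_nonneg (Finset.subset_univ s) fun _ _ _ => by positivity
  refine ⟨G, hGsa, fun Z hZ => hZ.cfc_real g, fun D hD hYD => ?_, hcol, fun j => ?_⟩
  · have : IsClosed (D : Set (K →L[ℂ] K)) := hD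
    exact cfc_mem (𝕜' := ℂ) g hYD
  -- The defect applied to T j splits as (ε² G)(G T j): the first factor has norm at most ε, the
  -- second is a member of a contractive row.
  · have h1 : T j - (∑ i, (G ∘L T i) ∘L ((G ∘L T i)†)) ∘L T j =
        ((ε ^ 2 : ℝ) • G) ∘L (G ∘L T j) := by
      rw [he]
      have h2 := congrArg (fun Z : K →L[ℂ] K => Z ∘L T j) hid
      simp only [ContinuousLinearMap.add_comp] at h2
      rw [sub_eq_iff_eq_add, add_comm]
      exact h2.symm
    have h3 : ‖(ε ^ 2 : ℝ) • G‖ ≤ ε := by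
      refine ContinuousLinearMap.opNorm_le_bound _ hε.le fun u => ?_
      have h4 : ε ^ 2 * ‖G u‖ ^ 2 ≤ ‖u‖ ^ 2 := by
        rw [← hquad u]
        exact le_add_of_nonneg_left (Finset.sum_nonneg fun _ _ => by positivity)
      have h5 : ε * ‖G u‖ ≤ ‖u‖ := by
        refine le_of_sq_le_sq ?_ (norm_nonneg _)
        rwa [mul_pow]
      rw [smul_apply, norm_smul, Real.norm_of_nonneg (by positivity)]
      calc ε ^ 2 * ‖G u‖ = ε * (ε * ‖G u‖) := by ring
        _ ≤ ε * ‖u‖ := by gcongr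
    rw [h1]
    refine (ContinuousLinearMap.opNorm_comp_le _ _).trans ?_
    calc ‖(ε ^ 2 : ℝ) • G‖ * ‖G ∘L T j‖ ≤ ε * 1 := by
          gcongr
          exact norm_adjoint_apply_le hcol j
      _ = ε := mul_one _

/-- The operators that leave a closed space invariant, together with their adjoints. -/
def stabilizer (γ : Submodule ℂ (X →L[ℂ] K)) : StarSubalgebra ℂ (K →L[ℂ] K) where
  carrier := {Y | ∀ ξ ∈ γ, Y ∘L ξ ∈ γ ∧ (Y†) ∘L ξ ∈ γ}
  mul_mem' := fun {Y Z} hY hZ ξ hξ => by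
    have hs : (Y * Z)† = (Z†) ∘L (Y†) := ContinuousLinearMap.adjoint_comp Y Z
    rw [hs]
    exact ⟨(hY _ (hZ ξ hξ).1).1, (hZ _ (hY ξ hξ).2).2⟩
  add_mem' := fun {Y Z} hY hZ ξ hξ => by
    rw [map_add, ContinuousLinearMap.add_comp, ContinuousLinearMap.add_comp]
    exact ⟨add_mem (hY ξ hξ).1 (hZ ξ hξ).1, add_mem (hY ξ hξ).2 (hZ ξ hξ).2⟩
  algebraMap_mem' := fun c ξ hξ => by
    rw [Algebra.algebraMap_eq_smul_one, map_smulₛₗ, ContinuousLinearMap.smul_comp,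
      ContinuousLinearMap.smul_comp]
    have : ((1 : K →L[ℂ] K)†) = 1 := star_one _
    rw [this]
    exact ⟨γ.smul_mem _ hξ, γ.smul_mem _ hξ⟩
  star_mem' := fun {Y} hY ξ hξ => by
    rw [ContinuousLinearMap.star_eq_adjoint, ContinuousLinearMap.adjoint_adjoint]
    exact ⟨(hY ξ hξ).2, (hY ξ hξ).1⟩

theorem isClosed_stabilizer {γ : Submodule ℂ (X →L[ℂ] K)} (hγ : IsClosed (γ : Set (X →L[ℂ] K))) :
    IsClosed (stabilizer γ : Set (K →L[ℂ] K)) := by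
  have : (stabilizer γ : Set (K →L[ℂ] K)) = ⋂ ξ ∈ γ, ({Y : K →L[ℂ] K | Y ∘L ξ ∈ γ} ∩
      {Y : K →L[ℂ] K | (Y†) ∘L ξ ∈ γ}) := by
    ext Y
    simp only [Set.mem_iInter]
    exact Iff.rfl
  rw [this]
  refine isClosed_biInter fun ξ _ => IsClosed.inter ?_ ?_
  · exact hγ.preimage ((ContinuousLinearMap.compL ℂ X K K).flip ξ).continuous
  · exact hγ.preimage (((ContinuousLinearMap.compL ℂ X K K).flip ξ).continuous.comp
      (ContinuousLinearMap.adjoint (𝕜 := ℂ) (E := K) (F := K)).continuous)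

variable {a : CStarBase 𝔏} {b : CStarBase 𝔎} {α : CModule a H} {δ : CModule b H}
  {α' : CModule a K} {δ' : CModule b K} {A : NonUnitalStarSubalgebra ℂ (H →L[ℂ] H)}
  {π : A → K →L[ℂ] K}

/-- The intertwiners of `π` that are morphisms for two module structures. -/
def jointIntertwiners (α : CModule a H) (δ : CModule b H) (A : NonUnitalStarSubalgebra ℂ (H →L[ℂ] H))
    (α' : CModule a K) (δ' : CModule b K) (π : A → K →L[ℂ] K) : Set (H →L[ℂ] K) :=
  intertwiners A π ∩ (morphisms α α' ∩ morphisms δ δ')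

/-- The adjoint of the intertwining relation at x*. Consequently S S* commutes with π(x) for every
intertwiner S. -/
theorem adjoint_intertwines (hπ : ∀ x, (π x)† = π (star x)) {S : H →L[ℂ] K}
    (hS : S ∈ intertwiners A π) (x : A) : (S†) ∘L π x = x.1 ∘L (S†) := by
  have h := congrArg (fun Z : H →L[ℂ] K => Z†) (hS (star x))
  simp only [ContinuousLinearMap.adjoint_comp, hπ, star_star] at h
  rw [← h]
  congr 1
  exact ContinuousLinearMap.adjoint_adjoint x.1

/-- Correcting T by G stays among the joint intertwiners because (G T)* = T* G, and G preserves both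
target modules. -/
theorem comp_mem_jointIntertwiners {G : K →L[ℂ] K} (hG : G† = G) (hcomm : ∀ x, Commute G (π x))
    (hα : G ∈ stabilizer α'.space) (hδ : G ∈ stabilizer δ'.space) {T : H →L[ℂ] K}
    (hT : T ∈ jointIntertwiners α δ A α' δ' π) : G ∘L T ∈ jointIntertwiners α δ A α' δ' π := by
  have hadj : (G ∘L T)† = (T†) ∘L G := by rw [ContinuousLinearMap.adjoint_comp, hG]
  refine ⟨fun x => ?_, ⟨fun ξ hξ => (hα _ (hT.2.1.1 ξ hξ)).1, fun ξ hξ => ?_⟩,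
    fun ξ hξ => (hδ _ (hT.2.2.1 ξ hξ)).1, fun ξ hξ => ?_⟩
  · have h : G ∘L π x = π x ∘L G := hcomm x
    rw [ContinuousLinearMap.comp_assoc, hT.1 x, ← ContinuousLinearMap.comp_assoc, h,
      ContinuousLinearMap.comp_assoc]
  · rw [hadj, ContinuousLinearMap.comp_assoc]; exact hT.2.1.2 _ (hα ξ hξ).1
  · rw [hadj, ContinuousLinearMap.comp_assoc]; exact hT.2.2.2 _ (hδ ξ hξ).1

/-- Finite subsets of the joint intertwiners admit contractive approximate units. -/
theorem exists_intertwiner_approx_unit (hπ : ∀ x, (π x)† = π (star x))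
    (𝒯 : Finset (H →L[ℂ] K)) (h𝒯 : ∀ T ∈ 𝒯, T ∈ jointIntertwiners α δ A α' δ' π) {ε : ℝ}
    (hε : 0 < ε) :
    ∃ (n : ℕ) (S : Fin n → H →L[ℂ] K), (∀ i, S i ∈ jointIntertwiners α δ A α' δ' π) ∧
      ColLE (fun i => (S i)†) 1 ∧ ∀ T ∈ 𝒯, ‖T - (∑ i, S i ∘L ((S i)†)) ∘L T‖ ≤ ε := by
  obtain ⟨n, T, hT𝒯, hsurj⟩ : ∃ (n : ℕ) (T : Fin n → H →L[ℂ] K), (∀ i, T i ∈ 𝒯) ∧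
      ∀ S ∈ 𝒯, ∃ i, T i = S :=
    ⟨𝒯.card, fun i => (𝒯.equivFin.symm i).1, fun i => (𝒯.equivFin.symm i).2, fun S hS =>
      ⟨𝒯.equivFin ⟨S, hS⟩, congrArg Subtype.val (𝒯.equivFin.symm_apply_apply ⟨S, hS⟩)⟩⟩
  have hT : ∀ i, T i ∈ jointIntertwiners α δ A α' δ' π := fun i => h𝒯 _ (hT𝒯 i)
  obtain ⟨G, hGsa, hGc, hGD, hcol, happ⟩ := exists_approx_unit T hε
  -- Each Tᵢ Tᵢ* commutes with π(x), and G inherits this as a function of their sum.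
  have hcomm : ∀ x : A, Commute G (π x) := fun x => by
    refine hGc _ (Commute.sum_left _ _ _ fun i _ => ?_)
    change (T i ∘L ((T i)†)) ∘L π x = π x ∘L (T i ∘L ((T i)†))
    rw [ContinuousLinearMap.comp_assoc, adjoint_intertwines hπ (hT i).1, ← ContinuousLinearMap.comp_assoc,
      (hT i).1 x]
    rfl
  -- Tᵢ* carries α' into α and Tᵢ carries it back, so the sum of the Tᵢ Tᵢ* lies in the stabilizer;
  -- this is a closed star subalgebra and hence contains G.
  have hα : G ∈ stabilizer α'.space := hGD _ (isClosed_stabilizer α'.isClosed_space)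
    (sum_mem fun i _ ξ hξ => by
      rw [ContinuousLinearMap.adjoint_comp, ContinuousLinearMap.adjoint_adjoint]
      have := (hT i).2.1.1 _ ((hT i).2.1.2 ξ hξ)
      exact ⟨this, this⟩)
  have hδ : G ∈ stabilizer δ'.space := hGD _ (isClosed_stabilizer δ'.isClosed_space)
    (sum_mem fun i _ ξ hξ => by
      rw [ContinuousLinearMap.adjoint_comp, ContinuousLinearMap.adjoint_adjoint]
      have := (hT i).2.2.1 _ ((hT i).2.2.2 ξ hξ)
      exact ⟨this, this⟩)
  refine ⟨n, fun i => G ∘L T i, fun i => comp_mem_jointIntertwiners hGsa hcomm hα hδ (hT i), hcol,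
    fun S hS => ?_⟩
  obtain ⟨j, rfl⟩ := hsurj S hS
  exact happ j

/-- Elements of `[I γ]` are approximated by `e θ` once `e` approximates finitely many elements
of `I`. -/
theorem exists_finset_approx {I : Set (H →L[ℂ] K)} {γ : Submodule ℂ (X →L[ℂ] H)} {θ : X →L[ℂ] K}
    (hθ : θ ∈ clspan {T : X →L[ℂ] K | ∃ S ∈ I, ∃ ξ ∈ γ, T = S ∘L ξ}) {ε : ℝ} (hε : 0 < ε) :
    ∃ 𝒯 : Finset (H →L[ℂ] K), (∀ T ∈ 𝒯, T ∈ I) ∧ ∃ r > 0, ∀ e : K →L[ℂ] K, ‖e‖ ≤ 1 →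
      (∀ T ∈ 𝒯, ‖T - e ∘L T‖ ≤ r) → ‖θ - e ∘L θ‖ ≤ ε := by
  classical
  -- On the algebraic span no bound on `e` is needed; contractivity only matters in the passage to
  -- the closure.
  have hspan : ∀ φ ∈ Submodule.span ℂ {T : X →L[ℂ] K | ∃ S ∈ I, ∃ ξ ∈ γ, T = S ∘L ξ}, ∀ ε > 0,
      ∃ 𝒯 : Finset (H →L[ℂ] K), (∀ T ∈ 𝒯, T ∈ I) ∧ ∃ r > 0, ∀ e : K →L[ℂ] K,
      (∀ T ∈ 𝒯, ‖T - e ∘L T‖ ≤ r) → ‖φ - e ∘L φ‖ ≤ ε := by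
    intro φ hφ
    induction hφ using Submodule.span_induction with
    | mem x hx =>
      obtain ⟨S, hS, ξ, hξ, rfl⟩ := hx
      intro ε hε
      refine ⟨{S}, by simpa using hS, ε / (‖ξ‖ + 1), by positivity, fun e he => ?_⟩
      have h1 := he S (by simp)
      have h2 : S ∘L ξ - e ∘L (S ∘L ξ) = (S - e ∘L S) ∘L ξ := by
        rw [ContinuousLinearMap.sub_comp]; rfl
      rw [h2]
      refine (ContinuousLinearMap.opNorm_comp_le _ _).trans ?_
      calc ‖S - e ∘L S‖ * ‖ξ‖ ≤ ε / (‖ξ‖ + 1) * (‖ξ‖ + 1) := by gcongr; linarith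
        _ = ε := by field_simp
    | zero => exact fun ε hε => ⟨∅, by simp, 1, one_pos, fun e _ => by simpa using hε.le⟩
    | add x y _ _ hx hy =>
      intro ε hε
      obtain ⟨𝒯, h1, r, hr, h2⟩ := hx (ε / 2) (by positivity)
      obtain ⟨𝒯', h1', r', hr', h2'⟩ := hy (ε / 2) (by positivity)
      refine ⟨𝒯 ∪ 𝒯', fun T hT => (Finset.mem_union.1 hT).elim (h1 T) (h1' T), min r r',
        lt_min hr hr', fun e he => ?_⟩
      have e1 := h2 e fun T hT => (he T (Finset.mem_union_left _ hT)).trans (min_le_left _ _)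
      have e2 := h2' e fun T hT => (he T (Finset.mem_union_right _ hT)).trans (min_le_right _ _)
      have e3 : x + y - e ∘L (x + y) = (x - e ∘L x) + (y - e ∘L y) := by
        rw [ContinuousLinearMap.comp_add]; abel
      rw [e3]
      refine (norm_add_le _ _).trans ?_
      linarith
    | smul c x _ hx =>
      intro ε hε
      obtain ⟨𝒯, h1, r, hr, h2⟩ := hx (ε / (‖c‖ + 1)) (by positivity)
      refine ⟨𝒯, h1, r, hr, fun e he => ?_⟩
      have e3 : c • x - e ∘L (c • x) = c • (x - e ∘L x) := by
        rw [ContinuousLinearMap.comp_smul, smul_sub]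
      rw [e3, norm_smul]
      calc ‖c‖ * ‖x - e ∘L x‖ ≤ (‖c‖ + 1) * (ε / (‖c‖ + 1)) := by
            gcongr
            · linarith
            · exact h2 e he
        _ = ε := by field_simp
  -- The error consists of θ - φ and e (θ - φ), each below ε/4 as ‖e‖ ≤ 1, and of φ - e φ, which is
  -- at most ε/2.
  obtain ⟨φ, hφ, hd⟩ := Metric.mem_closure_iff.1 (show θ ∈ closure _ from hθ) (ε / 4) (by positivity)
  rw [dist_eq_norm] at hd
  obtain ⟨𝒯, h1, r, hr, h2⟩ := hspan φ hφ (ε / 2) (by positivity)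
  refine ⟨𝒯, h1, r, hr, fun e he1 he => ?_⟩
  have e3 : θ - e ∘L θ = (θ - φ) - e ∘L (θ - φ) + (φ - e ∘L φ) := by
    rw [ContinuousLinearMap.comp_sub]; abel
  have e4 : ‖e ∘L (θ - φ)‖ ≤ ‖θ - φ‖ :=
    (ContinuousLinearMap.opNorm_comp_le _ _).trans (mul_le_of_le_one_left (norm_nonneg _) he1)
  rw [e3]
  refine (norm_add_le _ _).trans ?_
  have := norm_sub_le (θ - φ) (e ∘L (θ - φ))
  linarith [h2 e he]

theorem norm_sum_comp_adjoint_le {ι : Type*} [Fintype ι] {S : ι → H →L[ℂ] K}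
    (hS : ColLE (fun i => (S i)†) 1) : ‖∑ i, S i ∘L ((S i)†)‖ ≤ 1 := by
  have := norm_sum_adjoint_comp_self_le zero_le_one (hS Finset.univ)
  simpa only [ContinuousLinearMap.adjoint_adjoint] using this

/-- Column summable families in `[I γ]` are approximated by `e θ` with `e = ∑ S_i S_i*`. -/
theorem exists_approx_family {κ : Type*} {I : Set (H →L[ℂ] K)} {γ : Submodule ℂ (X →L[ℂ] H)}
    (hI : ∀ 𝒯 : Finset (H →L[ℂ] K), (∀ T ∈ 𝒯, T ∈ I) → ∀ ε > 0,
      ∃ (n : ℕ) (S : Fin n → H →L[ℂ] K), (∀ i, S i ∈ I) ∧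
      ColLE (fun i => (S i)†) 1 ∧ ∀ T ∈ 𝒯, ‖T - (∑ i, S i ∘L ((S i)†)) ∘L T‖ ≤ ε)
    {θ : κ → X →L[ℂ] K} (hθ : ∀ k, θ k ∈ clspan {T : X →L[ℂ] K | ∃ S ∈ I, ∃ ξ ∈ γ, T = S ∘L ξ})
    (hs : ColSummable θ) {ε : ℝ} (hε : 0 < ε) :
    ∃ (n : ℕ) (S : Fin n → H →L[ℂ] K), (∀ i, S i ∈ I) ∧ ColLE (fun i => (S i)†) 1 ∧
      ColLE (fun k => θ k - (∑ i, S i ∘L ((S i)†)) ∘L θ k) ε := by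
  classical
  -- Since ‖1 - e‖ ≤ 2, the tail outside `F` contributes at most 4 · ε/8 = ε/2. The entries in `F`
  -- are made so small that their squares add up to at most ε/2.
  obtain ⟨F, hF⟩ := hs (ε / 8) (by positivity)
  set η : ℝ := √(ε / 2 / (F.card + 1)) with hη
  have hη0 : 0 < η := Real.sqrt_pos.2 (by positivity)
  have hfin : ∀ F : Finset κ, ∃ 𝒯 : Finset (H →L[ℂ] K), (∀ T ∈ 𝒯, T ∈ I) ∧ ∃ r > 0,
      ∀ e : K →L[ℂ] K, ‖e‖ ≤ 1 →
      (∀ T ∈ 𝒯, ‖T - e ∘L T‖ ≤ r) → ∀ k ∈ F, ‖θ k - e ∘L θ k‖ ≤ η := by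
    intro F
    induction F using Finset.induction_on with
    | empty => exact ⟨∅, by simp, 1, one_pos, by simp⟩
    | insert k F _ ih =>
      obtain ⟨𝒯, h1, r, hr, h2⟩ := ih
      obtain ⟨𝒯', h1', r', hr', h2'⟩ := exists_finset_approx (hθ k) hη0
      refine ⟨𝒯 ∪ 𝒯', fun T hT => (Finset.mem_union.1 hT).elim (h1 T) (h1' T), min r r',
        lt_min hr hr', fun e he1 he j hj => ?_⟩
      rcases Finset.mem_insert.1 hj with rfl | hj
      · exact h2' e he1 fun T hT => (he T (Finset.mem_union_right _ hT)).trans (min_le_right _ _)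
      · exact h2 e he1 (fun T hT => (he T (Finset.mem_union_left _ hT)).trans (min_le_left _ _)) j hj
  obtain ⟨𝒯, h1, r, hr, h2⟩ := hfin F
  obtain ⟨n, S, hSI, hS1, hST⟩ := hI 𝒯 h1 r hr
  have he1 := norm_sum_comp_adjoint_le hS1
  have h3 := h2 _ he1 hST
  refine ⟨n, S, hSI, hS1, fun t u => ?_⟩
  set e := ∑ i, S i ∘L ((S i)†) with he
  rw [← Finset.sum_inter_add_sum_sdiff t F]
  have p1 : ∑ k ∈ t ∩ F, ‖(θ k - e ∘L θ k) u‖ ^ 2 ≤ ε / 2 * ‖u‖ ^ 2 := by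
    have : ∀ k ∈ t ∩ F, ‖(θ k - e ∘L θ k) u‖ ^ 2 ≤ (ε / 2 / (F.card + 1)) * ‖u‖ ^ 2 := by
      intro k hk
      have h4 : ‖(θ k - e ∘L θ k) u‖ ≤ η * ‖u‖ :=
        (ContinuousLinearMap.le_opNorm _ _).trans (by
          gcongr; exact h3 k (Finset.mem_of_mem_inter_right hk))
      calc _ ≤ (η * ‖u‖) ^ 2 := by gcongr
        _ = _ := by rw [mul_pow, hη, Real.sq_sqrt (by positivity)]
    refine (Finset.sum_le_sum this).trans ?_
    rw [Finset.sum_const, nsmul_eq_mul, ← mul_assoc]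
    gcongr
    have hcard : ((t ∩ F).card : ℝ) ≤ F.card := by
      exact_mod_cast Finset.card_le_card Finset.inter_subset_right
    rw [mul_div_assoc', div_le_iff₀ (by positivity)]
    nlinarith
  have p2 : ∑ k ∈ t \ F, ‖(θ k - e ∘L θ k) u‖ ^ 2 ≤ ε / 2 * ‖u‖ ^ 2 := by
    have h5 := (hF (t \ F) Finset.sdiff_disjoint).comp_left (1 - e)
    have h6 : ‖(1 : K →L[ℂ] K) - e‖ ≤ 2 :=
      (norm_sub_le _ _).trans (by
        have h : ‖(1 : K →L[ℂ] K)‖ ≤ 1 := ContinuousLinearMap.norm_id_le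
        linarith)
    have h7 : ‖(1 : K →L[ℂ] K) - e‖ ^ 2 * (ε / 8) ≤ ε / 2 := by
      have : ‖(1 : K →L[ℂ] K) - e‖ ^ 2 ≤ 2 ^ 2 := by gcongr
      nlinarith
    exact (h5.mono h7) u
  linarith

end Approximation

/-! ### Compressing columns by a family of operators. -/

section Compression

variable {ι κ E E' F G : Type*}
  [NormedAddCommGroup E] [InnerProductSpace ℂ E] [CompleteSpace E]
  [NormedAddCommGroup E'] [InnerProductSpace ℂ E'] [CompleteSpace E']
  [NormedAddCommGroup F] [InnerProductSpace ℂ F] [CompleteSpace F]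
  [NormedAddCommGroup G] [InnerProductSpace ℂ G] [CompleteSpace G]

/-- For fixed i, summing over k costs the factor C by the column bound for S at the vector f i u. In
the application S is the contractive column of the Sᵢ*, so compression does not lengthen columns. -/
theorem finColLE_prod_comp {S : κ → F →L[ℂ] G} {f : ι → E →L[ℂ] F} {C c : ℝ} (hC : 0 ≤ C)
    (hS : ColLE S C) {t : Finset (ι × κ)} {s : Finset ι} (hts : ∀ p ∈ t, p.1 ∈ s)
    (hf : FinColLE f s c) : FinColLE (fun p : ι × κ => S p.2 ∘L f p.1) t (C * c) := fun u => by
  classical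
  have hsub : t ⊆ s ×ˢ t.image Prod.snd := fun p hp =>
    Finset.mem_product.2 ⟨hts p hp, Finset.mem_image_of_mem _ hp⟩
  refine (Finset.sum_le_sum_of_subset_of_nonneg hsub fun _ _ _ => by positivity).trans ?_
  rw [Finset.sum_product]
  calc ∑ i ∈ s, ∑ k ∈ t.image Prod.snd, ‖(S k ∘L f i) u‖ ^ 2 ≤ ∑ i ∈ s, C * ‖f i u‖ ^ 2 :=
        Finset.sum_le_sum fun i _ => hS _ _
    _ = C * ∑ i ∈ s, ‖f i u‖ ^ 2 := by rw [Finset.mul_sum]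
    _ ≤ C * (c * ‖u‖ ^ 2) := by gcongr; exact hf u
    _ = _ := by ring

theorem ColLE.prod_comp {S : κ → F →L[ℂ] G} {f : ι → E →L[ℂ] F} {C c : ℝ} (hC : 0 ≤ C)
    (hS : ColLE S C) (hf : ColLE f c) : ColLE (fun p : ι × κ => S p.2 ∘L f p.1) (C * c) := fun t => by
  classical
  exact finColLE_prod_comp hC hS (s := t.image Prod.fst)
    (fun p hp => Finset.mem_image_of_mem _ hp) (hf _)

theorem ColSummable.prod_comp [Finite κ] (S : κ → F →L[ℂ] G) {f : ι → E →L[ℂ] F}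
    (hf : ColSummable f) : ColSummable fun p : ι × κ => S p.2 ∘L f p.1 := fun ε hε => by
  classical
  have := Fintype.ofFinite κ
  obtain ⟨C, hC, hS⟩ := (ColSummable.of_finite S).exists_colLE
  obtain ⟨s, hs⟩ := hf (ε / (C + 1)) (by positivity)
  refine ⟨s ×ˢ Finset.univ, fun t ht => ?_⟩
  have h1 : Disjoint (t.image Prod.fst) s := by
    rw [Finset.disjoint_left] at ht ⊢
    intro i hi his
    obtain ⟨p, hp, rfl⟩ := Finset.mem_image.1 hi
    exact ht hp (Finset.mem_product.2 ⟨his, Finset.mem_univ _⟩)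
  refine (finColLE_prod_comp hC hS (fun p hp => Finset.mem_image_of_mem _ hp) (hs _ h1)).mono ?_
  rw [mul_div_assoc', div_le_iff₀ (by positivity)]
  nlinarith

/-- If `X S_l = S_l T`, then the sandwich of `T` between the families `S_l* θ_i` and `S_l* θ'_i` is
the sandwich of `X` between `θ_i` and `∑ S_l S_l* θ'_i`. -/
theorem sand_compress [Fintype κ] {S : κ → F →L[ℂ] G} {θ : ι → E →L[ℂ] G} {θ' : ι → E' →L[ℂ] G}
    (hθ : ColSummable θ) (hθ' : ColSummable θ') {T : F →L[ℂ] F} {X : G →L[ℂ] G}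
    (hX : ∀ l, X ∘L S l = S l ∘L T) :
    sand (fun p : ι × κ => ((S p.2)†) ∘L θ p.1) (fun p : ι × κ => ((S p.2)†) ∘L θ' p.1) T =
      sand θ (fun i => (∑ l, S l ∘L ((S l)†)) ∘L θ' i) X := by
  have h1 := hasSum_sand_prod (hθ.prod_comp fun l => (S l)†) (hθ'.prod_comp fun l => (S l)†) T
  refine h1.unique (hasSum_of_eq (hasSum_sand hθ (hθ'.comp_left _) X) fun i => ?_)
  rw [sand, tsum_fintype]
  ext u
  simp only [ContinuousLinearMap.adjoint_comp, ContinuousLinearMap.adjoint_adjoint,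
    ContinuousLinearMap.comp_apply, sum_apply, map_sum]
  refine Finset.sum_congr rfl fun l _ => ?_
  have := DFunLike.congr_fun (hX l) (((S l)†) (θ' i u))
  simp only [ContinuousLinearMap.comp_apply] at this
  rw [this]

end Compression

/-! ### Pulling vector functionals back along a normal homomorphism. -/

section Pullback

variable {𝔎 𝔏 H K : Type*}
  [NormedAddCommGroup 𝔎] [InnerProductSpace ℂ 𝔎] [CompleteSpace 𝔎]
  [NormedAddCommGroup 𝔏] [InnerProductSpace ℂ 𝔏] [CompleteSpace 𝔏]
  [NormedAddCommGroup H] [InnerProductSpace ℂ H] [CompleteSpace H]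
  [NormedAddCommGroup K] [InnerProductSpace ℂ K] [CompleteSpace K]

/-- A set of operators with contractive approximate units `∑ S_i S_i*`. -/
def HasApproxUnits (I : Set (H →L[ℂ] K)) : Prop :=
  ∀ 𝒯 : Finset (H →L[ℂ] K), (∀ T ∈ 𝒯, T ∈ I) → ∀ ε > 0,
    ∃ (n : ℕ) (S : Fin n → H →L[ℂ] K), (∀ i, S i ∈ I) ∧
    ColLE (fun i => (S i)†) 1 ∧ ∀ T ∈ 𝒯, ‖T - (∑ i, S i ∘L ((S i)†)) ∘L T‖ ≤ ε

/-- The operators in `I` are morphisms from `γ` to `γ'` with `[I γ] = γ'`. -/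
structure IsNormalLeg (I : Set (H →L[ℂ] K)) (γ : Submodule ℂ (𝔎 →L[ℂ] H))
    (γ' : Submodule ℂ (𝔎 →L[ℂ] K)) : Prop where
  map_mem : ∀ S ∈ I, ∀ ξ ∈ γ, S ∘L ξ ∈ γ'
  adjoint_mem : ∀ S ∈ I, ∀ θ ∈ γ', (S†) ∘L θ ∈ γ
  span : clspan {T : 𝔎 →L[ℂ] K | ∃ S ∈ I, ∃ ξ ∈ γ, T = S ∘L ξ} = γ'

variable {a : CStarBase 𝔏} {b : CStarBase 𝔎} {γ : CModule a H} {δ : CModule b H}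
  {γ' : Submodule ℂ (𝔏 →L[ℂ] K)} {δ' : Submodule ℂ (𝔎 →L[ℂ] K)}
  {A : NonUnitalStarSubalgebra ℂ (H →L[ℂ] H)} {π : A → K →L[ℂ] K} {I : Set (H →L[ℂ] K)}

namespace Omega

theorem norm_eq (ω : Omega γ δ A) : ‖ω‖ = ω.norm := rfl

/-- Evaluation of functionals at `x`. -/
noncomputable def eval (x : A) : Omega γ δ A →L[ℂ] (𝔎 →L[ℂ] 𝔏) :=
  LinearMap.mkContinuous
    { toFun := fun ω => ω.toMap x
      map_add' := fun _ _ => rfl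
      map_smul' := fun _ _ => rfl }
    ‖x.1‖ (fun ω => (ω.norm_toMap_le x).trans_eq (mul_comm _ _))

theorem eval_apply (x : A) (ω : Omega γ δ A) : eval x ω = ω.toMap x := rfl

end Omega

theorem IsNormalLeg.exists_approx (hI : HasApproxUnits I) (hδ : IsNormalLeg I δ.space δ')
    {ι : Type*} (θ' : ι → δ') (hs : ColSummable fun i => (θ' i).1) {ε : ℝ} (hε : 0 < ε) :
    ∃ (n : ℕ) (S : Fin n → H →L[ℂ] K), (∀ i, S i ∈ I) ∧ ColLE (fun i => (S i)†) 1 ∧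
      ColLE (fun k => (θ' k).1 - (∑ i, S i ∘L ((S i)†)) ∘L (θ' k).1) ε :=
  exists_approx_family (γ := δ.space) hI (fun k => by rw [hδ.span]; exact (θ' k).2) hs hε

theorem IsNormalLeg.approx_mem {δ : Submodule ℂ (𝔎 →L[ℂ] H)} (hδ : IsNormalLeg I δ δ') {n : ℕ} {S : Fin n → H →L[ℂ] K}
    (hS : ∀ i, S i ∈ I) {θ : 𝔎 →L[ℂ] K} (hθ : θ ∈ δ') :
    (∑ i, S i ∘L ((S i)†)) ∘L θ ∈ δ' := by
  have h : (∑ i, S i ∘L ((S i)†)) ∘L θ = ∑ i, S i ∘L ((S i)†) ∘L θ := by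
    ext u; simp
  rw [h]
  refine sum_mem fun i _ => ?_
  exact hδ.map_mem _ (hS i) _ (hδ.adjoint_mem _ (hS i) _ hθ)

/-- The family `S_l* θ_i`. -/
noncomputable def compressFamily (hγ : IsNormalLeg I γ.space γ') {ι : Type*} {n : ℕ} {S : Fin n → H →L[ℂ] K}
    (hS : ∀ i, S i ∈ I) (θ : ι → γ') (p : ι × Fin n) : γ.space :=
  ⟨((S p.2)†) ∘L (θ p.1).1, hγ.adjoint_mem _ (hS p.2) _ (θ p.1).2⟩

theorem colLE_compress (hγ : IsNormalLeg I γ.space γ') {ι : Type*} {n : ℕ} {S : Fin n → H →L[ℂ] K}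
    (hS : ∀ i, S i ∈ I) (hS1 : ColLE (fun i => (S i)†) 1) {θ : ι → γ'} {c : ℝ}
    (hθ : ColLE (fun i => (θ i).1) c) : ColLE (fun p => (compressFamily hγ hS θ p).1) c := by
  have h := ColLE.prod_comp zero_le_one hS1 hθ
  rw [one_mul] at h
  exact h

theorem colSummable_compress (hγ : IsNormalLeg I γ.space γ') {ι : Type*} {n : ℕ}
    {S : Fin n → H →L[ℂ] K} (hS : ∀ i, S i ∈ I) {θ : ι → γ'} (hθ : ColSummable fun i => (θ i).1) :
    ColSummable fun p => (compressFamily hγ hS θ p).1 := by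
  have h := ColSummable.prod_comp (fun l => (S l)†) hθ
  exact h

/-- Intertwining moves Sᵢ past π(x), so the sandwich of π(x) between θ and e θ' is one of x between
the compressed columns and lies in Ω. Its norm bound involves θ' instead of e θ', and no constant is
lost. -/
theorem exists_omega_compress (hint : I ⊆ intertwiners A π) (hγ : IsNormalLeg I γ.space γ')
    (hδ : IsNormalLeg I δ.space δ') {ι : Type*} [Countable ι] {n : ℕ} {S : Fin n → H →L[ℂ] K}
    (hS : ∀ i, S i ∈ I) (hS1 : ColLE (fun i => (S i)†) 1) {θ : ι → γ'} {θ' : ι → δ'}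
    (hθ : ColSummable fun i => (θ i).1) (hθ' : ColSummable fun i => (θ' i).1) :
    ∃ ω : Omega γ δ A, IsRep (compressFamily hγ hS θ) (compressFamily hδ hS θ') ω.toMap ∧
      (∀ x, ω.toMap x = sand (fun i => (θ i).1)
        (fun i => (∑ l, S l ∘L ((S l)†)) ∘L (θ' i).1) (π x)) ∧
      ∀ c d, 0 ≤ c → 0 ≤ d → ColLE (fun i => (θ i).1) c → ColLE (fun i => (θ' i).1) d →
        ‖ω‖ ≤ √c * √d := by
  obtain ⟨ω, hrep⟩ : ∃ ω : Omega γ δ A,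
      IsRep (compressFamily hγ hS θ) (compressFamily hδ hS θ') ω.toMap :=
    ⟨_, Omega.isRep_ofFamily _ _ (colSummable_compress hγ hS hθ)
      (colSummable_compress hδ hS hθ')⟩
  refine ⟨ω, hrep, fun x => ?_, fun c d hc hd h h' => ?_⟩
  · rw [← hrep.sand_eq]
    exact sand_compress hθ hθ' fun l => (hint (hS l) x).symm
  · rw [Omega.norm_eq]
    exact ω.norm_le_of_isRep hrep hc hd (colLE_compress hγ hS hS1 h) (colLE_compress hδ hS hS1 h')

/-- One step of the iteration: θ' = e θ' + ψ, where e θ' contributes an element of Ω and the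
remainder ψ = (1 - e) θ' is as small as desired. -/
theorem exists_omega_step (hI : HasApproxUnits I) (hint : I ⊆ intertwiners A π)
    (hγ : IsNormalLeg I γ.space γ') (hδ : IsNormalLeg I δ.space δ') {ι : Type*} [Countable ι]
    {θ : ι → γ'} (hθ : ColSummable fun i => (θ i).1) {c : ℝ} (hc : 0 ≤ c)
    (hθc : ColLE (fun i => (θ i).1) c)
    (θ' : {θ' : ι → δ' // ColSummable fun i => (θ' i).1}) {ε : ℝ} (hε : 0 < ε) :
    ∃ ψ : {θ' : ι → δ' // ColSummable fun i => (θ' i).1}, ColLE (fun i => (ψ.1 i).1) ε ∧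
      ∃ ω : Omega γ δ A, (∀ x, ω.toMap x = sand (fun i => (θ i).1) (fun i => (θ'.1 i).1) (π x) -
        sand (fun i => (θ i).1) (fun i => (ψ.1 i).1) (π x)) ∧
        ∀ d, 0 ≤ d → ColLE (fun i => (θ'.1 i).1) d → ‖ω‖ ≤ √c * √d := by
  obtain ⟨n, S, hS, hS1, happ⟩ := hδ.exists_approx hI θ'.1 θ'.2 hε
  have hs : ColSummable fun k => (∑ i, S i ∘L ((S i)†)) ∘L (θ'.1 k).1 := θ'.2.comp_left _
  obtain ⟨ω, -, hω, hn⟩ := exists_omega_compress hint hγ hδ hS hS1 hθ θ'.2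
  have hmem : ∀ k, (θ'.1 k).1 - (∑ i, S i ∘L ((S i)†)) ∘L (θ'.1 k).1 ∈ δ' := fun k =>
    sub_mem (θ'.1 k).2 (hδ.approx_mem hS (θ'.1 k).2)
  refine ⟨⟨fun k => ⟨_, hmem k⟩, θ'.2.sub hs⟩, happ, ω, fun x => ?_, fun d hd hd' =>
    hn c d hc hd hθc hd'⟩
  have h := sand_sub_right hθ θ'.2 hs (π x)
  rw [hω, h, sub_sub_cancel]

/-- Pulling back along `π` the functional `ω_{θ,θ'}` with `θ ∈ γ'^∞` and `θ' ∈ δ'^∞`. -/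
theorem exists_pullback_approx (hI : HasApproxUnits I) (hint : I ⊆ intertwiners A π)
    (hγ : IsNormalLeg I γ.space γ') (hδ : IsNormalLeg I δ.space δ') {ι : Type*} [Countable ι]
    {θ : ι → γ'} {θ' : ι → δ'} (hθ : ColSummable fun i => (θ i).1)
    (hθ' : ColSummable fun i => (θ' i).1) {c d : ℝ} (hc : 0 ≤ c) (hd : 0 ≤ d)
    (hθc : ColLE (fun i => (θ i).1) c) (hθd : ColLE (fun i => (θ' i).1) d) {ε : ℝ} (hε : 0 < ε) :
    ∃ ω : Omega γ δ A, (∀ x, ω.toMap x = sand (fun i => (θ i).1) (fun i => (θ' i).1) (π x)) ∧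
      ‖ω‖ ≤ √c * (√d + ε) := by
  -- The tolerance bounds a squared column norm, so the remainder after step k has norm at most
  -- ε/2^(k+1); these numbers add up to ε.
  have hη : ∀ k : ℕ, 0 < (ε / 2 / 2 ^ k) ^ 2 := fun k => by positivity
  choose next hnext ω hω hωn using fun (ψ : {θ' : ι → δ' // ColSummable fun i => (θ' i).1}) (k : ℕ) =>
    exists_omega_step hI hint hγ hδ hθ hc hθc ψ (hη k)
  let ψ : ℕ → {θ' : ι → δ' // ColSummable fun i => (θ' i).1} := fun k =>
    Nat.rec ⟨θ', hθ'⟩ (fun k ψ => next ψ k) k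
  have hψ0 : ψ 0 = ⟨θ', hθ'⟩ := rfl
  have hψ : ∀ k, ψ (k + 1) = next (ψ k) k := fun k => rfl
  let w : ℕ → Omega γ δ A := fun k => ω (ψ k) k
  have hw0 : ‖w 0‖ ≤ √c * √d := hωn _ _ d hd hθd
  have hw : ∀ k, ‖w (k + 1)‖ ≤ √c * (ε / 2 / 2 ^ k) := fun k => by
    have h1 : ColLE (fun i => ((ψ (k + 1)).1 i).1) ((ε / 2 / 2 ^ k) ^ 2) := by
      rw [hψ]; exact hnext _ _
    have h2 := hωn (ψ (k + 1)) (k + 1) _ (hη k).le h1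
    rwa [Real.sqrt_sq (by positivity)] at h2
  have hgeo : HasSum (fun k : ℕ => √c * (ε / 2 / 2 ^ k)) (√c * ε) := (hasSum_geometric_two' ε).mul_left _
  -- Term 0 compresses the original column and costs √c √d. Term k + 1 compresses the remainder left
  -- by step k, hence the shift by one; all these together cost √c ε.
  have hbound : HasSum (fun k : ℕ => Nat.rec (√c * √d) (fun k _ => √c * (ε / 2 / 2 ^ k)) k : ℕ → ℝ)
      (√c * (√d + ε)) := by
    rw [mul_add, ← hasSum_nat_add_iff' 1]
    simpa using hgeo
  have hle : ∀ k, ‖w k‖ ≤ (Nat.rec (√c * √d) (fun k _ => √c * (ε / 2 / 2 ^ k)) k : ℝ) := fun k => by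
    cases k with
    | zero => exact hw0
    | succ k => exact hw k
  have hsum : Summable w := Summable.of_norm_bounded hbound.summable hle
  refine ⟨∑' k, w k, fun x => ?_, tsum_of_norm_bounded hbound hle⟩
  set f : ℕ → 𝔎 →L[ℂ] 𝔏 := fun k => sand (fun i => (θ i).1) (fun i => ((ψ k).1 i).1) (π x) with hf
  have h1 := (hsum.hasSum.mapL (Omega.eval x)).tendsto_sum_nat
  -- Each term is the difference of two successive sandwiches, so the series telescopes; the last
  -- remainder tends to 0.
  have h2 : ∀ n, ∑ k ∈ Finset.range n, Omega.eval x (w k) = f 0 - f n := fun n => by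
    rw [← Finset.sum_range_sub' f n]
    refine Finset.sum_congr rfl fun k _ => ?_
    rw [Omega.eval_apply]
    exact hω (ψ k) k x
  simp only [h2] at h1
  have h3 : Filter.Tendsto f Filter.atTop (nhds 0) := by
    rw [← Filter.tendsto_add_atTop_iff_nat 1]
    have h4 : Filter.Tendsto (fun k : ℕ => √c * (ε / 2 / 2 ^ k) * ‖π x‖) Filter.atTop (nhds 0) := by
      simpa using hgeo.summable.tendsto_atTop_zero.mul_const ‖π x‖
    refine squeeze_zero_norm (fun k => ?_) h4
    have h5 : ColLE (fun i => ((ψ (k + 1)).1 i).1) ((ε / 2 / 2 ^ k) ^ 2) := by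
      rw [hψ]; exact hnext _ _
    have h6 := norm_sand_le hθ (ψ (k + 1)).2 hc (hη k).le hθc h5 (π x)
    rwa [Real.sqrt_sq (by positivity)] at h6
  have h4 := tendsto_nhds_unique h1 (h3.const_sub (f 0))
  rw [sub_zero] at h4
  exact h4

/-- The functional is determined by its values, so the functionals produced for different bounds and
different ε all coincide, and ε may tend to 0 in the norm estimate. -/
theorem exists_pullback (hI : HasApproxUnits I) (hint : I ⊆ intertwiners A π)
    (hγ : IsNormalLeg I γ.space γ') (hδ : IsNormalLeg I δ.space δ') {ι : Type*} [Countable ι]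
    {θ : ι → γ'} {θ' : ι → δ'} (hθ : ColSummable fun i => (θ i).1)
    (hθ' : ColSummable fun i => (θ' i).1) :
    ∃ ω : Omega γ δ A, (∀ x, ω.toMap x = sand (fun i => (θ i).1) (fun i => (θ' i).1) (π x)) ∧
      ∀ c d, 0 ≤ c → 0 ≤ d → ColLE (fun i => (θ i).1) c → ColLE (fun i => (θ' i).1) d →
      ‖ω‖ ≤ √c * √d := by
  obtain ⟨c₀, hc₀, hθc₀⟩ := hθ.exists_colLE
  obtain ⟨d₀, hd₀, hθd₀⟩ := hθ'.exists_colLE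
  obtain ⟨ω, hω, -⟩ := exists_pullback_approx hI hint hγ hδ hθ hθ' hc₀ hd₀ hθc₀ hθd₀ one_pos
  refine ⟨ω, hω, fun c d hc hd hθc hθd => ?_⟩
  refine le_of_forall_pos_le_add fun ε hε => ?_
  obtain ⟨ω', hω', hn⟩ := exists_pullback_approx hI hint hγ hδ hθ hθ' hc hd hθc hθd
    (ε := ε / (√c + 1)) (by positivity)
  have : ω = ω' := Omega.ext fun x => by rw [hω, hω']
  subst this
  refine hn.trans ?_
  rw [mul_add]
  gcongr
  rw [mul_div_assoc', div_le_iff₀ (by positivity)]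
  nlinarith [Real.sqrt_nonneg c]

end Pullback

/-! ### Products of columns and the Schur bound. -/

section LegMul

variable {𝔎 V W P : Type*}
  [NormedAddCommGroup 𝔎] [InnerProductSpace ℂ 𝔎] [CompleteSpace 𝔎]
  [NormedAddCommGroup V] [InnerProductSpace ℂ V] [CompleteSpace V]
  [NormedAddCommGroup W] [InnerProductSpace ℂ W] [CompleteSpace W]
  [NormedAddCommGroup P] [InnerProductSpace ℂ P] [CompleteSpace P]

/-- A bilinear product of two spaces of operators that satisfies a Schur bound. -/
structure LegMul (G : Submodule ℂ (𝔎 →L[ℂ] V)) (G' : Submodule ℂ (𝔎 →L[ℂ] W)) (P : Type*)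
    [NormedAddCommGroup P] [InnerProductSpace ℂ P] [CompleteSpace P] where
  mul : G →ₗ[ℂ] G' →ₗ[ℂ] (𝔎 →L[ℂ] P)
  schur : ∀ {ι κ : Type} (ξ : ι → G) (η : κ → G') (s : Finset ι) (t : Finset κ) (c d : ℝ),
    0 ≤ c → 0 ≤ d → FinColLE (fun i => (ξ i).1) s c → FinColLE (fun k => (η k).1) t d →
    FinColLE (fun p : ι × κ => mul (ξ p.1) (η p.2)) (s ×ˢ t) (c * d)

namespace LegMul

variable {G : Submodule ℂ (𝔎 →L[ℂ] V)} {G' : Submodule ℂ (𝔎 →L[ℂ] W)} (m : LegMul G G' P)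
  {ι κ : Type}

/-- The family of products of the members of two families. -/
noncomputable def prod (ξ : ι → G) (η : κ → G') (p : ι × κ) : 𝔎 →L[ℂ] P := m.mul (ξ p.1) (η p.2)

theorem finColLE_prod {ξ : ι → G} {η : κ → G'} {s : Finset ι} {t : Finset κ} {r : Finset (ι × κ)}
    {c d : ℝ} (hc : 0 ≤ c) (hd : 0 ≤ d) (hξ : FinColLE (fun i => (ξ i).1) s c)
    (hη : FinColLE (fun k => (η k).1) t d) (hr : r ⊆ s ×ˢ t) : FinColLE (m.prod ξ η) r (c * d) :=
  (m.schur ξ η s t c d hc hd hξ hη).subset hr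

theorem colLE_prod {ξ : ι → G} {η : κ → G'} {c d : ℝ} (hc : 0 ≤ c) (hd : 0 ≤ d)
    (hξ : ColLE (fun i => (ξ i).1) c) (hη : ColLE (fun k => (η k).1) d) :
    ColLE (m.prod ξ η) (c * d) := fun r => by
  classical
  exact m.finColLE_prod hc hd (hξ _) (hη _) Finset.subset_product

/-- A pair outside s × t has its first index outside s, or its first index in s and its second
outside t. Either way one factor is a small tail and the other is bounded. -/
theorem colSummable_prod {ξ : ι → G} {η : κ → G'} (hξ : ColSummable fun i => (ξ i).1)
    (hη : ColSummable fun k => (η k).1) : ColSummable (m.prod ξ η) := fun ε hε => by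
  classical
  obtain ⟨c, hc, hξc⟩ := hξ.exists_colLE
  obtain ⟨d, hd, hηd⟩ := hη.exists_colLE
  have h1 : 0 < ε / 2 / (d + 1) := by positivity
  have h2 : 0 < ε / 2 / (c + 1) := by positivity
  obtain ⟨s, hs⟩ := hξ _ h1
  obtain ⟨t, ht⟩ := hη _ h2
  refine ⟨s ×ˢ t, fun r hr u => ?_⟩
  rw [Finset.disjoint_left] at hr
  rw [← Finset.sum_filter_add_sum_filter_not r (fun p => p.1 ∈ s)]
  have e1 : ∑ p ∈ r.filter (fun p => ¬ p.1 ∈ s), ‖m.prod ξ η p u‖ ^ 2 ≤ ε / 2 * ‖u‖ ^ 2 := by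
    have hd' : Disjoint ((r.filter fun p => ¬ p.1 ∈ s).image Prod.fst) s := by
      rw [Finset.disjoint_left]
      intro i hi
      obtain ⟨p, hp, rfl⟩ := Finset.mem_image.1 hi
      exact (Finset.mem_filter.1 hp).2
    refine ((m.finColLE_prod h1.le hd (hs _ hd') (hηd _) Finset.subset_product).mono ?_) u
    rw [div_mul_eq_mul_div, div_le_iff₀ (by positivity)]
    nlinarith
  have e2 : ∑ p ∈ r.filter (fun p => p.1 ∈ s), ‖m.prod ξ η p u‖ ^ 2 ≤ ε / 2 * ‖u‖ ^ 2 := by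
    have hd' : Disjoint ((r.filter fun p => p.1 ∈ s).image Prod.snd) t := by
      rw [Finset.disjoint_left]
      intro i hi hit
      obtain ⟨p, hp, rfl⟩ := Finset.mem_image.1 hi
      obtain ⟨h3, h4⟩ := Finset.mem_filter.1 hp
      exact hr h3 (Finset.mem_product.2 ⟨h4, hit⟩)
    refine ((m.finColLE_prod hc h2.le (hξc _) (ht _ hd') Finset.subset_product).mono ?_) u
    rw [mul_div_assoc', div_le_iff₀ (by positivity)]
    nlinarith
  linarith

end LegMul

/-- A family of linear maps on a space of operators that is compatible with columns. -/
structure Amplification (Λ : Type) (G : Submodule ℂ (𝔎 →L[ℂ] V)) (P : Type*)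
    [NormedAddCommGroup P] [InnerProductSpace ℂ P] [CompleteSpace P] where
  map : Λ → G →ₗ[ℂ] (𝔎 →L[ℂ] P)
  bound : ℝ
  bound_nonneg : 0 ≤ bound
  colLE : ∀ {ι : Type} (ξ : ι → G) (c : ℝ), 0 ≤ c → ColLE (fun i => (ξ i).1) c →
    ColLE (fun p : ι × Λ => map p.2 (ξ p.1)) (c * bound)
  colSummable : ∀ {ι : Type} (ξ : ι → G), (ColSummable fun i => (ξ i).1) →
    ColSummable fun p : ι × Λ => map p.2 (ξ p.1)

/-- The amplified family. -/
noncomputable def Amplification.fam {Λ ι : Type} {G : Submodule ℂ (𝔎 →L[ℂ] V)}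
    (ℓ : Amplification Λ G P) (ξ : ι → G) (p : ι × Λ) : 𝔎 →L[ℂ] P := ℓ.map p.2 (ξ p.1)

theorem Amplification.colSummable_fam {Λ ι : Type} {G : Submodule ℂ (𝔎 →L[ℂ] V)}
    (ℓ : Amplification Λ G P) {ξ : ι → G} (hξ : ColSummable fun i => (ξ i).1) :
    ColSummable (ℓ.fam ξ) := ℓ.colSummable ξ hξ

variable {G : Submodule ℂ (𝔎 →L[ℂ] V)} {G' : Submodule ℂ (𝔎 →L[ℂ] W)}

/-- Multiplication by a fixed family from the right. -/
noncomputable def LegMul.ampRight {Λ : Type} (m : LegMul G G' P) (η : Λ → G')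
    (hη : ColSummable fun k => (η k).1) : Amplification Λ G P where
  map k := m.mul.flip (η k)
  bound := hη.exists_colLE.choose
  bound_nonneg := hη.exists_colLE.choose_spec.1
  colLE _ _ hc hξ := m.colLE_prod hc hη.exists_colLE.choose_spec.1 hξ hη.exists_colLE.choose_spec.2
  colSummable _ hξ := m.colSummable_prod hξ hη

/-- Multiplication by a fixed family from the left. -/
noncomputable def LegMul.ampLeft {Λ : Type} (m : LegMul G G' P) (ξ : Λ → G)
    (hξ : ColSummable fun k => (ξ k).1) : Amplification Λ G' P where
  map k := m.mul (ξ k)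
  bound := hξ.exists_colLE.choose
  bound_nonneg := hξ.exists_colLE.choose_spec.1
  -- The amplified family lists the varying index first although the fixed factor stands on the
  -- left, hence the swap.
  colLE η c hc hη := by
    have h := (m.colLE_prod hξ.exists_colLE.choose_spec.1 hc hξ.exists_colLE.choose_spec.2
      hη).comp_injective Prod.swap_injective
    rw [mul_comm]
    exact h
  colSummable η hη := by
    have h := (m.colSummable_prod hξ hη).comp_injective Prod.swap_injective
    exact h

end LegMul

/-! ### Compression of amplified columns. -/

section Amplify

variable {𝔎 H P P' : Type*}
  [NormedAddCommGroup 𝔎] [InnerProductSpace ℂ 𝔎] [CompleteSpace 𝔎]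
  [NormedAddCommGroup H] [InnerProductSpace ℂ H] [CompleteSpace H]
  [NormedAddCommGroup P] [InnerProductSpace ℂ P] [CompleteSpace P]
  [NormedAddCommGroup P'] [InnerProductSpace ℂ P'] [CompleteSpace P']
  {I : Set (H →L[ℂ] P)} {Λ : Type}

/-- Compatibility of amplifications `ℓ` of `γ` and `ℓ'` of `γ'` with an operator `R` lying
over an intertwiner `S`. -/
structure LiesOver {γ : Submodule ℂ (𝔎 →L[ℂ] H)} {γ' : Submodule ℂ (𝔎 →L[ℂ] P)}
    (hγ : IsNormalLeg I γ γ') (ℓ : Amplification Λ γ P) (ℓ' : Amplification Λ γ' P')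
    {S : H →L[ℂ] P} (hS : S ∈ I) (R : P →L[ℂ] P') : Prop where
  map : ∀ k (φ : γ), ℓ'.map k ⟨S ∘L φ.1, hγ.map_mem S hS φ.1 φ.2⟩ = R ∘L ℓ.map k φ
  adjoint : ∀ k (θ : γ'), (R†) ∘L ℓ'.map k θ =
    ℓ.map k ⟨(S†) ∘L θ.1, hγ.adjoint_mem S hS θ.1 θ.2⟩

variable {γ δ : Submodule ℂ (𝔎 →L[ℂ] H)} {γ' δ' : Submodule ℂ (𝔎 →L[ℂ] P)}
  {hγ : IsNormalLeg I γ γ'} {hδ : IsNormalLeg I δ δ'}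
  {ℓ : Amplification Λ γ P} {ℓ' : Amplification Λ γ' P'}
  {k : Amplification Λ δ P} {k' : Amplification Λ δ' P'}

/-- The relation for the adjoint moves Rᵢ* down to Sᵢ*, and the relation for the map brings it back
up as Rᵢ. So the approximate unit e on P corresponds to ∑ Rᵢ Rᵢ* on P'. -/
theorem LiesOver.map_approx {n : ℕ} {S : Fin n → H →L[ℂ] P} (hS : ∀ i, S i ∈ I)
    {R : Fin n → P →L[ℂ] P'} (h : ∀ i, LiesOver hδ k k' (hS i) (R i)) (j : Λ) (θ : δ') :
    k'.map j ⟨(∑ i, S i ∘L ((S i)†)) ∘L θ.1, hδ.approx_mem hS θ.2⟩ =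
      (∑ i, R i ∘L ((R i)†)) ∘L k'.map j θ := by
  have h1 : (⟨(∑ i, S i ∘L ((S i)†)) ∘L θ.1, hδ.approx_mem hS θ.2⟩ : δ') =
      ∑ i, ⟨S i ∘L (((S i)†) ∘L θ.1),
        hδ.map_mem _ (hS i) _ (hδ.adjoint_mem _ (hS i) _ θ.2)⟩ := by
    refine Subtype.ext ?_
    rw [AddSubmonoidClass.coe_finsetSum]
    ext u; simp
  have h2 : (∑ i, R i ∘L ((R i)†)) ∘L k'.map j θ = ∑ i, R i ∘L (((R i)†) ∘L k'.map j θ) := by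
    ext u; simp
  rw [h1, h2, map_sum]
  refine Finset.sum_congr rfl fun i _ => ?_
  rw [(h i).adjoint]
  exact (h i).map j ⟨((S i)†) ∘L θ.1, hδ.adjoint_mem _ (hS i) _ θ.2⟩

/-- Compressing amplified families. -/
theorem sand_fam_compress {ι : Type} {n : ℕ} {S : Fin n → H →L[ℂ] P} (hS : ∀ i, S i ∈ I)
    {R : Fin n → P →L[ℂ] P'} (h : ∀ i, LiesOver hγ ℓ ℓ' (hS i) (R i))
    (h' : ∀ i, LiesOver hδ k k' (hS i) (R i)) {T : P →L[ℂ] P} {X : P' →L[ℂ] P'}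
    (hX : ∀ i, X ∘L R i = R i ∘L T) {θ : ι → γ'} {θ' : ι → δ'}
    (hθ : ColSummable fun i => (θ i).1) (hθ' : ColSummable fun i => (θ' i).1) :
    sand (ℓ.fam fun p : ι × Fin n => ⟨((S p.2)†) ∘L (θ p.1).1,
        hγ.adjoint_mem _ (hS p.2) _ (θ p.1).2⟩)
      (k.fam fun p : ι × Fin n => ⟨((S p.2)†) ∘L (θ' p.1).1,
        hδ.adjoint_mem _ (hS p.2) _ (θ' p.1).2⟩) T =
    sand (ℓ'.fam θ) (k'.fam fun i => ⟨(∑ l, S l ∘L ((S l)†)) ∘L (θ' i).1,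
      hδ.approx_mem hS (θ' i).2⟩) X := by
  -- Compressing and then amplifying orders the indices differently from amplifying and then
  -- compressing.
  let e : (ι × Λ) × Fin n ≃ (ι × Fin n) × Λ :=
    { toFun := fun p => ((p.1.1, p.2), p.1.2)
      invFun := fun p => ((p.1.1, p.2), p.1.2)
      left_inv := fun _ => rfl
      right_inv := fun _ => rfl }
  have e1 : (fun q => (ℓ.fam fun p : ι × Fin n => ⟨((S p.2)†) ∘L (θ p.1).1,
        hγ.adjoint_mem _ (hS p.2) _ (θ p.1).2⟩) (e q)) =
      fun q : (ι × Λ) × Fin n => ((R q.2)†) ∘L ℓ'.fam θ q.1 := by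
    funext q
    exact ((h q.2).adjoint q.1.2 (θ q.1.1)).symm
  have e2 : (fun q => (k.fam fun p : ι × Fin n => ⟨((S p.2)†) ∘L (θ' p.1).1,
        hδ.adjoint_mem _ (hS p.2) _ (θ' p.1).2⟩) (e q)) =
      fun q : (ι × Λ) × Fin n => ((R q.2)†) ∘L k'.fam θ' q.1 := by
    funext q
    exact ((h' q.2).adjoint q.1.2 (θ' q.1.1)).symm
  rw [← sand_comp_equiv e, e1, e2, sand_compress (ℓ'.colSummable_fam hθ)
    (k'.colSummable_fam hθ') hX]
  congr 1
  funext q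
  exact (LiesOver.map_approx hS h' q.2 (θ' q.1)).symm

end Amplify

/-! ### Evaluating amplified functionals on the larger space. -/

section AmplifyFunctional

variable {𝔎 H P P' : Type*}
  [NormedAddCommGroup 𝔎] [InnerProductSpace ℂ 𝔎] [CompleteSpace 𝔎]
  [NormedAddCommGroup H] [InnerProductSpace ℂ H] [CompleteSpace H]
  [NormedAddCommGroup P] [InnerProductSpace ℂ P] [CompleteSpace P]
  [NormedAddCommGroup P'] [InnerProductSpace ℂ P'] [CompleteSpace P']
  {I : Set (H →L[ℂ] P)} {Λ : Type}
  {a b : CStarBase 𝔎} {γ : CModule a H} {δ : CModule b H}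
  {γ' δ' : Submodule ℂ (𝔎 →L[ℂ] P)}
  {A : NonUnitalStarSubalgebra ℂ (H →L[ℂ] H)} {π : A → P →L[ℂ] P}
  {hγ : IsNormalLeg I γ.space γ'} {hδ : IsNormalLeg I δ.space δ'}
  {ℓ : Amplification Λ γ.space P} {ℓ' : Amplification Λ γ' P'}
  {k : Amplification Λ δ.space P} {k' : Amplification Λ δ' P'}

/-- Amplified sandwiches of a pulled back functional can be computed upstairs. -/
theorem amplified_pullback (hI : HasApproxUnits I) (hint : I ⊆ intertwiners A π)
    {T : P →L[ℂ] P} {X : P' →L[ℂ] P'}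
    (hR : ∀ S (hS : S ∈ I), ∃ R : P →L[ℂ] P', X ∘L R = R ∘L T ∧ LiesOver hγ ℓ ℓ' hS R ∧
      LiesOver hδ k k' hS R)
    {F : Omega γ δ A → 𝔎 →L[ℂ] 𝔎} {C : ℝ} (hC : 0 ≤ C) (hF : ∀ ω, ‖F ω‖ ≤ C * ‖ω‖)
    (hFsub : ∀ ω ω', F (ω - ω') = F ω - F ω')
    (hFrep : ∀ {ι : Type} (ω : Omega γ δ A) (ξ : ι → γ.space) (ξ' : ι → δ.space),
      IsRep ξ ξ' ω.toMap → F ω = sand (ℓ.fam ξ) (k.fam ξ') T)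
    {ι : Type} [Countable ι] {θ : ι → γ'} {θ' : ι → δ'} (hθ : ColSummable fun i => (θ i).1)
    (hθ' : ColSummable fun i => (θ' i).1) {τ : Omega γ δ A}
    (hτ : ∀ x, τ.toMap x = sand (fun i => (θ i).1) (fun i => (θ' i).1) (π x)) :
    F τ = sand (ℓ'.fam θ) (k'.fam θ') X := by
  obtain ⟨c, hc, hθc⟩ := hθ.exists_colLE
  -- The first summand bounds `F` on the pullback of a remainder of column norm ε, the second bounds
  -- its amplified sandwich, both divided by ε.
  set M : ℝ := C * √c + √(c * ℓ'.bound) * √k'.bound * ‖X‖ with hM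
  have hM0 : 0 ≤ M := by positivity
  have key : ∀ ε > 0, ‖F τ - sand (ℓ'.fam θ) (k'.fam θ') X‖ ≤ M * ε := fun ε hε => by
    obtain ⟨n, S, hS, hS1, happ⟩ := hδ.exists_approx hI θ' hθ' (ε := ε ^ 2) (by positivity)
    choose R hRX hRγ hRδ using hR
    let φ : ι → δ' := fun i => ⟨(∑ l, S l ∘L ((S l)†)) ∘L (θ' i).1, hδ.approx_mem hS (θ' i).2⟩
    let ψ : ι → δ' := fun i => θ' i - φ i
    have hφ : ColSummable fun i => (φ i).1 := hθ'.comp_left _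
    have hψ : ColSummable fun i => (ψ i).1 := hθ'.sub hφ
    have hψε : ColLE (fun i => (ψ i).1) (ε ^ 2) := happ
    -- τ splits into ω, which comes from e θ' and is represented by compressed columns, and ω',
    -- which comes from the remainder ψ. For ω the two sides agree exactly; for ω' both are of order
    -- ε.
    obtain ⟨ω, hrep, hω, -⟩ := exists_omega_compress hint hγ hδ hS hS1 hθ hθ'
    obtain ⟨ω', hω', hn⟩ := exists_pullback hI hint hγ hδ hθ hψ
    have hsub : τ - ω = ω' := Omega.ext fun x => by
      have h1 := sand_sub_right hθ hθ' hφ (π x)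
      rw [hω']
      refine Eq.trans ?_ h1.symm
      have h2 : (τ - ω).toMap x = τ.toMap x - ω.toMap x := by rw [Omega.toMap_sub]; rfl
      rw [h2, hτ, hω]
    have hFω : F ω = sand (ℓ'.fam θ) (k'.fam φ) X := by
      rw [hFrep ω _ _ hrep]
      exact sand_fam_compress hS (fun i => hRγ _ (hS i)) (fun i => hRδ _ (hS i))
        (fun i => hRX _ (hS i)) hθ hθ'
    have hk : k'.fam ψ = fun p => k'.fam θ' p - k'.fam φ p := by
      funext p
      exact map_sub (k'.map p.2) _ _
    have h3 : sand (ℓ'.fam θ) (k'.fam ψ) X =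
        sand (ℓ'.fam θ) (k'.fam θ') X - sand (ℓ'.fam θ) (k'.fam φ) X := by
      rw [hk]
      exact sand_sub_right (ℓ'.colSummable_fam hθ) (k'.colSummable_fam hθ') (k'.colSummable_fam hφ) X
    have h4 : F τ - sand (ℓ'.fam θ) (k'.fam θ') X = F ω' - sand (ℓ'.fam θ) (k'.fam ψ) X := by
      rw [h3, ← hsub, hFsub, hFω]; abel
    rw [h4]
    refine (norm_sub_le _ _).trans ?_
    have h5 : ‖F ω'‖ ≤ C * (√c * ε) := by
      refine (hF ω').trans ?_
      gcongr
      have := hn c (ε ^ 2) hc (by positivity) hθc hψε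
      rwa [Real.sqrt_sq hε.le] at this
    have h6 : ‖sand (ℓ'.fam θ) (k'.fam ψ) X‖ ≤ √(c * ℓ'.bound) * √(ε ^ 2 * k'.bound) * ‖X‖ :=
      norm_sand_le (ℓ'.colSummable_fam hθ) (k'.colSummable_fam hψ)
        (mul_nonneg hc ℓ'.bound_nonneg) (mul_nonneg (by positivity) k'.bound_nonneg)
        (ℓ'.colLE θ c hc hθc) (k'.colLE ψ _ (by positivity) hψε) X
    rw [Real.sqrt_mul (sq_nonneg ε), Real.sqrt_sq hε.le] at h6
    calc ‖F ω'‖ + ‖sand (ℓ'.fam θ) (k'.fam ψ) X‖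
        ≤ C * (√c * ε) + √(c * ℓ'.bound) * (ε * √k'.bound) * ‖X‖ := add_le_add h5 h6
      _ = M * ε := by rw [hM]; ring
  have h0 : ‖F τ - sand (ℓ'.fam θ) (k'.fam θ') X‖ ≤ 0 := by
    refine le_of_forall_pos_le_add fun ε hε => ?_
    refine (key (ε / (M + 1)) (by positivity)).trans ?_
    rw [zero_add, mul_div_assoc', div_le_iff₀ (by positivity)]
    nlinarith
  exact sub_eq_zero.1 (norm_le_zero_iff.1 h0)

end AmplifyFunctional

/-! ### The convolution product and its algebraic laws, in an abstract setting. -/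

section Convolution

variable {𝔎 H P P₂ P₃ : Type*}
  [NormedAddCommGroup 𝔎] [InnerProductSpace ℂ 𝔎] [CompleteSpace 𝔎]
  [NormedAddCommGroup H] [InnerProductSpace ℂ H] [CompleteSpace H]
  [NormedAddCommGroup P] [InnerProductSpace ℂ P] [CompleteSpace P]
  [NormedAddCommGroup P₂] [InnerProductSpace ℂ P₂] [CompleteSpace P₂]
  [NormedAddCommGroup P₃] [InnerProductSpace ℂ P₃] [CompleteSpace P₃]

/-- A comultiplication `π` on the algebra `A` with its two iterations `X`, `Y`, which are
identified by `U`, and sufficiently many intertwiners. -/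
structure ComulData (A : NonUnitalStarSubalgebra ℂ (H →L[ℂ] H)) (P P₂ P₃ : Type*)
    [NormedAddCommGroup P] [InnerProductSpace ℂ P] [CompleteSpace P]
    [NormedAddCommGroup P₂] [InnerProductSpace ℂ P₂] [CompleteSpace P₂]
    [NormedAddCommGroup P₃] [InnerProductSpace ℂ P₃] [CompleteSpace P₃] where
  π : A → P →L[ℂ] P
  I : Set (H →L[ℂ] P)
  approx : HasApproxUnits I
  intertwine : I ⊆ intertwiners A π
  X : A → P₂ →L[ℂ] P₂
  Y : A → P₃ →L[ℂ] P₃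
  relX : (H →L[ℂ] P) → (P →L[ℂ] P₂) → Prop
  relY : (H →L[ℂ] P) → (P →L[ℂ] P₃) → Prop
  exists_relX : ∀ S ∈ I, ∃ R, relX S R
  exists_relY : ∀ S ∈ I, ∃ R, relY S R
  X_comp : ∀ S ∈ I, ∀ R, relX S R → ∀ x, X x ∘L R = R ∘L π x
  Y_comp : ∀ S ∈ I, ∀ R, relY S R → ∀ x, Y x ∘L R = R ∘L π x
  U : P₂ →L[ℂ] P₃
  inner_U : ∀ u v, ⟪U u, U v⟫_ℂ = ⟪u, v⟫_ℂ
  U_comp : ∀ x, U ∘L X x = Y x ∘L U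

/-- A leg of a comultiplication: a space `γ` of operators with products `γ × γ → γ₂` and
products of three factors that are compatible with intertwiners and associative. -/
structure Leg {A : NonUnitalStarSubalgebra ℂ (H →L[ℂ] H)} (D : ComulData A P P₂ P₃)
    (γ : Submodule ℂ (𝔎 →L[ℂ] H)) where
  γ₂ : Submodule ℂ (𝔎 →L[ℂ] P)
  normal : IsNormalLeg D.I γ γ₂
  m : LegMul γ γ P
  mem : ∀ ξ η, m.mul ξ η ∈ γ₂
  mX : LegMul γ₂ γ P₂
  mY : LegMul γ γ₂ P₃
  mX_map : ∀ S (hS : S ∈ D.I) R, D.relX S R → ∀ (φ κ : γ),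
    mX.mul ⟨S ∘L φ.1, normal.map_mem S hS φ.1 φ.2⟩ κ = R ∘L m.mul φ κ
  mX_adjoint : ∀ S (hS : S ∈ D.I) R, D.relX S R → ∀ (θ : γ₂) (κ : γ),
    (R†) ∘L mX.mul θ κ = m.mul ⟨(S†) ∘L θ.1, normal.adjoint_mem S hS θ.1 θ.2⟩ κ
  mY_map : ∀ S (hS : S ∈ D.I) R, D.relY S R → ∀ (φ κ : γ),
    mY.mul κ ⟨S ∘L φ.1, normal.map_mem S hS φ.1 φ.2⟩ = R ∘L m.mul κ φ
  mY_adjoint : ∀ S (hS : S ∈ D.I) R, D.relY S R → ∀ (θ : γ₂) (κ : γ),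
    (R†) ∘L mY.mul κ θ = m.mul κ ⟨(S†) ∘L θ.1, normal.adjoint_mem S hS θ.1 θ.2⟩
  assoc : ∀ ξ η κ : γ, D.U ∘L mX.mul ⟨m.mul ξ η, mem ξ η⟩ κ = mY.mul ξ ⟨m.mul η κ, mem η κ⟩

variable {A : NonUnitalStarSubalgebra ℂ (H →L[ℂ] H)} {D : ComulData A P P₂ P₃}
  {a b : CStarBase 𝔎} {γ : CModule a H} {δ : CModule b H}

/-- The product family with values in `γ₂`. -/
noncomputable def Leg.fam {γ : Submodule ℂ (𝔎 →L[ℂ] H)} (L : Leg D γ) {ι κ : Type} (ξ : ι → γ)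
    (η : κ → γ) (p : ι × κ) : L.γ₂ := ⟨L.m.prod ξ η p, L.mem _ _⟩

theorem Leg.liesOver_ampRight {γ : Submodule ℂ (𝔎 →L[ℂ] H)} (L : Leg D γ) {Λ : Type} {η : Λ → γ}
    (hη : ColSummable fun i => (η i).1) {S : H →L[ℂ] P} (hS : S ∈ D.I) {R : P →L[ℂ] P₂}
    (hR : D.relX S R) :
    LiesOver L.normal (L.m.ampRight η hη) (L.mX.ampRight η hη) hS R :=
  ⟨fun k φ => L.mX_map S hS R hR φ (η k), fun k θ => L.mX_adjoint S hS R hR θ (η k)⟩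

theorem Leg.liesOver_ampLeft {γ : Submodule ℂ (𝔎 →L[ℂ] H)} (L : Leg D γ) {Λ : Type} {η : Λ → γ}
    (hη : ColSummable fun i => (η i).1) {S : H →L[ℂ] P} (hS : S ∈ D.I) {R : P →L[ℂ] P₃}
    (hR : D.relY S R) :
    LiesOver L.normal (L.m.ampLeft η hη) (L.mY.ampLeft η hη) hS R :=
  ⟨fun k φ => L.mY_map S hS R hR φ (η k), fun k θ => L.mY_adjoint S hS R hR θ (η k)⟩

/-- The products of `γ` and `δ` define functionals that only depend on the functionals
represented by the factors. -/
structure IsIndependent (L : Leg D γ.space) (L' : Leg D δ.space) : Prop where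
  left : ∀ (x : A) (η : γ.space) (η' : δ.space) {ι κ : Type} (ω : A →L[ℂ] (𝔎 →L[ℂ] 𝔎))
    (ξ : ι → γ.space) (ξ' : ι → δ.space) (σ : κ → γ.space) (σ' : κ → δ.space),
    IsRep ξ ξ' ω → IsRep σ σ' ω →
    sand (fun i => L.m.mul (ξ i) η) (fun i => L'.m.mul (ξ' i) η') (D.π x) =
      sand (fun i => L.m.mul (σ i) η) (fun i => L'.m.mul (σ' i) η') (D.π x)
  right : ∀ (x : A) (ξ : γ.space) (ξ' : δ.space) {ι κ : Type} (ω : A →L[ℂ] (𝔎 →L[ℂ] 𝔎))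
    (η : ι → γ.space) (η' : ι → δ.space) (σ : κ → γ.space) (σ' : κ → δ.space),
    IsRep η η' ω → IsRep σ σ' ω →
    sand (fun i => L.m.mul ξ (η i)) (fun i => L'.m.mul ξ' (η' i)) (D.π x) =
      sand (fun i => L.m.mul ξ (σ i)) (fun i => L'.m.mul ξ' (σ' i)) (D.π x)

variable {L : Leg D γ.space} {L' : Leg D δ.space}

theorem hasSum_box_left {ι κ : Type} {ξ : ι → γ.space} {ξ' : ι → δ.space} {η : κ → γ.space}
    {η' : κ → δ.space} {ω ω' : A →L[ℂ] (𝔎 →L[ℂ] 𝔎)} (h : IsRep ξ ξ' ω) (h' : IsRep η η' ω')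
    (T : P →L[ℂ] P) :
    HasSum (fun i => sand (fun k => L.m.mul (ξ i) (η k)) (fun k => L'.m.mul (ξ' i) (η' k)) T)
      (sand (L.m.prod ξ η) (L'.m.prod ξ' η') T) :=
  hasSum_sand_prod (L.m.colSummable_prod h.left h'.left) (L'.m.colSummable_prod h.right h'.right) T

theorem hasSum_box_right {ι κ : Type} {ξ : ι → γ.space} {ξ' : ι → δ.space} {η : κ → γ.space}
    {η' : κ → δ.space} {ω ω' : A →L[ℂ] (𝔎 →L[ℂ] 𝔎)} (h : IsRep ξ ξ' ω) (h' : IsRep η η' ω')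
    (T : P →L[ℂ] P) :
    HasSum (fun k => sand (fun i => L.m.mul (ξ i) (η k)) (fun i => L'.m.mul (ξ' i) (η' k)) T)
      (sand (L.m.prod ξ η) (L'.m.prod ξ' η') T) := by
  have h1 := hasSum_sand_prod
    ((L.m.colSummable_prod h.left h'.left).comp_injective Prod.swap_injective)
    ((L'.m.colSummable_prod h.right h'.right).comp_injective Prod.swap_injective) T
  have e : sand (fun k => L.m.prod ξ η (Prod.swap k)) (fun k => L'.m.prod ξ' η' (Prod.swap k)) T =
      sand (L.m.prod ξ η) (L'.m.prod ξ' η') T := sand_comp_equiv (Equiv.prodComm κ ι) T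
  rw [e] at h1
  exact h1

/-- One factor is replaced at a time: with the index of the other factor as the outer one, every
inner sum has fixed entries of that factor and falls under the independence hypothesis. -/
theorem IsIndependent.box_eq (hL : IsIndependent L L') (x : A) {ι κ ι' κ' : Type}
    {ω ω' : A →L[ℂ] (𝔎 →L[ℂ] 𝔎)}
    {ξ : ι → γ.space} {ξ' : ι → δ.space} {η : κ → γ.space} {η' : κ → δ.space}
    {σ : ι' → γ.space} {σ' : ι' → δ.space} {τ : κ' → γ.space} {τ' : κ' → δ.space}
    (h : IsRep ξ ξ' ω) (h' : IsRep η η' ω') (hσ : IsRep σ σ' ω) (hτ : IsRep τ τ' ω') :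
    sand (L.m.prod ξ η) (L'.m.prod ξ' η') (D.π x) =
      sand (L.m.prod σ τ) (L'.m.prod σ' τ') (D.π x) := by
  have e1 : sand (L.m.prod ξ η) (L'.m.prod ξ' η') (D.π x) =
      sand (L.m.prod σ η) (L'.m.prod σ' η') (D.π x) :=
    (hasSum_box_right h h' (D.π x)).unique (hasSum_of_eq (hasSum_box_right hσ h' (D.π x)) fun k =>
      hL.left x (η k) (η' k) ω σ σ' ξ ξ' hσ h)
  have e2 : sand (L.m.prod σ η) (L'.m.prod σ' η') (D.π x) =
      sand (L.m.prod σ τ) (L'.m.prod σ' τ') (D.π x) :=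
    (hasSum_box_left hσ h' (D.π x)).unique (hasSum_of_eq (hasSum_box_left hσ hτ (D.π x)) fun k =>
      hL.right x (σ k) (σ' k) ω' τ τ' η η' hτ h')
  rw [e1, e2]

/-- The pullback of the product of balanced columns, whose squared norms are at most r r' by the
Schur bound. Independence makes the formula valid for all representations at once. -/
theorem exists_conv (L : Leg D γ.space) (L' : Leg D δ.space) (hL : IsIndependent L L')
    (ω ω' : Omega γ δ A) :
    ∃ χ : Omega γ δ A, (∀ (x : A) {ι κ : Type} (ξ : ι → γ.space) (ξ' : ι → δ.space)
      (η : κ → γ.space) (η' : κ → δ.space), IsRep ξ ξ' ω.toMap → IsRep η η' ω'.toMap →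
      χ.toMap x = sand (L.m.prod ξ η) (L'.m.prod ξ' η') (D.π x)) ∧ ‖χ‖ ≤ ‖ω‖ * ‖ω'‖ := by
  have key : ∀ {r r' : ℝ}, ω.norm < r → ω'.norm < r' →
      ∃ χ : Omega γ δ A, (∀ (x : A) {ι κ : Type} (ξ : ι → γ.space) (ξ' : ι → δ.space)
      (η : κ → γ.space) (η' : κ → δ.space), IsRep ξ ξ' ω.toMap → IsRep η η' ω'.toMap →
      χ.toMap x = sand (L.m.prod ξ η) (L'.m.prod ξ' η') (D.π x)) ∧ ‖χ‖ ≤ r * r' := by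
    intro r r' hr hr'
    have hr0 : 0 ≤ r := ω.norm_nonneg.trans hr.le
    have hr0' : 0 ≤ r' := ω'.norm_nonneg.trans hr'.le
    obtain ⟨ξ, ξ', h, hc, hd⟩ := ω.exists_isRep_lt hr
    obtain ⟨η, η', h', hc', hd'⟩ := ω'.exists_isRep_lt hr'
    obtain ⟨χ, hχ, hn⟩ := exists_pullback D.approx D.intertwine L.normal L'.normal
      (θ := L.fam ξ η) (θ' := L'.fam ξ' η') (L.m.colSummable_prod h.left h'.left)
      (L'.m.colSummable_prod h.right h'.right)
    refine ⟨χ, fun x ι κ σ σ' τ τ' hσ hτ => ?_, ?_⟩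
    · rw [hχ x]
      exact hL.box_eq x h h' hσ hτ
    · have h1 := hn (r * r') (r * r') (by positivity) (by positivity)
        (L.m.colLE_prod hr0 hr0' hc hc') (L'.m.colLE_prod hr0 hr0' hd hd')
      rwa [Real.mul_self_sqrt (by positivity)] at h1
  obtain ⟨χ, hχ, -⟩ := key (lt_add_one ω.norm) (lt_add_one ω'.norm)
  refine ⟨χ, hχ, ?_⟩
  -- Better representations give the same functional, so the bound holds for every t > 0 and passes
  -- to the limit.
  have hle : ∀ t > 0, ‖χ‖ ≤ (ω.norm + t) * (ω'.norm + t) := fun t ht => by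
    obtain ⟨χ', hχ', hn⟩ := key (lt_add_of_pos_right ω.norm ht) (lt_add_of_pos_right ω'.norm ht)
    obtain ⟨ξ, ξ', h⟩ := ω.exists_isRep
    obtain ⟨η, η', h'⟩ := ω'.exists_isRep
    have : χ = χ' := Omega.ext fun x => by rw [hχ x ξ ξ' η η' h h', hχ' x ξ ξ' η η' h h']
    rwa [this]
  have hcont : Filter.Tendsto (fun t : ℝ => (ω.norm + t) * (ω'.norm + t))
      (nhdsWithin 0 (Set.Ioi 0)) (nhds ((ω.norm + 0) * (ω'.norm + 0))) :=
    (Continuous.tendsto (by fun_prop) 0).mono_left nhdsWithin_le_nhds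
  rw [add_zero, add_zero] at hcont
  exact ge_of_tendsto hcont (Filter.eventually_of_mem self_mem_nhdsWithin hle)

/-- The convolution product. -/
noncomputable def conv (hL : IsIndependent L L') (ω ω' : Omega γ δ A) : Omega γ δ A :=
  (exists_conv L L' hL ω ω').choose

section

variable (hL : IsIndependent L L')

theorem conv_apply (ω ω' : Omega γ δ A) (x : A) {ι κ : Type} {ξ : ι → γ.space} {ξ' : ι → δ.space}
    {η : κ → γ.space} {η' : κ → δ.space} (h : IsRep ξ ξ' ω.toMap) (h' : IsRep η η' ω'.toMap) :
    (conv hL ω ω').toMap x = sand (L.m.prod ξ η) (L'.m.prod ξ' η') (D.π x) :=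
  (exists_conv L L' hL ω ω').choose_spec.1 x ξ ξ' η η' h h'

theorem norm_conv_le (ω ω' : Omega γ δ A) : ‖conv hL ω ω'‖ ≤ ‖ω‖ * ‖ω'‖ :=
  (exists_conv L L' hL ω ω').choose_spec.2

theorem conv_add (ω ω' ω'' : Omega γ δ A) :
    conv hL ω (ω' + ω'') = conv hL ω ω' + conv hL ω ω'' := Omega.ext fun x => by
  obtain ⟨ξ, ξ', h⟩ := ω.exists_isRep
  obtain ⟨η, η', h'⟩ := ω'.exists_isRep
  obtain ⟨κ, κ', h''⟩ := ω''.exists_isRep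
  have hs : IsRep _ _ (ω' + ω'').toMap := Omega.isRep_add h' h''
  change _ = (conv hL ω ω').toMap x + (conv hL ω ω'').toMap x
  rw [conv_apply hL _ _ x h hs, conv_apply hL _ _ x h h', conv_apply hL _ _ x h h'']
  refine (hasSum_box_left h hs (D.π x)).unique ?_
  refine hasSum_of_eq ((hasSum_box_left h h' (D.π x)).add (hasSum_box_left h h'' (D.π x)))
    fun i => ?_
  have e := sand_elim
    ((L.m.colSummable_prod h.left h'.left).comp_injective (Prod.mk_right_injective i))
    ((L'.m.colSummable_prod h.right h'.right).comp_injective (Prod.mk_right_injective i))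
    ((L.m.colSummable_prod h.left h''.left).comp_injective (Prod.mk_right_injective i))
    ((L'.m.colSummable_prod h.right h''.right).comp_injective (Prod.mk_right_injective i)) (D.π x)
  refine e.symm.trans ?_
  congr 1 <;> funext k <;> cases k <;> rfl

theorem add_conv (ω ω' ω'' : Omega γ δ A) :
    conv hL (ω' + ω'') ω = conv hL ω' ω + conv hL ω'' ω := Omega.ext fun x => by
  obtain ⟨ξ, ξ', h⟩ := ω.exists_isRep
  obtain ⟨η, η', h'⟩ := ω'.exists_isRep
  obtain ⟨κ, κ', h''⟩ := ω''.exists_isRep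
  have hs : IsRep _ _ (ω' + ω'').toMap := Omega.isRep_add h' h''
  change _ = (conv hL ω' ω).toMap x + (conv hL ω'' ω).toMap x
  rw [conv_apply hL _ _ x hs h, conv_apply hL _ _ x h' h, conv_apply hL _ _ x h'' h]
  refine (hasSum_box_right hs h (D.π x)).unique ?_
  refine hasSum_of_eq ((hasSum_box_right h' h (D.π x)).add (hasSum_box_right h'' h (D.π x)))
    fun i => ?_
  have e := sand_elim
    ((L.m.colSummable_prod h'.left h.left).comp_injective (Prod.mk_left_injective i))
    ((L'.m.colSummable_prod h'.right h.right).comp_injective (Prod.mk_left_injective i))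
    ((L.m.colSummable_prod h''.left h.left).comp_injective (Prod.mk_left_injective i))
    ((L'.m.colSummable_prod h''.right h.right).comp_injective (Prod.mk_left_injective i)) (D.π x)
  refine e.symm.trans ?_
  congr 1 <;> funext k <;> cases k <;> rfl

theorem smul_conv (z : ℂ) (ω ω' : Omega γ δ A) :
    conv hL (z • ω) ω' = z • conv hL ω ω' := Omega.ext fun x => by
  obtain ⟨ξ, ξ', h⟩ := ω.exists_isRep
  obtain ⟨η, η', h'⟩ := ω'.exists_isRep
  have hs : IsRep _ _ (z • ω).toMap := Omega.isRep_smul h z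
  change _ = z • (conv hL ω ω').toMap x
  rw [conv_apply hL _ _ x hs h', conv_apply hL _ _ x h h', ← sand_smul_right z
    (L.m.colSummable_prod h.left h'.left) (L'.m.colSummable_prod h.right h'.right)]
  congr 1
  funext p
  exact LinearMap.map_smul₂ L'.m.mul z (ξ' p.1) (η' p.2)

theorem conv_smul (z : ℂ) (ω ω' : Omega γ δ A) :
    conv hL ω (z • ω') = z • conv hL ω ω' := Omega.ext fun x => by
  obtain ⟨ξ, ξ', h⟩ := ω.exists_isRep
  obtain ⟨η, η', h'⟩ := ω'.exists_isRep
  have hs : IsRep _ _ (z • ω').toMap := Omega.isRep_smul h' z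
  change _ = z • (conv hL ω ω').toMap x
  rw [conv_apply hL _ _ x h hs, conv_apply hL _ _ x h h', ← sand_smul_right z
    (L.m.colSummable_prod h.left h'.left) (L'.m.colSummable_prod h.right h'.right)]
  congr 1
  funext p
  exact map_smul (L'.m.mul (ξ' p.1)) z (η' p.2)

theorem zero_conv (ω : Omega γ δ A) : conv hL 0 ω = 0 := by
  have := smul_conv hL 0 0 ω
  rwa [zero_smul, zero_smul] at this

theorem conv_zero (ω : Omega γ δ A) : conv hL ω 0 = 0 := by
  have := conv_smul hL 0 ω 0
  rwa [zero_smul, zero_smul] at this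

theorem sub_conv (ω ω' ω'' : Omega γ δ A) :
    conv hL (ω' - ω'') ω = conv hL ω' ω - conv hL ω'' ω := by
  rw [eq_sub_iff_add_eq, ← add_conv, sub_add_cancel]

theorem conv_sub (ω ω' ω'' : Omega γ δ A) :
    conv hL ω (ω' - ω'') = conv hL ω ω' - conv hL ω ω'' := by
  rw [eq_sub_iff_add_eq, ← conv_add, sub_add_cancel]

theorem norm_conv_apply_le (ω ω' : Omega γ δ A) (x : A) :
    ‖(conv hL ω ω').toMap x‖ ≤ ‖ω‖ * ‖ω'‖ * ‖x.1‖ :=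
  (Omega.norm_toMap_le _ x).trans
    (mul_le_mul_of_nonneg_right (norm_conv_le hL ω ω') (norm_nonneg _))

theorem toMap_sub_apply (ω ω' : Omega γ δ A) (x : A) :
    (ω - ω').toMap x = ω.toMap x - ω'.toMap x := by rw [Omega.toMap_sub]; rfl

/-- Needed when τ is itself a convolution product, known only as a pullback from P and not through
columns on H: amplification by the columns of ω turns its product with ω into a sandwich of the
iterated comultiplication. -/
theorem conv_apply_left {τ ω : Omega γ δ A} (x : A) {ι κ : Type} [Countable ι] {θ : ι → L.γ₂}
    {θ' : ι → L'.γ₂} (hθ : ColSummable fun i => (θ i).1) (hθ' : ColSummable fun i => (θ' i).1)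
    (hτ : ∀ x, τ.toMap x = sand (fun i => (θ i).1) (fun i => (θ' i).1) (D.π x))
    {η : κ → γ.space} {η' : κ → δ.space} (h : IsRep η η' ω.toMap) :
    (conv hL τ ω).toMap x = sand (L.mX.prod θ η) (L'.mX.prod θ' η') (D.X x) := by
  refine amplified_pullback (ℓ := L.m.ampRight η h.left) (ℓ' := L.mX.ampRight η h.left)
    (k := L'.m.ampRight η' h.right) (k' := L'.mX.ampRight η' h.right) (T := D.π x) (X := D.X x)
    (hγ := L.normal) (hδ := L'.normal) (F := fun τ => (conv hL τ ω).toMap x)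
    (C := ‖ω‖ * ‖x.1‖) D.approx D.intertwine ?_ (by positivity) (fun τ => ?_) (fun τ τ' => ?_)
    (fun τ ξ ξ' hτ' => ?_) hθ hθ' hτ
  · intro S hS
    obtain ⟨R, hR⟩ := D.exists_relX S hS
    exact ⟨R, D.X_comp S hS R hR x, L.liesOver_ampRight h.left hS hR,
      L'.liesOver_ampRight h.right hS hR⟩
  · exact (norm_conv_apply_le hL τ ω x).trans_eq (by ring)
  · rw [sub_conv, toMap_sub_apply]
  · exact conv_apply hL τ ω x hτ' h

theorem conv_apply_right {τ ω : Omega γ δ A} (x : A) {ι κ : Type} [Countable ι] {θ : ι → L.γ₂}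
    {θ' : ι → L'.γ₂} (hθ : ColSummable fun i => (θ i).1) (hθ' : ColSummable fun i => (θ' i).1)
    (hτ : ∀ x, τ.toMap x = sand (fun i => (θ i).1) (fun i => (θ' i).1) (D.π x))
    {η : κ → γ.space} {η' : κ → δ.space} (h : IsRep η η' ω.toMap) :
    (conv hL ω τ).toMap x = sand (L.mY.prod η θ) (L'.mY.prod η' θ') (D.Y x) := by
  -- The amplification lists the index of the pulled back columns first, the product family lists it
  -- second.
  rw [← sand_comp_equiv (f := L.mY.prod η θ) (g := L'.mY.prod η' θ') (Equiv.prodComm ι κ)]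
  refine amplified_pullback (ℓ := L.m.ampLeft η h.left) (ℓ' := L.mY.ampLeft η h.left)
    (k := L'.m.ampLeft η' h.right) (k' := L'.mY.ampLeft η' h.right) (T := D.π x) (X := D.Y x)
    (hγ := L.normal) (hδ := L'.normal) (F := fun τ => (conv hL ω τ).toMap x)
    (C := ‖ω‖ * ‖x.1‖) D.approx D.intertwine ?_ (by positivity) (fun τ => ?_) (fun τ τ' => ?_)
    (fun {ι} τ ξ ξ' hτ' => ?_) hθ hθ' hτ
  · intro S hS
    obtain ⟨R, hR⟩ := D.exists_relY S hS
    exact ⟨R, D.Y_comp S hS R hR x, L.liesOver_ampLeft h.left hS hR,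
      L'.liesOver_ampLeft h.right hS hR⟩
  · exact (norm_conv_apply_le hL ω τ x).trans_eq (by ring)
  · rw [conv_sub, toMap_sub_apply]
  · rw [conv_apply hL ω τ x h hτ', ← sand_comp_equiv (f := L.m.prod η ξ) (g := L'.m.prod η' ξ')
      (Equiv.prodComm ι κ)]
    rfl

/-- Each side is a sandwich of an iterated comultiplication between triple products. The triple
products correspond under U, and ⟪U u, Y U v⟫ = ⟪U u, U X v⟫ = ⟪u, X v⟫; surjectivity of U plays no
role. -/
theorem conv_assoc (ω ω' ω'' : Omega γ δ A) :
    conv hL (conv hL ω ω') ω'' = conv hL ω (conv hL ω' ω'') := Omega.ext fun x => by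
  obtain ⟨ξ, ξ', h⟩ := ω.exists_isRep
  obtain ⟨η, η', h'⟩ := ω'.exists_isRep
  obtain ⟨κ, κ', h''⟩ := ω''.exists_isRep
  have e1 := conv_apply_left hL (τ := conv hL ω ω') x (θ := L.fam ξ η) (θ' := L'.fam ξ' η')
    (L.m.colSummable_prod h.left h'.left) (L'.m.colSummable_prod h.right h'.right)
    (fun x => conv_apply hL ω ω' x h h') h''
  have e2 := conv_apply_right hL (τ := conv hL ω' ω'') x (θ := L.fam η κ) (θ' := L'.fam η' κ')
    (L.m.colSummable_prod h'.left h''.left) (L'.m.colSummable_prod h'.right h''.right)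
    (fun x => conv_apply hL ω' ω'' x h' h'') h
  rw [e1, e2, ← sand_comp_equiv (f := L.mY.prod ξ (L.fam η κ))
    (g := L'.mY.prod ξ' (L'.fam η' κ')) (Equiv.prodAssoc ℕ ℕ ℕ)]
  refine tsum_congr fun p => ?_
  beta_reduce
  have a1 : L.mY.prod ξ (L.fam η κ) (Equiv.prodAssoc ℕ ℕ ℕ p) =
      D.U ∘L L.mX.prod (L.fam ξ η) κ p := (L.assoc (ξ p.1.1) (η p.1.2) (κ p.2)).symm
  have a2 : L'.mY.prod ξ' (L'.fam η' κ') (Equiv.prodAssoc ℕ ℕ ℕ p) =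
      D.U ∘L L'.mX.prod (L'.fam ξ' η') κ' p := (L'.assoc (ξ' p.1.1) (η' p.1.2) (κ' p.2)).symm
  rw [a1, a2]
  ext v
  refine ext_inner_left ℂ fun u => ?_
  have a3 : D.Y x (D.U (L'.mX.prod (L'.fam ξ' η') κ' p v)) =
      D.U (D.X x (L'.mX.prod (L'.fam ξ' η') κ' p v)) :=
    (DFunLike.congr_fun (D.U_comp x) _).symm
  simp only [ContinuousLinearMap.comp_apply, ContinuousLinearMap.adjoint_inner_right]
  rw [a3, D.inner_U]

/-- The set `Ω_{γ,δ}(A)` is a Banach algebra with respect to convolution. -/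
theorem isBanachAlgebra_conv (prd : Omega γ δ A → Omega γ δ A → Omega γ δ A → Prop)
    (hprd : ∀ ω ω', prd ω ω' (conv hL ω ω')) :
    IsBanachAlgebra (Ω := Omega γ δ A) Omega.toMap Omega.norm prd := by
  let ring : NonUnitalNormedRing (Omega γ δ A) :=
    { (inferInstance : NormedAddCommGroup (Omega γ δ A)) with
      mul := conv hL
      left_distrib := conv_add hL
      right_distrib := fun ω ω' ω'' => add_conv hL ω'' ω ω'
      zero_mul := zero_conv hL
      mul_zero := conv_zero hL
      mul_assoc := conv_assoc hL
      norm_mul_le := norm_conv_le hL }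
  let nsp : NormedSpace ℂ (Omega γ δ A) := (inferInstance : NormedSpace ℂ (Omega γ δ A))
  exact ⟨ring, nsp, ⟨fun z ω ω' => smul_conv hL z ω ω'⟩,
    ⟨fun z ω ω' => (conv_smul hL z ω ω').symm⟩, (inferInstance : CompleteSpace (Omega γ δ A)),
    fun _ _ => rfl, fun _ _ => rfl, fun _ => rfl, hprd⟩

end

end Convolution

/-! ### Moving operators through a sandwich. -/

section SandwichComp

variable {ι E E' F F' G G' : Type*}
  [NormedAddCommGroup E] [InnerProductSpace ℂ E] [CompleteSpace E]
  [NormedAddCommGroup E'] [InnerProductSpace ℂ E'] [CompleteSpace E']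
  [NormedAddCommGroup F] [InnerProductSpace ℂ F] [CompleteSpace F]
  [NormedAddCommGroup F'] [InnerProductSpace ℂ F'] [CompleteSpace F']
  [NormedAddCommGroup G] [InnerProductSpace ℂ G] [CompleteSpace G]
  [NormedAddCommGroup G'] [InnerProductSpace ℂ G'] [CompleteSpace G']

theorem sand_comp_right {f : ι → E →L[ℂ] F} {g : ι → E' →L[ℂ] F'} (hf : ColSummable f)
    (hg : ColSummable g) (T : F' →L[ℂ] F) (k : G →L[ℂ] E') :
    sand f (fun i => g i ∘L k) T = sand f g T ∘L k := by
  refine (hasSum_sand hf (hg.comp_right k) T).unique ?_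
  exact (hasSum_sand hf hg T).mapL ((ContinuousLinearMap.compL ℂ G E' E).flip k)

theorem sand_comp_left {f : ι → E →L[ℂ] F} {g : ι → E' →L[ℂ] F'} (hf : ColSummable f)
    (hg : ColSummable g) (T : F' →L[ℂ] F) (k : G →L[ℂ] E) :
    sand (fun i => f i ∘L k) g T = (k†) ∘L sand f g T := by
  refine (hasSum_sand (hf.comp_right k) hg T).unique ?_
  refine hasSum_of_eq ((hasSum_sand hf hg T).mapL (ContinuousLinearMap.compL ℂ E' E G (k†)))
    fun i => ?_
  rw [ContinuousLinearMap.adjoint_comp]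
  rfl

theorem sand_comp_comp (f : ι → E →L[ℂ] F) (g : ι → E' →L[ℂ] F') (T : G' →L[ℂ] G) (k : F →L[ℂ] G)
    (k' : F' →L[ℂ] G') :
    sand (fun i => k ∘L f i) (fun i => k' ∘L g i) T = sand f g ((k†) ∘L T ∘L k') :=
  tsum_congr fun i => by rw [ContinuousLinearMap.adjoint_comp]; rfl

theorem sand_comp_snd (f : ι → E →L[ℂ] F) (g : ι → E' →L[ℂ] F') (T : G' →L[ℂ] F)
    (k' : F' →L[ℂ] G') :
    sand f (fun i => k' ∘L g i) T = sand f g (T ∘L k') := rfl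

end SandwichComp

/-! ### Ket operators, their products, and tensoring with the identity. -/

section Kets

variable {𝔎 V V' W W' : Type*}
  [NormedAddCommGroup 𝔎] [InnerProductSpace ℂ 𝔎] [CompleteSpace 𝔎]
  [NormedAddCommGroup V] [InnerProductSpace ℂ V] [CompleteSpace V]
  [NormedAddCommGroup V'] [InnerProductSpace ℂ V'] [CompleteSpace V']
  [NormedAddCommGroup W] [InnerProductSpace ℂ W] [CompleteSpace W]
  [NormedAddCommGroup W'] [InnerProductSpace ℂ W'] [CompleteSpace W']
  {b : CStarBase 𝔎} {α : CModule b V} {γ : CModule b.dagger W}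

theorem ket1_comp (ξ : α.space) (η : γ.space) :
    ket1 (γ := γ) ξ ∘L η.1 = ket2 (α := α) η ∘L ξ.1 := by
  ext ζ
  rw [ContinuousLinearMap.comp_apply, ContinuousLinearMap.comp_apply, ket1_apply, ket2_apply]

theorem ket1_comp_apply (ξ : α.space) (η : γ.space) (ζ : 𝔎) :
    ket1 (γ := γ) ξ (η.1 ζ) = ket2 (α := α) η (ξ.1 ζ) := by
  rw [ket1_apply, ket2_apply]

theorem ket1_add (ξ ξ' : α.space) : ket1 (γ := γ) (ξ + ξ') = ket1 ξ + ket1 ξ' := by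
  refine eq_of_eqOn_total γ.total' ?_
  rintro _ ⟨⟨η, ζ⟩, rfl⟩
  have h : ((ξ + ξ' : α.space).1) ζ = ξ.1 ζ + ξ'.1 ζ := rfl
  simp only [add_apply, ket1_comp_apply, h, map_add]

theorem ket1_smul (c : ℂ) (ξ : α.space) : ket1 (γ := γ) (c • ξ) = c • ket1 ξ := by
  refine eq_of_eqOn_total γ.total' ?_
  rintro _ ⟨⟨η, ζ⟩, rfl⟩
  have h : ((c • ξ : α.space).1) ζ = c • ξ.1 ζ := rfl
  simp only [smul_apply, ket1_comp_apply, h, map_smul]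

theorem ket2_add (η η' : γ.space) : ket2 (α := α) (η + η') = ket2 η + ket2 η' := by
  refine eq_of_eqOn_total α.total' ?_
  rintro _ ⟨⟨ξ, ζ⟩, rfl⟩
  have h : ((η + η' : γ.space).1) ζ = η.1 ζ + η'.1 ζ := rfl
  simp only [add_apply, ← ket1_comp_apply, h, map_add]

theorem ket2_smul (c : ℂ) (η : γ.space) : ket2 (α := α) (c • η) = c • ket2 η := by
  refine eq_of_eqOn_total α.total' ?_
  rintro _ ⟨⟨ξ, ζ⟩, rfl⟩
  have h : ((c • η : γ.space).1) ζ = c • η.1 ζ := rfl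
  simp only [smul_apply, ← ket1_comp_apply, h, map_smul]

/-- On ξ'ζ one has |η⟩₂ ξ'ζ = |ξ'⟩₁ ηζ, and ⟨ξ|₁ |ξ'⟩₁ = ρ_γ(ξ*ξ') sends ηζ to η ξ*ξ'ζ. This
exchange relation carries the mixed independence statements. -/
theorem adjoint_ket1_comp_ket2 (ξ : α.space) (η : γ.space) :
    ((ket1 (γ := γ) ξ)†) ∘L ket2 η = η.1 ∘L ((ξ.1)†) := by
  refine eq_of_eqOn_total α.total' ?_
  rintro _ ⟨⟨ξ', ζ⟩, rfl⟩
  have h := DFunLike.congr_fun (adjoint_ket1_comp (γ := γ) ξ ξ') (η.1 ζ)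
  simp only [ContinuousLinearMap.comp_apply] at h ⊢
  rw [← ket1_comp_apply, h, γ.rho_apply (α.inner_mem ξ ξ')]
  rfl

theorem adjoint_ket2_comp_ket1 (ξ : α.space) (η : γ.space) :
    ((ket2 (α := α) η)†) ∘L ket1 ξ = ξ.1 ∘L ((η.1)†) := by
  have h := congrArg (fun T : V →L[ℂ] W => T†) (adjoint_ket1_comp_ket2 ξ η)
  simp only [ContinuousLinearMap.adjoint_comp, ContinuousLinearMap.adjoint_adjoint] at h
  exact h

theorem CModule.sum_rho (α : CModule b V) {ι : Type*} (s : Finset ι) (y : ι → 𝔎 →L[ℂ] 𝔎)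
    (hy : ∀ i, y i ∈ b.Bd) : ∑ i ∈ s, α.rho (y i) = α.rho (∑ i ∈ s, y i) := by
  classical
  induction s using Finset.induction with
  | empty => simpa using (α.rho_smul (y := 0) (zero_mem _) 0).symm
  | insert i s hi ih =>
    rw [Finset.sum_insert hi, Finset.sum_insert hi, α.rho_add (hy i) (sum_mem fun j _ => hy j), ih]

/-- The Gram sum of the kets is ρ_γ of the Gram sum of the ξ i, and ρ_γ is norm decreasing. -/
theorem finColLE_ket1 {ι : Type*} {ξ : ι → α.space} {s : Finset ι} {c : ℝ} (hc : 0 ≤ c)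
    (h : FinColLE (fun i => (ξ i).1) s c) : FinColLE (fun i => ket1 (γ := γ) (ξ i)) s c := by
  refine (finColLE_norm _ s).mono ?_
  simp only [adjoint_ket1_comp]
  rw [γ.sum_rho s _ fun i => α.inner_mem (ξ i) (ξ i)]
  exact (γ.norm_rho_le (sum_mem fun i _ => α.inner_mem (ξ i) (ξ i))).trans
    (norm_sum_adjoint_comp_self_le hc h)

theorem finColLE_ket2 {ι : Type*} {η : ι → γ.space} {s : Finset ι} {c : ℝ} (hc : 0 ≤ c)
    (h : FinColLE (fun i => (η i).1) s c) : FinColLE (fun i => ket2 (α := α) (η i)) s c := by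
  refine (finColLE_norm _ s).mono ?_
  simp only [adjoint_ket2_comp]
  rw [α.sum_rho s _ fun i => γ.inner_mem (η i) (η i)]
  exact (α.norm_rho_le (sum_mem fun i _ => γ.inner_mem (η i) (η i))).trans
    (norm_sum_adjoint_comp_self_le hc h)

theorem colSummable_ket1 {ι : Type*} {ξ : ι → α.space} (h : ColSummable fun i => (ξ i).1) :
    ColSummable fun i => ket1 (γ := γ) (ξ i) := fun ε hε => by
  obtain ⟨s, hs⟩ := h ε hε
  exact ⟨s, fun t ht => finColLE_ket1 hε.le (hs t ht)⟩

theorem colSummable_ket2 {ι : Type*} {η : ι → γ.space} (h : ColSummable fun i => (η i).1) :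
    ColSummable fun i => ket2 (α := α) (η i) := fun ε hε => by
  obtain ⟨s, hs⟩ := h ε hε
  exact ⟨s, fun t ht => finColLE_ket2 hε.le (hs t ht)⟩

/-- The product `(ξ, η) ↦ |ξ⟩₁ η`. -/
noncomputable def legMul1 (α : CModule b V) (γ : CModule b.dagger W)
    (δ : Submodule ℂ (𝔎 →L[ℂ] W)) : LegMul α.space δ (RelTensor α γ) where
  mul := LinearMap.mk₂ ℂ (fun ξ η => ket1 ξ ∘L η.1)
    (fun ξ ξ' η => by rw [ket1_add, ContinuousLinearMap.add_comp])
    (fun c ξ η => by rw [ket1_smul, ContinuousLinearMap.smul_comp])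
    (fun ξ η η' => by rw [Submodule.coe_add, ContinuousLinearMap.comp_add])
    (fun c ξ η => by rw [Submodule.coe_smul, ContinuousLinearMap.comp_smul])
  schur ξ η s t c d hc hd hξ hη u := by
    -- The kets are summed first at the fixed vector η k u, which leaves the column of the η k.
    rw [Finset.sum_product_right]
    calc ∑ k ∈ t, ∑ i ∈ s, ‖ket1 (ξ i) ((η k).1 u)‖ ^ 2 ≤ ∑ k ∈ t, c * ‖(η k).1 u‖ ^ 2 :=
          Finset.sum_le_sum fun k _ => finColLE_ket1 (γ := γ) hc hξ _
      _ = c * ∑ k ∈ t, ‖(η k).1 u‖ ^ 2 := by rw [Finset.mul_sum]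
      _ ≤ c * (d * ‖u‖ ^ 2) := by gcongr; exact hη u
      _ = c * d * ‖u‖ ^ 2 := by ring

/-- The product `(ξ, η) ↦ |η⟩₂ ξ`. -/
noncomputable def legMul2 (α : CModule b V) (γ : CModule b.dagger W)
    (δ : Submodule ℂ (𝔎 →L[ℂ] V)) : LegMul δ γ.space (RelTensor α γ) where
  mul := LinearMap.mk₂ ℂ (fun ξ η => ket2 η ∘L ξ.1)
    (fun ξ ξ' η => by rw [Submodule.coe_add, ContinuousLinearMap.comp_add])
    (fun c ξ η => by rw [Submodule.coe_smul, ContinuousLinearMap.comp_smul])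
    (fun ξ η η' => by rw [ket2_add, ContinuousLinearMap.add_comp])
    (fun c ξ η => by rw [ket2_smul, ContinuousLinearMap.smul_comp])
  schur ξ η s t c d hc hd hξ hη u := by
    rw [Finset.sum_product]
    calc ∑ i ∈ s, ∑ k ∈ t, ‖ket2 (η k) ((ξ i).1 u)‖ ^ 2 ≤ ∑ i ∈ s, d * ‖(ξ i).1 u‖ ^ 2 :=
          Finset.sum_le_sum fun k _ => finColLE_ket2 (α := α) hd hη _
      _ = d * ∑ i ∈ s, ‖(ξ i).1 u‖ ^ 2 := by rw [Finset.mul_sum]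
      _ ≤ d * (c * ‖u‖ ^ 2) := by gcongr; exact hξ u
      _ = c * d * ‖u‖ ^ 2 := by ring

theorem legMul1_apply (δ : Submodule ℂ (𝔎 →L[ℂ] W)) (ξ : α.space) (η : δ) :
    (legMul1 α γ δ).mul ξ η = ket1 ξ ∘L η.1 := rfl

theorem legMul2_apply (δ : Submodule ℂ (𝔎 →L[ℂ] V)) (ξ : δ) (η : γ.space) :
    (legMul2 α γ δ).mul ξ η = ket2 η ∘L ξ.1 := rfl

section TensorId

variable {α' : CModule b V'} {γ' : CModule b.dagger W'}

theorem IsTensorId.comp_ket1 {S : V →L[ℂ] V'} {R : RelTensor α γ →L[ℂ] RelTensor α' γ}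
    (h : IsTensorId S R) (ξ : α.space) (hξ : S ∘L ξ.1 ∈ α'.space) :
    R ∘L ket1 ξ = ket1 ⟨S ∘L ξ.1, hξ⟩ := by
  refine eq_of_eqOn_total γ.total' ?_
  rintro _ ⟨⟨η, ζ⟩, rfl⟩
  have h1 := DFunLike.congr_fun (h η) (ξ.1 ζ)
  simp only [ContinuousLinearMap.comp_apply] at h1 ⊢
  rw [ket1_comp_apply, ket1_comp_apply, h1]
  rfl

/-- Both sides are compared on elementary tensors; S* ξ' must lie in α for the right-hand side to be
an elementary tensor again, which is why S has to be a morphism. -/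
theorem IsTensorId.adjoint {S : V →L[ℂ] V'} {R : RelTensor α γ →L[ℂ] RelTensor α' γ}
    (h : IsTensorId S R) (hS : S ∈ morphisms α α') : IsTensorId (α := α') (α' := α) (S†) (R†) := by
  intro η
  refine eq_of_eqOn_total α'.total' ?_
  rintro _ ⟨⟨ξ', ζ'⟩, rfl⟩
  refine eq_of_inner_total total_tens ?_
  rintro _ ⟨⟨ξ, ζ, η'⟩, rfl⟩
  have h1 : R (tens ξ ζ η') = tens ⟨S ∘L ξ.1, hS.1 _ ξ.2⟩ ζ η' := by
    have h2 := DFunLike.congr_fun (h η') (ξ.1 ζ)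
    simp only [ContinuousLinearMap.comp_apply] at h2
    rw [← ket2_apply, h2, ← ket2_apply]
    rfl
  have h3 : ket2 (α := α) η ((S†) (ξ'.1 ζ')) = tens ⟨(S†) ∘L ξ'.1, hS.2 _ ξ'.2⟩ ζ' η := by
    rw [← ket2_apply]; rfl
  simp only [ContinuousLinearMap.comp_apply]
  rw [ContinuousLinearMap.adjoint_inner_right, h1, h3, ket2_apply, inner_tens, inner_tens,
    α'.inner_comm' γ ⟨S ∘L ξ.1, hS.1 _ ξ.2⟩, α.inner_comm' γ, ContinuousLinearMap.adjoint_comp]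
  rfl

theorem IsIdTensor.comp_ket2 {S : W →L[ℂ] W'} {R : RelTensor α γ →L[ℂ] RelTensor α γ'}
    (h : IsIdTensor S R) (η : γ.space) (hη : S ∘L η.1 ∈ γ'.space) :
    R ∘L ket2 η = ket2 ⟨S ∘L η.1, hη⟩ := by
  refine eq_of_eqOn_total α.total' ?_
  rintro _ ⟨⟨ξ, ζ⟩, rfl⟩
  have h1 := DFunLike.congr_fun (h ξ) (η.1 ζ)
  simp only [ContinuousLinearMap.comp_apply] at h1 ⊢
  rw [← ket1_comp_apply, ← ket1_comp_apply, h1]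
  rfl

theorem IsIdTensor.adjoint {S : W →L[ℂ] W'} {R : RelTensor α γ →L[ℂ] RelTensor α γ'}
    (h : IsIdTensor S R) (hS : S ∈ morphisms γ γ') : IsIdTensor (γ := γ') (γ' := γ) (S†) (R†) := by
  intro ξ
  refine eq_of_eqOn_total γ'.total' ?_
  rintro _ ⟨⟨η', ζ'⟩, rfl⟩
  refine eq_of_inner_total total_tens ?_
  rintro _ ⟨⟨ξ', ζ, η⟩, rfl⟩
  have h1 : R (tens ξ' ζ η) = tens ξ' ζ ⟨S ∘L η.1, hS.1 _ η.2⟩ := by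
    have h2 := DFunLike.congr_fun (h ξ') (η.1 ζ)
    simp only [ContinuousLinearMap.comp_apply] at h2
    rw [← ket1_apply, h2, ← ket1_apply]
    rfl
  have h3 : ket1 (γ := γ) ξ ((S†) (η'.1 ζ')) = tens ξ ζ' ⟨(S†) ∘L η'.1, hS.2 _ η'.2⟩ := by
    rw [← ket1_apply]; rfl
  simp only [ContinuousLinearMap.comp_apply]
  rw [ContinuousLinearMap.adjoint_inner_right, h1, h3, ket1_apply, inner_tens, inner_tens,
    ContinuousLinearMap.adjoint_comp]
  rfl

end TensorId

end Kets

/-! ### The associator is isometric. -/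

section AssocIsometry

variable {𝔎 𝔏 H K L : Type*}
  [NormedAddCommGroup 𝔎] [InnerProductSpace ℂ 𝔎] [CompleteSpace 𝔎]
  [NormedAddCommGroup 𝔏] [InnerProductSpace ℂ 𝔏] [CompleteSpace 𝔏]
  [NormedAddCommGroup H] [InnerProductSpace ℂ H] [CompleteSpace H]
  [NormedAddCommGroup K] [InnerProductSpace ℂ K] [CompleteSpace K]
  [NormedAddCommGroup L] [InnerProductSpace ℂ L] [CompleteSpace L]
  {b : CStarBase 𝔎} {d : CStarBase 𝔏} (α : CModule b H) (M : Bimodule b.dagger d K)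
  (φ : CModule d.dagger L)

/-- Generators on both sides have the same Gram matrix, given by the two commuting representations
on the middle factor. -/
theorem adjoint_assoc_comp_assoc :
    ((assoc α M φ)†) ∘L assoc α M φ = ContinuousLinearMap.id ℂ _ := by
  refine eq_of_eqOn_total (total_ket2_ket1 α M φ) ?_
  rintro _ ⟨⟨η', ξ', h'⟩, rfl⟩
  refine eq_of_inner_total (total_ket2_ket1 α M φ) ?_
  rintro _ ⟨⟨η, ξ, h⟩, rfl⟩
  simp only [ContinuousLinearMap.comp_apply, ContinuousLinearMap.id_apply]
  rw [ContinuousLinearMap.adjoint_inner_right, assoc_apply, assoc_apply, inner_ket1_ket2,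
    inner_ket2_ket1]

theorem inner_assoc (u v : RelTensor (rightLeg α M.left M.right M.left_right) φ) :
    ⟪assoc α M φ u, assoc α M φ v⟫_ℂ = ⟪u, v⟫_ℂ := by
  rw [← ContinuousLinearMap.adjoint_inner_right, ← ContinuousLinearMap.comp_apply,
    adjoint_assoc_comp_assoc]
  rfl

end AssocIsometry

/-! ### Compatibility of the products with S ⊗ Id and Id ⊗ S. -/

section LegMulTensor

variable {𝔎 V V' W W' : Type*}
  [NormedAddCommGroup 𝔎] [InnerProductSpace ℂ 𝔎] [CompleteSpace 𝔎]
  [NormedAddCommGroup V] [InnerProductSpace ℂ V] [CompleteSpace V]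
  [NormedAddCommGroup V'] [InnerProductSpace ℂ V'] [CompleteSpace V']
  [NormedAddCommGroup W] [InnerProductSpace ℂ W] [CompleteSpace W]
  [NormedAddCommGroup W'] [InnerProductSpace ℂ W'] [CompleteSpace W']
  {b : CStarBase 𝔎} {α : CModule b V} {α' : CModule b V'} {γ : CModule b.dagger W}
  {γ' : CModule b.dagger W'}

theorem IsTensorId.comp_legMul1 {S : V →L[ℂ] V'} {R : RelTensor α γ →L[ℂ] RelTensor α' γ}
    (h : IsTensorId S R) (δ : Submodule ℂ (𝔎 →L[ℂ] W)) (ξ : α.space) (hξ : S ∘L ξ.1 ∈ α'.space)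
    (κ : δ) : R ∘L (legMul1 α γ δ).mul ξ κ = (legMul1 α' γ δ).mul ⟨S ∘L ξ.1, hξ⟩ κ := by
  rw [legMul1_apply, legMul1_apply, ← ContinuousLinearMap.comp_assoc, h.comp_ket1 ξ hξ]

theorem IsTensorId.comp_legMul2 {S : V →L[ℂ] V'} {R : RelTensor α γ →L[ℂ] RelTensor α' γ}
    (h : IsTensorId S R) {δ : Submodule ℂ (𝔎 →L[ℂ] V)} {δ' : Submodule ℂ (𝔎 →L[ℂ] V')} (ξ : δ)
    (hξ : S ∘L ξ.1 ∈ δ') (κ : γ.space) :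
    R ∘L (legMul2 α γ δ).mul ξ κ = (legMul2 α' γ δ').mul ⟨S ∘L ξ.1, hξ⟩ κ := by
  rw [legMul2_apply, legMul2_apply, ← ContinuousLinearMap.comp_assoc, h κ,
    ContinuousLinearMap.comp_assoc]

theorem IsIdTensor.comp_legMul1 {S : W →L[ℂ] W'} {R : RelTensor α γ →L[ℂ] RelTensor α γ'}
    (h : IsIdTensor S R) {δ : Submodule ℂ (𝔎 →L[ℂ] W)} {δ' : Submodule ℂ (𝔎 →L[ℂ] W')} (η : δ)
    (hη : S ∘L η.1 ∈ δ') (κ : α.space) :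
    R ∘L (legMul1 α γ δ).mul κ η = (legMul1 α γ' δ').mul κ ⟨S ∘L η.1, hη⟩ := by
  rw [legMul1_apply, legMul1_apply, ← ContinuousLinearMap.comp_assoc, h κ,
    ContinuousLinearMap.comp_assoc]

theorem IsIdTensor.comp_legMul2 {S : W →L[ℂ] W'} {R : RelTensor α γ →L[ℂ] RelTensor α γ'}
    (h : IsIdTensor S R) (δ : Submodule ℂ (𝔎 →L[ℂ] V)) (η : γ.space) (hη : S ∘L η.1 ∈ γ'.space)
    (κ : δ) : R ∘L (legMul2 α γ δ).mul κ η = (legMul2 α γ' δ).mul κ ⟨S ∘L η.1, hη⟩ := by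
  rw [legMul2_apply, legMul2_apply, ← ContinuousLinearMap.comp_assoc, h.comp_ket2 η hη]

end LegMulTensor

/-! ### The two legs of a normal Hopf bimodule. -/

section Hopf

variable {𝔎 H : Type*}
  [NormedAddCommGroup 𝔎] [InnerProductSpace ℂ 𝔎] [CompleteSpace 𝔎]
  [NormedAddCommGroup H] [InnerProductSpace ℂ H] [CompleteSpace H]
  {b : CStarBase 𝔎} (M : NormalHopfBimodule b H)

namespace NormalHopfBimodule

/-- The module `α ▷ α` on `H_α ⊗ βH`. -/
noncomputable abbrev right₂ : CModule b (RelTensor M.right M.left) :=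
  rightLeg M.right M.left M.right M.left_right

/-- The module `β ◁ β` on `H_α ⊗ βH`. -/
noncomputable abbrev left₂ : CModule b.dagger (RelTensor M.right M.left) :=
  leftLeg M.left M.right M.left M.right_left

theorem adjoint_Δ (x : M.A) : ((M.Δ x).1)† = (M.Δ (star x)).1 := by
  rw [map_star]; rfl

/-- The iterated comultiplications of a normal Hopf `C*`-bimodule. -/
noncomputable def comulData : ComulData M.A (RelTensor M.right M.left)
    (RelTensor M.right₂ M.left) (RelTensor M.right M.left₂) where
  π a := (M.Δ a).1
  I := jointIntertwiners M.left M.right M.A M.left₂ M.right₂ fun a => (M.Δ a).1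
  approx _ h𝒯 _ hε := exists_intertwiner_approx_unit M.adjoint_Δ _ h𝒯 hε
  intertwine _ hS := hS.1
  X a := (M.coassociative a).choose
  Y a := (M.coassociative a).choose_spec.choose
  relX S R := IsTensorId S R
  relY S R := IsIdTensor S R
  -- S ⊗ Id exists because S maps α into α ▷ α, and Id ⊗ S because S maps β into β ◁ β. Hence the
  -- intertwiners must be morphisms for both structures simultaneously.
  exists_relX _ hS := exists_isTensorId _ hS.2.2.1
  exists_relY _ hS := exists_isIdTensor _ hS.2.1.1
  X_comp S hS R hR a := (M.coassociative a).choose_spec.choose_spec.1 S hS.1 R hR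
  Y_comp S hS R hR a := (M.coassociative a).choose_spec.choose_spec.2.1 S hS.1 R hR
  U := assoc M.right M.toBimodule M.left
  inner_U := inner_assoc M.right M.toBimodule M.left
  U_comp a := (M.coassociative a).choose_spec.choose_spec.2.2

theorem comulData_π (a : M.A) : M.comulData.π a = (M.Δ a).1 := rfl

theorem ket1_mem_right₂ (ξ : M.right.space) (η : M.right.space) :
    ket1 (γ := M.left) ξ ∘L η.1 ∈ M.right₂.space := subset_clspan _ ⟨ξ, η.1, η.2, rfl⟩

theorem ket2_mem_left₂ (ξ : M.left.space) (η : M.left.space) :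
    ket2 (α := M.right) η ∘L ξ.1 ∈ M.left₂.space := subset_clspan _ ⟨η, ξ.1, ξ.2, rfl⟩

/-- On φζ with φ in β both sides become the triple tensor with entries ξ, ηζ and φ, after the
innermost kets are exchanged. -/
theorem assoc_comp_ket1 (ξ η : M.right.space) :
    assoc M.right M.toBimodule M.left ∘L
      ket1 (α := M.right₂) (γ := M.left) ⟨_, M.ket1_mem_right₂ ξ η⟩ =
    ket1 (γ := M.left₂) ξ ∘L ket1 (γ := M.left) η := by
  refine eq_of_eqOn_total M.left.total' ?_
  rintro _ ⟨⟨φ, ζ⟩, rfl⟩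
  simp only [ContinuousLinearMap.comp_apply]
  rw [ket1_comp_apply, ket1_comp_apply]
  exact assoc_apply M.right M.toBimodule M.left ξ (η.1 ζ) φ

theorem assoc_comp_ket2 (η κ : M.left.space) :
    (assoc M.right M.toBimodule M.left ∘L ket2 (α := M.right₂) κ) ∘L ket2 (α := M.right) η =
    ket2 (α := M.right) (γ := M.left₂) ⟨_, M.ket2_mem_left₂ η κ⟩ := by
  refine eq_of_eqOn_total M.right.total' ?_
  rintro _ ⟨⟨φ, ζ⟩, rfl⟩
  simp only [ContinuousLinearMap.comp_apply]
  rw [← ket1_comp_apply, ← ket1_comp_apply]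
  exact assoc_apply M.right M.toBimodule M.left φ (η.1 ζ) κ

theorem assoc_comp_legMul1 (ξ η κ : M.right.space) :
    assoc M.right M.toBimodule M.left ∘L
      (legMul1 M.right₂ M.left M.right.space).mul
        ⟨(legMul1 M.right M.left M.right.space).mul ξ η, M.ket1_mem_right₂ ξ η⟩ κ =
    (legMul1 M.right M.left₂ M.right₂.space).mul ξ
      ⟨(legMul1 M.right M.left M.right.space).mul η κ, M.ket1_mem_right₂ η κ⟩ :=
  congrArg (fun T => T ∘L κ.1) (M.assoc_comp_ket1 ξ η)

theorem assoc_comp_legMul2 (ξ η κ : M.left.space) :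
    assoc M.right M.toBimodule M.left ∘L
      (legMul2 M.right₂ M.left M.left₂.space).mul
        ⟨(legMul2 M.right M.left M.left.space).mul ξ η, M.ket2_mem_left₂ ξ η⟩ κ =
    (legMul2 M.right M.left₂ M.left.space).mul ξ
      ⟨(legMul2 M.right M.left M.left.space).mul η κ, M.ket2_mem_left₂ η κ⟩ :=
  congrArg (fun T => T ∘L ξ.1) (M.assoc_comp_ket2 η κ)

/-- The leg of the comultiplication given by `α`. -/
noncomputable def rightLegData : Leg M.comulData M.right.space where
  γ₂ := M.right₂.space
  normal := ⟨fun _ hS => hS.2.2.1, fun _ hS => hS.2.2.2, M.normal.2⟩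
  m := legMul1 M.right M.left M.right.space
  mem := M.ket1_mem_right₂
  mX := legMul1 M.right₂ M.left M.right.space
  mY := legMul1 M.right M.left₂ M.right₂.space
  mX_map _ hS _ hR φ κ := (IsTensorId.comp_legMul1 hR _ φ (hS.2.2.1 _ φ.2) κ).symm
  mX_adjoint _ hS _ hR θ κ :=
    IsTensorId.comp_legMul1 (IsTensorId.adjoint hR hS.2.2) _ θ (hS.2.2.2 _ θ.2) κ
  mY_map _ hS _ hR φ κ := (IsIdTensor.comp_legMul1 hR φ (hS.2.2.1 _ φ.2) κ).symm
  mY_adjoint _ hS _ hR θ κ :=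
    IsIdTensor.comp_legMul1 (IsIdTensor.adjoint hR hS.2.1) θ (hS.2.2.2 _ θ.2) κ
  assoc := M.assoc_comp_legMul1

/-- The leg of the comultiplication given by `β`. -/
noncomputable def leftLegData : Leg M.comulData M.left.space where
  γ₂ := M.left₂.space
  normal := ⟨fun _ hS => hS.2.1.1, fun _ hS => hS.2.1.2, M.normal.1⟩
  m := legMul2 M.right M.left M.left.space
  mem := M.ket2_mem_left₂
  mX := legMul2 M.right₂ M.left M.left₂.space
  mY := legMul2 M.right M.left₂ M.left.space
  mX_map _ hS _ hR φ κ := (IsTensorId.comp_legMul2 hR φ (hS.2.1.1 _ φ.2) κ).symm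
  mX_adjoint _ hS _ hR θ κ :=
    IsTensorId.comp_legMul2 (IsTensorId.adjoint hR hS.2.2) θ (hS.2.1.2 _ θ.2) κ
  mY_map _ hS _ hR φ κ := (IsIdTensor.comp_legMul2 hR _ φ (hS.2.1.1 _ φ.2) κ).symm
  mY_adjoint _ hS _ hR θ κ :=
    IsIdTensor.comp_legMul2 (IsIdTensor.adjoint hR hS.2.1) _ θ (hS.2.1.2 _ θ.2) κ
  assoc := M.assoc_comp_legMul2

end NormalHopfBimodule

end Hopf

/-! ### Functionals determined by their values on A. -/

section Independence

variable {𝔎 H : Type*}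
  [NormedAddCommGroup 𝔎] [InnerProductSpace ℂ 𝔎] [CompleteSpace 𝔎]
  [NormedAddCommGroup H] [InnerProductSpace ℂ H] [CompleteSpace H]
  {b c d : CStarBase 𝔎} {α : CModule b H} {γ : CModule b.dagger H}
  {A : NonUnitalStarSubalgebra ℂ (H →L[ℂ] H)} {ι κ : Type}

/-- Since ω_{ξ',ξ}(a) = ω_{ξ,ξ'}(a*)* and A is closed under adjoints, ω also determines the flipped
functional. -/
theorem IsRep.flip_eq {μ : CModule c H} {ν : CModule d H} {ξ : ι → μ.space} {ξ' : ι → ν.space}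
    {σ : κ → μ.space} {σ' : κ → ν.space} {ω : A →L[ℂ] (𝔎 →L[ℂ] 𝔎)} (h : IsRep ξ ξ' ω)
    (hσ : IsRep σ σ' ω) {a : H →L[ℂ] H} (ha : a ∈ A) :
    sand (fun i => (ξ' i).1) (fun i => (ξ i).1) a =
      sand (fun i => (σ' i).1) (fun i => (σ i).1) a := by
  have e := (h.sand_eq (star ⟨a, ha⟩)).trans (hσ.sand_eq (star ⟨a, ha⟩)).symm
  have e1 : ((star (⟨a, ha⟩ : A)).1)† = a := ContinuousLinearMap.adjoint_adjoint a
  rw [← e1, ← adjoint_sand h.left h.right, ← adjoint_sand hσ.left hσ.right, e]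

theorem IsRep.eq {μ : CModule c H} {ν : CModule d H} {ξ : ι → μ.space} {ξ' : ι → ν.space}
    {σ : κ → μ.space} {σ' : κ → ν.space} {ω : A →L[ℂ] (𝔎 →L[ℂ] 𝔎)} (h : IsRep ξ ξ' ω)
    (hσ : IsRep σ σ' ω) {a : H →L[ℂ] H} (ha : a ∈ A) :
    sand (fun i => (ξ i).1) (fun i => (ξ' i).1) a =
      sand (fun i => (σ i).1) (fun i => (σ' i).1) a :=
  (h.sand_eq ⟨a, ha⟩).trans (hσ.sand_eq ⟨a, ha⟩).symm

/-- Termwise ⟨ξ i|₁ |η⟩₂ = η (ξ i)*, so the fixed η factors out and a plain functional of a remains.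
-/
theorem sand_ket1_comp {ξ : ι → α.space} {ξ' : ι → 𝔎 →L[ℂ] H} (hξ : ColSummable fun i => (ξ i).1)
    (hξ' : ColSummable ξ') (η : γ.space) (a : H →L[ℂ] H) :
    sand (fun i => ket1 (γ := γ) (ξ i)) ξ' (ket2 η ∘L a) =
      η.1 ∘L sand (fun i => (ξ i).1) ξ' a := by
  refine (hasSum_sand (colSummable_ket1 hξ) hξ' _).unique ?_
  refine hasSum_of_eq ((hasSum_sand hξ hξ' a).mapL (ContinuousLinearMap.compL ℂ 𝔎 𝔎 H η.1))
    fun i => ?_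
  have e := congrArg (fun T => T ∘L a ∘L ξ' i) (adjoint_ket1_comp_ket2 (ξ i) η)
  exact e.symm

theorem sand_ket2_comp {η : ι → γ.space} {η' : ι → 𝔎 →L[ℂ] H} (hη : ColSummable fun i => (η i).1)
    (hη' : ColSummable η') (ξ : α.space) (a : H →L[ℂ] H) :
    sand (fun i => ket2 (α := α) (η i)) η' (ket1 ξ ∘L a) =
      ξ.1 ∘L sand (fun i => (η i).1) η' a := by
  refine (hasSum_sand (colSummable_ket2 hη) hη' _).unique ?_
  refine hasSum_of_eq ((hasSum_sand hη hη' a).mapL (ContinuousLinearMap.compL ℂ 𝔎 𝔎 H ξ.1))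
    fun i => ?_
  have e := congrArg (fun T => T ∘L a ∘L η' i) (adjoint_ket2_comp_ket1 ξ (η i))
  exact e.symm

theorem sand_eq_of_mem_clspan {E E' F F' : Type*}
    [NormedAddCommGroup E] [InnerProductSpace ℂ E] [CompleteSpace E]
    [NormedAddCommGroup E'] [InnerProductSpace ℂ E'] [CompleteSpace E']
    [NormedAddCommGroup F] [InnerProductSpace ℂ F] [CompleteSpace F]
    [NormedAddCommGroup F'] [InnerProductSpace ℂ F'] [CompleteSpace F']
    {f : ι → E →L[ℂ] F} {g : ι → E' →L[ℂ] F'} {f' : κ → E →L[ℂ] F} {g' : κ → E' →L[ℂ] F'}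
    (hf : ColSummable f) (hg : ColSummable g) (hf' : ColSummable f') (hg' : ColSummable g')
    {S : Set (F' →L[ℂ] F)} (h : ∀ T ∈ S, sand f g T = sand f' g' T) {T : F' →L[ℂ] F}
    (hT : T ∈ clspan S) : sand f g T = sand f' g' T := by
  have h1 : (sandL hf hg - sandL hf' hg') T ∈ (⊥ : Submodule ℂ (E' →L[ℂ] E)) :=
    map_mem_of_clspan (by simp) (sandL hf hg - sandL hf' hg')
      (fun Y hY => by simp [sandL_apply, h Y hY]) hT
  rw [Submodule.mem_bot, sub_apply, sub_eq_zero] at h1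
  exact h1

/-- Both sides are continuous and linear in T, so it suffices to treat T = |η⟩₂ a, where only the
values of the functionals on A enter. -/
theorem sand_ket1_eq {ξ : ι → α.space} {ξ' : ι → 𝔎 →L[ℂ] H} {σ : κ → α.space}
    {σ' : κ → 𝔎 →L[ℂ] H} (hξ : ColSummable fun i => (ξ i).1) (hξ' : ColSummable ξ')
    (hσ : ColSummable fun i => (σ i).1) (hσ' : ColSummable σ')
    (h : ∀ a ∈ A, sand (fun i => (ξ i).1) ξ' a = sand (fun i => (σ i).1) σ' a)
    {T : H →L[ℂ] RelTensor α γ} (hT : T ∈ ketSpan (fun η : γ.space => ket2 (α := α) η) A) :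
    sand (fun i => ket1 (ξ i)) ξ' T = sand (fun i => ket1 (σ i)) σ' T := by
  refine sand_eq_of_mem_clspan (colSummable_ket1 hξ) hξ' (colSummable_ket1 hσ) hσ' ?_ hT
  rintro _ ⟨η, a, ha, rfl⟩
  rw [sand_ket1_comp hξ hξ', sand_ket1_comp hσ hσ', h a ha]

theorem sand_ket2_eq {η : ι → γ.space} {η' : ι → 𝔎 →L[ℂ] H} {σ : κ → γ.space}
    {σ' : κ → 𝔎 →L[ℂ] H} (hη : ColSummable fun i => (η i).1) (hη' : ColSummable η')
    (hσ : ColSummable fun i => (σ i).1) (hσ' : ColSummable σ')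
    (h : ∀ a ∈ A, sand (fun i => (η i).1) η' a = sand (fun i => (σ i).1) σ' a)
    {T : H →L[ℂ] RelTensor α γ} (hT : T ∈ ketSpan (fun ξ : α.space => ket1 (γ := γ) ξ) A) :
    sand (fun i => ket2 (η i)) η' T = sand (fun i => ket2 (σ i)) σ' T := by
  refine sand_eq_of_mem_clspan (colSummable_ket2 hη) hη' (colSummable_ket2 hσ) hσ' ?_ hT
  rintro _ ⟨ξ, a, ha, rfl⟩
  rw [sand_ket2_comp hη hη', sand_ket2_comp hσ hσ', h a ha]

/-- Operators on `H` are determined by their matrix coefficients for a module. -/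
theorem CModule.ext_adjoint_comp (μ : CModule c H) {S T : H →L[ℂ] H}
    (h : ∀ φ φ' : μ.space, ((φ.1)†) ∘L S ∘L φ'.1 = ((φ.1)†) ∘L T ∘L φ'.1) : S = T := by
  refine eq_of_eqOn_total μ.total' ?_
  rintro _ ⟨⟨φ', ζ'⟩, rfl⟩
  refine eq_of_inner_total μ.total' ?_
  rintro _ ⟨⟨φ, ζ⟩, rfl⟩
  have e := DFunLike.congr_fun (h φ φ') ζ'
  simp only [ContinuousLinearMap.comp_apply] at e ⊢
  rw [← ContinuousLinearMap.adjoint_inner_right, e, ContinuousLinearMap.adjoint_inner_right]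

end Independence

/-! ### Well-definedness of the four products and the final identification. -/

section HopfIndependence

variable {𝔎 H : Type*}
  [NormedAddCommGroup 𝔎] [InnerProductSpace ℂ 𝔎] [CompleteSpace 𝔎]
  [NormedAddCommGroup H] [InnerProductSpace ℂ H] [CompleteSpace H]
  {b : CStarBase 𝔎} (M : NormalHopfBimodule b H) {ι κ : Type}

namespace NormalHopfBimodule

theorem comp_ket1_mem (a : M.A) (ξ : M.right.space) :
    (M.Δ a).1 ∘L ket1 ξ ∈ ketSpan (fun ξ : M.right.space => ket1 (γ := M.left) ξ) M.A :=
  ((M.Δ a).2.1 ξ).1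

theorem comp_ket2_mem (a : M.A) (η : M.left.space) :
    (M.Δ a).1 ∘L ket2 η ∈ ketSpan (fun η : M.left.space => ket2 (α := M.right) η) M.A :=
  ((M.Δ a).2.2 η).1

/-- Up to closure Δ(a)|ξ'⟩₁ is a combination of |ξ''⟩₁ x with x in A, and ⟨ξ|₁ |ξ''⟩₁ x = ρ_β(ξ*ξ'')
x stays in A. -/
theorem adjoint_ket1_comp_mem (a : M.A) (ξ ξ' : M.right.space) :
    ((ket1 (γ := M.left) ξ)†) ∘L (M.Δ a).1 ∘L ket1 ξ' ∈ M.A := by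
  refine comp_left_mem (W := M.A.toSubmodule) M.isClosed_A _ ?_ (M.comp_ket1_mem a ξ')
  rintro _ ⟨ξ'', x, hx, rfl⟩
  rw [← ContinuousLinearMap.comp_assoc, adjoint_ket1_comp]
  exact M.left_mul_mem _ (M.right.inner_mem ξ ξ'') x hx

theorem adjoint_ket2_comp_mem (a : M.A) (η η' : M.left.space) :
    ((ket2 (α := M.right) η)†) ∘L (M.Δ a).1 ∘L ket2 η' ∈ M.A := by
  refine comp_left_mem (W := M.A.toSubmodule) M.isClosed_A _ ?_ (M.comp_ket2_mem a η')
  rintro _ ⟨η'', x, hx, rfl⟩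
  rw [← ContinuousLinearMap.comp_assoc, adjoint_ket2_comp]
  exact M.right_mul_mem _ (M.left.inner_mem η η'') x hx

theorem sand_ket1_mem {ξ ξ' : ι → M.right.space} (hξ : ColSummable fun i => (ξ i).1)
    (hξ' : ColSummable fun i => (ξ' i).1) (a : M.A) :
    sand (fun i => ket1 (γ := M.left) (ξ i)) (fun i => ket1 (ξ' i)) (M.Δ a).1 ∈ M.A :=
  M.isClosed_A.mem_of_tendsto (hasSum_sand (colSummable_ket1 hξ) (colSummable_ket1 hξ') _)
    (Filter.Eventually.of_forall fun _ => sum_mem fun _ _ => M.adjoint_ket1_comp_mem a _ _)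

theorem sand_ket2_mem {η η' : ι → M.left.space} (hη : ColSummable fun i => (η i).1)
    (hη' : ColSummable fun i => (η' i).1) (a : M.A) :
    sand (fun i => ket2 (α := M.right) (η i)) (fun i => ket2 (η' i)) (M.Δ a).1 ∈ M.A :=
  M.isClosed_A.mem_of_tendsto (hasSum_sand (colSummable_ket2 hη) (colSummable_ket2 hη') _)
    (Filter.Eventually.of_forall fun _ => sum_mem fun _ _ => M.adjoint_ket2_comp_mem a _ _)

theorem sand_ket1_comp_comp {ξ ξ' : ι → M.right.space} (hξ : ColSummable fun i => (ξ i).1)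
    (hξ' : ColSummable fun i => (ξ' i).1) (T : RelTensor M.right M.left →L[ℂ] RelTensor M.right M.left)
    (k k' : 𝔎 →L[ℂ] H) :
    sand (fun i => ket1 (ξ i) ∘L k) (fun i => ket1 (ξ' i) ∘L k') T =
      (k†) ∘L sand (fun i => ket1 (ξ i)) (fun i => ket1 (ξ' i)) T ∘L k' := by
  rw [sand_comp_left (colSummable_ket1 hξ) ((colSummable_ket1 hξ').comp_right k'),
    sand_comp_right (colSummable_ket1 hξ) (colSummable_ket1 hξ')]

theorem sand_ket2_comp_comp {η η' : ι → M.left.space} (hη : ColSummable fun i => (η i).1)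
    (hη' : ColSummable fun i => (η' i).1) (T : RelTensor M.right M.left →L[ℂ] RelTensor M.right M.left)
    (k k' : 𝔎 →L[ℂ] H) :
    sand (fun i => ket2 (η i) ∘L k) (fun i => ket2 (η' i) ∘L k') T =
      (k†) ∘L sand (fun i => ket2 (η i)) (fun i => ket2 (η' i)) T ∘L k' := by
  rw [sand_comp_left (colSummable_ket2 hη) ((colSummable_ket2 hη').comp_right k'),
    sand_comp_right (colSummable_ket2 hη) (colSummable_ket2 hη')]

/-- The slices `(ω ∗ Id)(Δ(a))` do not depend on the representation of `ω`. -/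
theorem sand_ket1_congr {ω : M.A →L[ℂ] (𝔎 →L[ℂ] 𝔎)} {ξ ξ' : ι → M.right.space}
    {σ σ' : κ → M.right.space} (h : IsRep ξ ξ' ω) (hσ : IsRep σ σ' ω) (a : M.A) :
    sand (fun i => ket1 (γ := M.left) (ξ i)) (fun i => ket1 (ξ' i)) (M.Δ a).1 =
      sand (fun i => ket1 (σ i)) (fun i => ket1 (σ' i)) (M.Δ a).1 := by
  -- Testing against φ, φ' in β and exchanging kets turns the coefficient of the slice into ω
  -- evaluated at ⟨φ|₂ Δ(a) |φ'⟩₂, an element of A.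
  refine M.left.ext_adjoint_comp fun φ φ' => ?_
  rw [← M.sand_ket1_comp_comp h.left h.right, ← M.sand_ket1_comp_comp hσ.left hσ.right]
  simp only [ket1_comp]
  rw [sand_comp_comp, sand_comp_comp]
  exact h.eq hσ (M.adjoint_ket2_comp_mem a φ φ')

/-- The slices `(Id ∗ ω)(Δ(a))` do not depend on the representation of `ω`. -/
theorem sand_ket2_congr {ω : M.A →L[ℂ] (𝔎 →L[ℂ] 𝔎)} {η η' : ι → M.left.space}
    {σ σ' : κ → M.left.space} (h : IsRep η η' ω) (hσ : IsRep σ σ' ω) (a : M.A) :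
    sand (fun i => ket2 (α := M.right) (η i)) (fun i => ket2 (η' i)) (M.Δ a).1 =
      sand (fun i => ket2 (σ i)) (fun i => ket2 (σ' i)) (M.Δ a).1 := by
  refine M.right.ext_adjoint_comp fun φ φ' => ?_
  rw [← M.sand_ket2_comp_comp h.left h.right, ← M.sand_ket2_comp_comp hσ.left hσ.right]
  simp only [← ket1_comp]
  rw [sand_comp_comp, sand_comp_comp]
  exact h.eq hσ (M.adjoint_ket1_comp_mem a φ φ')

theorem rightLegData_mul (ξ η : M.right.space) :
    M.rightLegData.m.mul ξ η = ket1 (γ := M.left) ξ ∘L η.1 := rfl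

theorem leftLegData_mul (ξ η : M.left.space) :
    M.leftLegData.m.mul ξ η = ket2 (α := M.right) η ∘L ξ.1 := rfl

/-- In the first factor the columns enter through the slice (ω ∗ Id)(Δ(x)); in the second they
enclose ⟨ξ|₁ Δ(x) |ξ'⟩₁, which lies in A. -/
theorem isIndependent_right : IsIndependent M.rightLegData M.rightLegData where
  left x η η' _ _ ω ξ ξ' σ σ' h hσ := by
    simp only [rightLegData_mul, comulData_π]
    rw [M.sand_ket1_comp_comp h.left h.right, M.sand_ket1_comp_comp hσ.left hσ.right,
      M.sand_ket1_congr h hσ x]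
  right x ξ ξ' _ _ ω η η' σ σ' h hσ := by
    simp only [rightLegData_mul, comulData_π]
    rw [sand_comp_comp, sand_comp_comp]
    exact h.eq hσ (M.adjoint_ket1_comp_mem x ξ ξ')

theorem isIndependent_left : IsIndependent M.leftLegData M.leftLegData where
  left x η η' _ _ ω ξ ξ' σ σ' h hσ := by
    simp only [leftLegData_mul, comulData_π]
    rw [sand_comp_comp, sand_comp_comp]
    exact h.eq hσ (M.adjoint_ket2_comp_mem x η η')
  right x ξ ξ' _ _ ω η η' σ σ' h hσ := by
    simp only [leftLegData_mul, comulData_π]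
    rw [M.sand_ket2_comp_comp h.left h.right, M.sand_ket2_comp_comp hσ.left hσ.right,
      M.sand_ket2_congr h hσ x]

theorem sand_ket1_ket2_left {ξ : ι → M.right.space} {ξ' : ι → 𝔎 →L[ℂ] H}
    {σ : κ → M.right.space} {σ' : κ → 𝔎 →L[ℂ] H} (hξ : ColSummable fun i => (ξ i).1)
    (hξ' : ColSummable ξ') (hσ : ColSummable fun i => (σ i).1) (hσ' : ColSummable σ')
    (h : ∀ a ∈ M.A, sand (fun i => (ξ i).1) ξ' a = sand (fun i => (σ i).1) σ' a)
    (x : M.A) (η : 𝔎 →L[ℂ] H) (η' : M.left.space) :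
    sand (fun i => ket1 (ξ i) ∘L η) (fun i => ket2 η' ∘L ξ' i) (M.Δ x).1 =
      sand (fun i => ket1 (σ i) ∘L η) (fun i => ket2 η' ∘L σ' i) (M.Δ x).1 := by
  rw [sand_comp_left (colSummable_ket1 hξ) (hξ'.comp_left _),
    sand_comp_left (colSummable_ket1 hσ) (hσ'.comp_left _), sand_comp_snd, sand_comp_snd,
    sand_ket1_eq hξ hξ' hσ hσ' h (M.comp_ket2_mem x η')]

theorem sand_ket2_ket1_right {η : ι → M.left.space} {η' : ι → 𝔎 →L[ℂ] H}
    {σ : κ → M.left.space} {σ' : κ → 𝔎 →L[ℂ] H} (hη : ColSummable fun i => (η i).1)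
    (hη' : ColSummable η') (hσ : ColSummable fun i => (σ i).1) (hσ' : ColSummable σ')
    (h : ∀ a ∈ M.A, sand (fun i => (η i).1) η' a = sand (fun i => (σ i).1) σ' a)
    (x : M.A) (ξ : 𝔎 →L[ℂ] H) (ξ' : M.right.space) :
    sand (fun i => ket2 (η i) ∘L ξ) (fun i => ket1 ξ' ∘L η' i) (M.Δ x).1 =
      sand (fun i => ket2 (σ i) ∘L ξ) (fun i => ket1 ξ' ∘L σ' i) (M.Δ x).1 := by
  rw [sand_comp_left (colSummable_ket2 hη) (hη'.comp_left _),
    sand_comp_left (colSummable_ket2 hσ) (hσ'.comp_left _), sand_comp_snd, sand_comp_snd,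
    sand_ket2_eq hη hη' hσ hσ' h (M.comp_ket1_mem x ξ')]

/-- For the first factor Δ(x)|η'⟩₂ lies in [|β⟩₂ A] and meets the bras ⟨ξ i|₁. For the second the
varying kets |η' i⟩₂ stand on the right of Δ(x), so the adjoint is taken and the same argument is
applied to Δ(x*)|ξ⟩₁ with the flipped functional. -/
theorem isIndependent_right_left : IsIndependent M.rightLegData M.leftLegData where
  left x η η' _ _ ω ξ ξ' σ σ' h hσ := by
    simp only [rightLegData_mul, leftLegData_mul, comulData_π]
    exact M.sand_ket1_ket2_left h.left h.right hσ.left hσ.right (fun a ha => h.eq hσ ha) x η.1 η'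
  right x ξ ξ' _ _ ω η η' σ σ' h hσ := by
    simp only [rightLegData_mul, leftLegData_mul, comulData_π]
    have e := M.sand_ket2_ket1_right h.right h.left hσ.right hσ.left (fun a ha => h.flip_eq hσ ha)
      (star x) ξ'.1 ξ
    rw [← M.adjoint_Δ, ← adjoint_sand (h.left.comp_left _) ((colSummable_ket2 h.right).comp_right _),
      ← adjoint_sand (hσ.left.comp_left _) ((colSummable_ket2 hσ.right).comp_right _)] at e
    exact (ContinuousLinearMap.adjoint (𝕜 := ℂ)).injective e

theorem isIndependent_left_right : IsIndependent M.leftLegData M.rightLegData where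
  left x η η' _ _ ω ξ ξ' σ σ' h hσ := by
    simp only [rightLegData_mul, leftLegData_mul, comulData_π]
    have e := M.sand_ket1_ket2_left h.right h.left hσ.right hσ.left (fun a ha => h.flip_eq hσ ha)
      (star x) η'.1 η
    rw [← M.adjoint_Δ, ← adjoint_sand (h.left.comp_left _) ((colSummable_ket1 h.right).comp_right _),
      ← adjoint_sand (hσ.left.comp_left _) ((colSummable_ket1 hσ.right).comp_right _)] at e
    exact (ContinuousLinearMap.adjoint (𝕜 := ℂ)).injective e
  right x ξ ξ' _ _ ω η η' σ σ' h hσ := by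
    simp only [rightLegData_mul, leftLegData_mul, comulData_π]
    exact M.sand_ket2_ket1_right h.left h.right hσ.left hσ.right (fun a ha => h.eq hσ ha) x ξ.1 ξ'

/-- Summing the double sandwich over the index of ω first produces the slice (ω ∗ Id)(Δ(a)) in A, to
which ω' is then applied. -/
theorem isBoxRight_conv (ω ω' : Omega M.right M.right M.A) (a : M.A) :
    IsBoxRight ω ω' (M.Δ a).1 ((conv M.isIndependent_right ω ω').toMap a) := by
  obtain ⟨ξ, ξ', h⟩ := ω.exists_isRep
  obtain ⟨η, η', h'⟩ := ω'.exists_isRep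
  refine ⟨⟨_, M.sand_ket1_mem h.left h.right a⟩, fun σ σ' hσ => ?_, ?_⟩
  · rw [represents_iff] at hσ
    have e := M.sand_ket1_congr h hσ a
    have h1 := hasSum_sand (colSummable_ket1 hσ.left) (colSummable_ket1 hσ.right) (M.Δ a).1
    rw [← e] at h1
    exact h1
  · rw [conv_apply M.isIndependent_right ω ω' a h h', ← h'.sand_eq]
    refine (hasSum_box_right h h' _).unique ?_
    refine hasSum_of_eq (hasSum_sand h'.left h'.right _) fun k => ?_
    exact (M.sand_ket1_comp_comp h.left h.right (M.Δ a).1 (η k).1 (η' k).1).symm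

/-- Here the index of ω' is summed first, which gives the slice (Id ∗ ω')(Δ(a)). -/
theorem isBoxLeft_conv (ω ω' : Omega M.left M.left M.A) (a : M.A) :
    IsBoxLeft ω ω' (M.Δ a).1 ((conv M.isIndependent_left ω ω').toMap a) := by
  obtain ⟨ξ, ξ', h⟩ := ω.exists_isRep
  obtain ⟨η, η', h'⟩ := ω'.exists_isRep
  refine ⟨⟨_, M.sand_ket2_mem h'.left h'.right a⟩, fun σ σ' hσ => ?_, ?_⟩
  · rw [represents_iff] at hσ
    have e := M.sand_ket2_congr h' hσ a
    have h1 := hasSum_sand (colSummable_ket2 hσ.left) (colSummable_ket2 hσ.right) (M.Δ a).1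
    rw [← e] at h1
    exact h1
  · rw [conv_apply M.isIndependent_left ω ω' a h h', ← h.sand_eq]
    refine (hasSum_box_left h h' _).unique ?_
    refine hasSum_of_eq (hasSum_sand h.left h.right _) fun k => ?_
    exact (M.sand_ket2_comp_comp h'.left h'.right (M.Δ a).1 (ξ k).1 (ξ' k).1).symm

/-- In the mixed cases no slice is involved: the defining double sum is the sandwich of the product
columns itself. -/
theorem isBoxRightLeft_conv (ω ω' : Omega M.right M.left M.A) (a : M.A) :
    IsBoxRightLeft ω ω' (M.Δ a).1 ((conv M.isIndependent_right_left ω ω').toMap a) := by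
  intro ξ ξ' η η' h h'
  rw [represents_iff] at h h'
  rw [conv_apply M.isIndependent_right_left ω ω' a h h']
  exact hasSum_sand (M.rightLegData.m.colSummable_prod h.left h'.left)
    (M.leftLegData.m.colSummable_prod h.right h'.right) (M.Δ a).1

theorem isBoxLeftRight_conv (ω ω' : Omega M.left M.right M.A) (a : M.A) :
    IsBoxLeftRight ω ω' (M.Δ a).1 ((conv M.isIndependent_left_right ω ω').toMap a) := by
  intro ξ ξ' η η' h h'
  rw [represents_iff] at h h'
  rw [conv_apply M.isIndependent_left_right ω ω' a h h']
  exact hasSum_sand (M.leftLegData.m.colSummable_prod h.left h'.left)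
    (M.rightLegData.m.colSummable_prod h.right h'.right) (M.Δ a).1

end NormalHopfBimodule

end HopfIndependence

end CStarRel

theorem mainTheorem6 {𝔎 H : Type*}
    [NormedAddCommGroup 𝔎] [InnerProductSpace ℂ 𝔎] [CompleteSpace 𝔎]
    [NormedAddCommGroup H] [InnerProductSpace ℂ H] [CompleteSpace H]
    (b : CStarRel.CStarBase 𝔎) (M : CStarRel.NormalHopfBimodule b H) :
    CStarRel.IsBanachAlgebra
      (Ω := CStarRel.Omega M.right M.right M.A) CStarRel.Omega.toMap CStarRel.Omega.norm
      (fun ω ω' χ => ∀ a : M.A, CStarRel.IsBoxRight ω ω' (M.Δ a).1 (χ.toMap a)) ∧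
    CStarRel.IsBanachAlgebra
      (Ω := CStarRel.Omega M.left M.left M.A) CStarRel.Omega.toMap CStarRel.Omega.norm
      (fun ω ω' χ => ∀ a : M.A, CStarRel.IsBoxLeft ω ω' (M.Δ a).1 (χ.toMap a)) ∧
    CStarRel.IsBanachAlgebra
      (Ω := CStarRel.Omega M.right M.left M.A) CStarRel.Omega.toMap CStarRel.Omega.norm
      (fun ω ω' χ => ∀ a : M.A, CStarRel.IsBoxRightLeft ω ω' (M.Δ a).1 (χ.toMap a)) ∧
    CStarRel.IsBanachAlgebra
      (Ω := CStarRel.Omega M.left M.right M.A) CStarRel.Omega.toMap CStarRel.Omega.norm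
      (fun ω ω' χ => ∀ a : M.A, CStarRel.IsBoxLeftRight ω ω' (M.Δ a).1 (χ.toMap a)) := by
  exact ⟨CStarRel.isBanachAlgebra_conv M.isIndependent_right _ M.isBoxRight_conv,
    CStarRel.isBanachAlgebra_conv M.isIndependent_left _ M.isBoxLeft_conv,
    CStarRel.isBanachAlgebra_conv M.isIndependent_right_left _ M.isBoxRightLeft_conv,
    CStarRel.isBanachAlgebra_conv M.isIndependent_left_right _ M.isBoxLeftRight_conv⟩
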